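/- Let $M$ be a smooth manifold, let $E=\bigoplus_{n\in\mathbb Z}E^n$ be a graded smooth real vector bundle of finite rank over $M$, and let $\Omega(M;E)=\bigoplus_p\Omega^p(M;E)$ be the space of $E$-valued differential forms, where $\Omega^p(M;E^j)$ has total degree $p+j$. Let $(E,D)$ be a representation up to homotopy of $TM$: a linear operator $D:\Omega(M;E)\to\Omega(M;E)$ that raises the total degree by one and satisfies $D^2=0$ and $D(\alpha\wedge\eta)=d\alpha\wedge\eta+(-1)^k\alpha\wedge D\eta$ for $\alpha\in\Omega^k(M)$, $\eta\in\Omega(M;E)$. For a section $s\in\Gamma(E)=\Omega^0(M;E)$, let $\partial s$, $\nabla s$ and $\omega_2(\cdot,\cdot)s$ be the components of $Ds$ of form degree $0$, $1$ and $2$. Then $\partial$ is a bundle endomorphism making every $(E_x,\partial)$ a cochain complex, $\omega_2$ is a $2$-form with values in $\mathrm{End}(E)$, and $\nabla$ is the connection underlying $D$. Paths are continuous and piecewise smooth; homotopies of paths fix the end points and are continuous maps $h:[0,1]^2\to M$, $(\varepsilon,t)\mapsto h(\varepsilon,t)$, that are smooth on each closed rectangle of some subdivision of the square by finitely many horizontal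 and vertical lines. (1) For every path $\gamma:[0,1]\to M$ and all $s,t\in[0,1]$, the parallel transport $T_\gamma^{s,t}:E_{\gamma(s)}\to E_{\gamma(t)}$ of $\nabla$ along $\gamma$ exists and is a linear map: for every $u\in E_{\gamma(s)}$ there is a continuous section over $\gamma$ with value $u$ at time $s$ and with covariant derivative zero outside finitely many times, and every such section has the value $T_\gamma^{s,t}u$ at time $t$. If $\gamma$ goes from $x$ to $y$, then $T_\gamma=T_\gamma^{0,1}:(E_x,\partial)\to(E_y,\partial)$ is a chain map (it preserves the grading and $\partial T_\gamma=T_\gamma\partial$). If $\delta$ is a path from $y$ to $z$, then for the concatenation $\gamma*\delta$ ($\gamma$ followed by $\delta$), which is again a path, $T_{\gamma*\delta}=T_\delta\circ T_\gamma$. (2) Let $\gamma_0,\gamma_1$ be paths from $x$ to $y$ and let $h$ be a homotopy from $\gamma_0=h(0,\cdot)$ to $\gamma_1=h(1,\cdot)$. Put $\gamma_\varepsilon=h(\varepsilon,\cdot)$. Then the $\mathrm{Hom}(E_x,E_y)$-valued integrand below is integrable on the square, the linear map $$T_h=-\int_0^1\!\int_0^1 T_{\gamma_\varepsilon}^{t,1}\circ\omega_2\Big(\frac{\partial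 h}{\partial t},\frac{\partial h}{\partial\varepsilon}\Big)\circ T_{\gamma_\varepsilon}^{0,t}\,dt\,d\varepsilon:\;E_x\to E_y$$ has degree $-1$, and $$T_{\gamma_1}-T_{\gamma_0}=[\partial,T_h]=\partial\circ T_h+T_h\circ\partial .$$ In particular $T_{\gamma_0}$ and $T_{\gamma_1}$ are chain homotopic. -/

import Mathlib

open Bundle
open scoped Manifold ContDiff DirectSum Topology

noncomputable section

namespace RepHomotopy

section Forms

variable (V : Type*) [NormedAddCommGroup V] [NormedSpace ℝ V]
  (M : Type*) [TopologicalSpace M] [ChartedSpace V M] [IsManifold 𝓘(ℝ, V) ∞ M]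

/-- Smooth vector fields on `M`. -/
abbrev VField :=
  Cₛ^∞⟮𝓘(ℝ, V); V, (TangentSpace 𝓘(ℝ, V) : M → Type _)⟯

/-- The space `Ω^k(M)` of smooth scalar `k`-forms: families of alternating forms on the tangent
spaces that give a smooth function when evaluated on smooth vector fields. -/
def ScalarForm (k : ℕ) :
    Submodule ℝ (∀ x : M, (TangentSpace 𝓘(ℝ, V) x) [⋀^Fin k]→ₗ[ℝ] ℝ) where
  carrier := {α | ∀ X : Fin k → VField V M,
    ContMDiff 𝓘(ℝ, V) 𝓘(ℝ, ℝ) ∞ (fun x => α x (fun i => X i x))}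
  add_mem' ha hb X := (ha X).add (hb X)
  zero_mem' _ := contMDiff_const
  smul_mem' _ _ ha X := contMDiff_const.mul (ha X)

variable {V M} in
/-- `IsDeRham α α'` says that `α' = dα`, by the Koszul formula
`dα(X₀,…,X_k) = ∑ᵢ (-1)ⁱ Xᵢ(α(…,X̂ᵢ,…)) + ∑_{i<j} (-1)^{i+j} α([Xᵢ,Xⱼ],…,X̂ᵢ,…,X̂ⱼ,…)`.
In the second sum the bracket `[Xᵢ,Xⱼ]` is put in the place of `Xᵢ` instead of the first place,
which changes the sign by `(-1)ⁱ`. -/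
def IsDeRham {k : ℕ} (α : ScalarForm V M k) (α' : ScalarForm V M (k + 1)) : Prop :=
  ∀ (X : Fin (k + 1) → VField V M) (x : M),
    α'.1 x (fun i => X i x) =
      (∑ i : Fin (k + 1), (-1 : ℝ) ^ (i : ℕ) *
        mvfderiv 𝓘(ℝ, V) (fun y => α.1 y (fun l => X (i.succAbove l) y)) x (X i x)) +
      ∑ i : Fin (k + 1), ∑ j ∈ Finset.univ.filter (fun j : Fin (k + 1) => i < j),
        (-1 : ℝ) ^ (j : ℕ) *
          α.1 x (fun l => (Function.update (fun m => X m x) i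
            (VectorField.mlieBracket 𝓘(ℝ, V) (fun y => X i y) (fun y => X j y) x))
              (j.succAbove l))

variable {M}
variable (F : Type*) [NormedAddCommGroup F] [NormedSpace ℝ F]
  (E : M → Type*) [TopologicalSpace (TotalSpace F E)]
  [∀ x, AddCommGroup (E x)] [∀ x, Module ℝ (E x)] [∀ x, TopologicalSpace (E x)]
  [FiberBundle F E] [VectorBundle ℝ F E]

/-- Smooth sections of the vector bundle `E`. -/
abbrev Sec := Cₛ^∞⟮𝓘(ℝ, V); F, E⟯

/-- The space `Ω^p(M; E)` of smooth `E`-valued `p`-forms. -/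
def Omega (p : ℕ) :
    Submodule ℝ (∀ x : M, (TangentSpace 𝓘(ℝ, V) x) [⋀^Fin p]→ₗ[ℝ] E x) where
  carrier := {η | ∀ X : Fin p → VField V M,
    ContMDiff 𝓘(ℝ, V) (𝓘(ℝ, V).prod 𝓘(ℝ, F)) ∞
      (fun x => TotalSpace.mk' F x (η x (fun i => X i x)))}
  add_mem' ha hb X := (ha X).add_section (hb X)
  zero_mem' _ := Bundle.contMDiff_zeroSection ℝ E
  smul_mem' c _ ha X := (ha X).const_smul_section (a := c)

/-- All `E`-valued forms, `Ω(M; E) = ⨁ₚ Ω^p(M; E)`. -/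
abbrev TotalOmega := ⨁ p : ℕ, Omega V F E p

variable {V F E}

/-- A smooth section of `E`, viewed as an element of `Ω^0(M; E)`. -/
def Sec.toForm (s : Sec V F E) : Omega V F E 0 :=
  ⟨fun x => AlternatingMap.constOfIsEmpty ℝ _ (Fin 0) (s x), fun _ => s.contMDiff⟩

/-- A smooth section of `E`, viewed as an element of `Ω(M; E)`. -/
def Sec.toTotal (s : Sec V F E) : TotalOmega V F E :=
  DirectSum.lof ℝ ℕ (fun p => Omega V F E p) 0 s.toForm

/-- The wedge product of a scalar alternating form with a vector valued one (the signed sum over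
shuffles), linear in the second argument. -/
def wedgeAlt {T W : Type*} [AddCommGroup T] [Module ℝ T] [AddCommGroup W] [Module ℝ W] {k : ℕ}
    (a : T [⋀^Fin k]→ₗ[ℝ] ℝ) (q : ℕ) :
    (T [⋀^Fin q]→ₗ[ℝ] W) →ₗ[ℝ] (T [⋀^Fin (k + q)]→ₗ[ℝ] W) where
  toFun b := ((TensorProduct.lid ℝ W).toLinearMap.compAlternatingMap
    (a.domCoprod b)).domDomCongr finSumFinEquiv
  map_add' b b' := by
    simp only [← AlternatingMap.domCoprod'_apply, TensorProduct.tmul_add, map_add]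
    ext v; simp
  map_smul' c b := by
    simp only [← AlternatingMap.domCoprod'_apply, TensorProduct.tmul_smul, map_smul]
    ext v; simp

theorem wedgeAlt_smooth {k q : ℕ} (α : ScalarForm V M k) (η : Omega V F E q) :
    (fun x => wedgeAlt (α.1 x) q (η.1 x)) ∈ Omega V F E (k + q) := by
  intro X
  have key : ∀ σ : Equiv.Perm.ModSumCongr (Fin k) (Fin q),
      ContMDiff 𝓘(ℝ, V) (𝓘(ℝ, V).prod 𝓘(ℝ, F)) ∞
        (fun x => TotalSpace.mk' F x
          (TensorProduct.lid ℝ (E x) (AlternatingMap.domCoprod.summand (α.1 x) (η.1 x) σ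
            (fun i => X (finSumFinEquiv i) x)))) := by
    intro σ
    induction σ using Quotient.inductionOn' with | _ σ
    have h := ((α.2 (fun i => X (finSumFinEquiv (σ (Sum.inl i))))).smul_section
      (η.2 (fun i => X (finSumFinEquiv (σ (Sum.inr i)))))).const_smul_section
        (a := (((Equiv.Perm.sign σ : ℤˣ) : ℤ) : ℝ))
    convert! h using 2 with x
    rcases Int.units_eq_one_or (Equiv.Perm.sign σ) with hσ | hσ <;>
      simp [AlternatingMap.domCoprod.summand_mk'', hσ]
  have h := ContMDiff.sum_section (s := Finset.univ) (fun σ _ => key σ)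
  convert! h using 2 with x
  simp only [wedgeAlt, LinearMap.coe_mk, AddHom.coe_mk, AlternatingMap.domDomCongr_apply,
    LinearMap.compAlternatingMap_apply]
  rw [← map_sum]
  simp only [AlternatingMap.domCoprod, AlternatingMap.coe_mk, MultilinearMap.coe_mk,
    sum_apply]
  rfl

/-- Left multiplication `η ↦ α ∧ η` on `Ω(M; E)` by a scalar form `α`. -/
def wedge {k : ℕ} (α : ScalarForm V M k) : TotalOmega V F E →ₗ[ℝ] TotalOmega V F E :=
  DirectSum.toModule ℝ ℕ _ fun q =>
    (DirectSum.lof ℝ ℕ (fun p => Omega V F E p) (k + q)) ∘ₗ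
      { toFun := fun η => ⟨fun x => wedgeAlt (α.1 x) q (η.1 x), wedgeAlt_smooth α η⟩
        map_add' := fun a b => by ext1; funext x; exact (wedgeAlt (α.1 x) q).map_add _ _
        map_smul' := fun c a => by ext1; funext x; exact (wedgeAlt (α.1 x) q).map_smul _ _ }

end Forms

section Rep

variable (V : Type*) [NormedAddCommGroup V] [NormedSpace ℝ V]
  {M : Type*} [TopologicalSpace M] [ChartedSpace V M] [IsManifold 𝓘(ℝ, V) ∞ M]
  (F : Type*) [NormedAddCommGroup F] [NormedSpace ℝ F]
  (E : M → Type*) [TopologicalSpace (TotalSpace F E)]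
  [∀ x, AddCommGroup (E x)] [∀ x, Module ℝ (E x)] [∀ x, TopologicalSpace (E x)]
  [FiberBundle F E] [VectorBundle ℝ F E]

/-- A grading of the vector bundle `E`: a decomposition `E = ⨁ₙ Eⁿ` indexed by the integers. The
last field says that the decomposition is smooth: the degree `n` component `t` of a smooth section
`s` is a smooth section. -/
structure Grading where
  piece : ∀ x : M, ℤ → Submodule ℝ (E x)
  isInternal : ∀ x, DirectSum.IsInternal (piece x)
  smooth : ∀ (n : ℤ) (s : Sec V F E) (t : ∀ x, E x), (∀ x, t x ∈ piece x n) →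
    (∀ x, s x - t x ∈ ⨆ m : {m : ℤ // m ≠ n}, piece x m) →
    ContMDiff 𝓘(ℝ, V) (𝓘(ℝ, V).prod 𝓘(ℝ, F)) ∞ (fun x => TotalSpace.mk' F x (t x))

variable {V F E}

/-- A representation up to homotopy of `TM` on the graded vector bundle `E`: an operator `D` on
`Ω(M; E)` that raises the total degree by one, squares to zero, and satisfies the graded
derivation rule. -/
structure RepUpToHomotopy (G : Grading V F E) where
  D : TotalOmega V F E →ₗ[ℝ] TotalOmega V F E
  /-- `D` maps `Ω^p(M; E^j)` into the sum over `q` of the spaces `Ω^q(M; E^{j+p+1-q})`. -/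
  degree : ∀ (p : ℕ) (j : ℤ) (η : Omega V F E p), (∀ x v, η.1 x v ∈ G.piece x j) →
    ∀ (q : ℕ) (x : M) (w : Fin q → TangentSpace 𝓘(ℝ, V) x),
      (D (DirectSum.lof ℝ ℕ (fun p => Omega V F E p) p η) q).1 x w ∈ G.piece x (j + p + 1 - q)
  sq_zero : ∀ η, D (D η) = 0
  derivation : ∀ (k : ℕ) (α : ScalarForm V M k) (α' : ScalarForm V M (k + 1)), IsDeRham α α' →
    ∀ η, D (wedge α η) = wedge α' η + (-1 : ℝ) ^ k • wedge α (D η)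

namespace RepUpToHomotopy

variable {G : Grading V F E} (R : RepUpToHomotopy G)

/-- The part of degree `0` of `D s`, for a section `s`. -/
def delSec (s : Sec V F E) (x : M) : E x := (R.D s.toTotal 0).1 x ![]

/-- The connection underlying `D`: the part of form degree `1` of `D s`, `∇_X s = (D s)₁(X)`. -/
def nabla (s : Sec V F E) (x : M) (X : TangentSpace 𝓘(ℝ, V) x) : E x := (R.D s.toTotal 1).1 x ![X]

/-- The part of form degree `2` of `D s`, for a section `s`, evaluated on two tangent vectors. -/
def omega2Sec (s : Sec V F E) (x : M) (X Y : TangentSpace 𝓘(ℝ, V) x) : E x :=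
  (R.D s.toTotal 2).1 x ![X, Y]

/-- The differential `∂` on the fiber `E_x`: the linear map with `∂(s(x)) = (D s)₀(x)` for all
smooth sections `s`. -/
def del (x : M) : E x →ₗ[ℝ] E x :=
  Classical.epsilon fun L => ∀ s : Sec V F E, L (s x) = R.delSec s x

/-- The `End(E)`-valued `2`-form `ω₂` of `D` at `x`: the alternating form with
`ω₂(X, Y)(s(x)) = (D s)₂(X, Y)` for all smooth sections `s`. -/
def omega2 (x : M) : (TangentSpace 𝓘(ℝ, V) x) [⋀^Fin 2]→ₗ[ℝ] Module.End ℝ (E x) :=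
  Classical.epsilon fun W => ∀ (s : Sec V F E) (X Y : TangentSpace 𝓘(ℝ, V) x),
    W ![X, Y] (s x) = R.omega2Sec s x X Y

/-- The curve `σ` in the total space of `E` lies over the curve `c` near `t` and has covariant
derivative `v` at `t`: near `t`, `σ = ∑ᵢ fᵢ · (sᵢ ∘ c)` with smooth sections `sᵢ` and functions
`fᵢ` differentiable at `t`, and `v = ∑ᵢ (fᵢ'(t) sᵢ(c(t)) + fᵢ(t) ∇_{c'(t)} sᵢ)`. -/
def HasCovDerivAt (c : ℝ → M) (σ : ℝ → TotalSpace F E) (t : ℝ) (v : E (c t)) : Prop :=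
  MDifferentiableAt 𝓘(ℝ, ℝ) 𝓘(ℝ, V) c t ∧
  ∃ (n : ℕ) (s : Fin n → Sec V F E) (f : Fin n → ℝ → ℝ),
    (∀ i, DifferentiableAt ℝ (f i) t) ∧
    (∀ᶠ τ in 𝓝 t, σ τ = ⟨c τ, ∑ i, f i τ • s i (c τ)⟩) ∧
    v = ∑ i, (deriv (f i) t • s i (c t) +
      f i t • R.nabla (s i) (c t) (mfderiv 𝓘(ℝ, ℝ) 𝓘(ℝ, V) c t (1 : ℝ)))

/-- `σ` is a parallel section over the (piecewise smooth) curve `c` on `[0,1]`: it is continuous,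
lies over `c`, and has covariant derivative zero outside finitely many points. -/
def IsParallel (c : ℝ → M) (σ : ℝ → TotalSpace F E) : Prop :=
  (∀ t ∈ Set.Icc (0 : ℝ) 1, (σ t).proj = c t) ∧
  ContinuousOn σ (Set.Icc 0 1) ∧
  ∃ B : Finset ℝ, ∀ t ∈ Set.Ioo (0 : ℝ) 1, t ∉ B → R.HasCovDerivAt c σ t 0

/-- `T : E_p → E_q` is the parallel transport along `c` from time `s` (where `c` is at `p`) to
time `t` (where `c` is at `q`): through every `u` in `E_p` there is a parallel section over `c`,
and every parallel section over `c` with value `u` at `s` has value `T u` at `t`. -/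
structure IsParallelTransport (c : ℝ → M) (s t : ℝ) {p q : M} (T : E p →ₗ[ℝ] E q) : Prop where
  exists_parallel : ∀ u : E p, ∃ σ : ℝ → TotalSpace F E, R.IsParallel c σ ∧ σ s = ⟨p, u⟩
  eq_apply : ∀ (u : E p) (σ : ℝ → TotalSpace F E), R.IsParallel c σ → σ s = ⟨p, u⟩ →
    σ t = ⟨q, T u⟩

/-- The parallel transport `T_c^{s,t} : E_p → E_q`, where `p = c(s)` and `q = c(t)`. -/
def transport (c : ℝ → M) (s t : ℝ) (p q : M) : E p →ₗ[ℝ] E q :=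
  Classical.epsilon fun T => R.IsParallelTransport c s t T

/-- The global parallel transport `T_γ = T_γ^{0,1} : E_x → E_y` along a path from `x` to `y`. -/
def pathTransport {x y : M} (γ : Path x y) : E x →ₗ[ℝ] E y := R.transport γ.extend 0 1 x y

end RepUpToHomotopy

variable (V) in
/-- Piecewise smooth paths: there are finitely many break points such that the path is smooth on
every closed interval without break points in its interior. -/
def IsPiecewiseSmooth {x y : M} (γ : Path x y) : Prop :=
  ∃ B : Finset ℝ, ∀ a b : ℝ, 0 ≤ a → a < b → b ≤ 1 → (∀ r ∈ B, r ∉ Set.Ioo a b) →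
    ContMDiffOn 𝓘(ℝ, ℝ) 𝓘(ℝ, V) ∞ γ.extend (Set.Icc a b)

/-- A homotopy of paths (relative to the end points) as a map of two real variables, the homotopy
parameter `ε` and the time `t`; only its values on the unit square matter. -/
def homotopyMap {x y : M} {γ₀ γ₁ : Path x y} (h : γ₀.Homotopy γ₁) (ε t : ℝ) : M :=
  h (Set.projIcc 0 1 zero_le_one ε, Set.projIcc 0 1 zero_le_one t)

variable (V) in
/-- Piecewise smooth homotopies: the unit square is cut by finitely many horizontal and vertical
lines into closed rectangles on each of which the homotopy is smooth. -/
def IsPiecewiseSmoothHomotopy {x y : M} {γ₀ γ₁ : Path x y} (h : γ₀.Homotopy γ₁) : Prop :=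
  ∃ B C : Finset ℝ, ∀ a b a' b' : ℝ, 0 ≤ a → a < b → b ≤ 1 → 0 ≤ a' → a' < b' → b' ≤ 1 →
    (∀ r ∈ B, r ∉ Set.Ioo a b) → (∀ r ∈ C, r ∉ Set.Ioo a' b') →
    ContMDiffOn 𝓘(ℝ, ℝ × ℝ) 𝓘(ℝ, V) ∞ (fun z : ℝ × ℝ => homotopyMap h z.1 z.2)
      (Set.Icc a b ×ˢ Set.Icc a' b')

namespace RepUpToHomotopy

variable {G : Grading V F E} (R : RepUpToHomotopy G)

/-- The vector `T_{γ_ε}^{t,1} ω₂(∂h/∂t, ∂h/∂ε) T_{γ_ε}^{0,t} u` of `E_y`, where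
`γ_ε = h(ε, ·)`. -/
def homotopyIntegrand {x y : M} {γ₀ γ₁ : Path x y} (h : γ₀.Homotopy γ₁) (u : E x) (ε t : ℝ) :
    E y :=
  R.transport (homotopyMap h ε) t 1 (homotopyMap h ε t) y
    (R.omega2 (homotopyMap h ε t)
      ![mfderiv 𝓘(ℝ, ℝ) 𝓘(ℝ, V) (fun τ => homotopyMap h ε τ) t (1 : ℝ),
        mfderiv 𝓘(ℝ, ℝ) 𝓘(ℝ, V) (fun e => homotopyMap h e t) ε (1 : ℝ)]
      (R.transport (homotopyMap h ε) 0 t x (homotopyMap h ε t) u))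

/-- `T_h = -∫₀¹∫₀¹ T_{γ_ε}^{t,1} ω₂(∂h/∂t, ∂h/∂ε) T_{γ_ε}^{0,t} dt dε`. The integral of a function
with values in the finite-dimensional space `Hom(E_x, E_y)` is taken coefficientwise: for every
`u` in `E_x` and every linear functional `φ` on `E_y`. The integrability over the square is part
of the claim. -/
def IsHomotopyOperator {x y : M} {γ₀ γ₁ : Path x y} (h : γ₀.Homotopy γ₁)
    (T : E x →ₗ[ℝ] E y) : Prop :=
  ∀ (u : E x) (φ : E y →ₗ[ℝ] ℝ),
    MeasureTheory.IntegrableOn (fun z : ℝ × ℝ => φ (R.homotopyIntegrand h u z.1 z.2))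
      (Set.Icc 0 1 ×ˢ Set.Icc 0 1) ∧
    φ (T u) = -∫ ε in (0 : ℝ)..1, ∫ t in (0 : ℝ)..1, φ (R.homotopyIntegrand h u ε t)

end RepUpToHomotopy

end Rep

end RepHomotopy

end

set_option linter.unusedSectionVars false

open Bundle Set MeasureTheory Filter
open scoped Manifold ContDiff DirectSum Topology

noncomputable section

namespace RepHomotopy

/-! ### Linear ordinary differential equations with bounded measurable coefficients -/

section LinearODE

variable {X : Type*} [NormedAddCommGroup X] [NormedSpace ℝ X]

/-! Read in form degrees 0, 1 and 2, the equation `D² s = 0` says that `∂² = 0`, that `∇` commutes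
with `∂` (`nabla_delSection`), and that the curvature of `∇` on `(X, Y)` is `-(∂ ω₂(X, Y) + ω₂(X, Y)
∂)` (`sum_nabla_nabla`). To read it this way one must know `D` on forms of positive degree. Applying
`D` to `D(fη) = df ∧ η + f Dη` gives `D(df ∧ η) = -df ∧ Dη`, and a form of degree `p + 1` is locally
`1/(p + 1)` times the sum of the `df_m ∧ ι_{e_m} η`, where `e_m` are vector fields dual to the
functions `f_m`. So `D` is determined recursively by its values on sections (`D_lof_succ`).

An operator on sections that commutes with `∇` commutes with parallel transport. Applied to `∂`, and
to the projections onto the graded pieces (`nabla_prSection`), this shows that transport is a chain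
map.

For a homotopy, the derivative of `T_{γ_ε}` in `ε` is minus the time integral of a curvature term
between the transports `T^{t,1}` and `T^{0,t}`. There is no boundary term because the end points are
fixed. This term is `ω₂(∂h/∂t, ∂h/∂ε) ∂ + ∂ ω₂(∂h/∂t, ∂h/∂ε)`, and `∂` passes through both
transports, so integration over `ε` yields `∂ T_h + T_h ∂`.

The analysis takes place in one trivial bundle. Compactness provides finitely many sections and
functionals that form a redundant frame along the whole path or homotopy (`Frame.exists_good`). They
embed `E` there as the image of a projection `P` in a trivial bundle, and parallel transport becomes
a linear system with propagator `W` and inverse `Z`. Duhamel's formula differentiates `W` in `ε`,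
integration by parts turns the result into curvature (`W_one_sub_eq_integral`), and the symmetry of
mixed partial derivatives identifies that curvature with the commutator (`curvature_apply`). No Lie
bracket is ever computed. Everything is combined in `exists_homotopyOperator`. -/

theorem integral_exp_mul_le {k t : ℝ} (hk : 0 < k) :
    ∫ r in (0 : ℝ)..t, Real.exp (k * r) ≤ Real.exp (k * t) / k := by
  have h : ∀ r ∈ uIcc (0 : ℝ) t,
      HasDerivAt (fun r => Real.exp (k * r) / k) (Real.exp (k * r)) r := by
    intro r _
    have h := (((hasDerivAt_id r).const_mul k).exp).div_const k
    convert! h using 1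
    field_simp
    simp
  rw [intervalIntegral.integral_eq_sub_of_hasDerivAt h
    (Continuous.intervalIntegrable (by fun_prop) _ _)]
  have : 0 < Real.exp (k * 0) / k := by positivity
  linarith

/-- The Volterra operator of a bounded coefficient, with an exponential weight. -/
theorem norm_weighted_integral_le {A : ℝ → X →L[ℝ] X} {C k K t : ℝ} (hC : ∀ t, ‖A t‖ ≤ C)
    (hk : 0 < k) (hK : 0 ≤ K) (ht : 0 ≤ t) {v : ℝ → X} (hv : ∀ r, ‖v r‖ ≤ K) :
    ‖Real.exp (-(k * t)) • ∫ r in (0 : ℝ)..t, A r (Real.exp (k * r) • v r)‖ ≤ C / k * K := by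
  have hC0 : 0 ≤ C := (norm_nonneg _).trans (hC 0)
  have h1 : ‖∫ r in (0 : ℝ)..t, A r (Real.exp (k * r) • v r)‖ ≤
      ∫ r in (0 : ℝ)..t, C * K * Real.exp (k * r) := by
    refine intervalIntegral.norm_integral_le_of_norm_le ht ?_
      (Continuous.intervalIntegrable (by fun_prop) _ _)
    refine Eventually.of_forall fun r _ => ?_
    calc ‖A r (Real.exp (k * r) • v r)‖ ≤ ‖A r‖ * ‖Real.exp (k * r) • v r‖ := (A r).le_opNorm _
      _ = ‖A r‖ * (Real.exp (k * r) * ‖v r‖) := by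
          rw [norm_smul, Real.norm_of_nonneg (Real.exp_pos _).le]
      _ ≤ C * (Real.exp (k * r) * K) := by
          gcongr
          · exact hC r
          · exact hv r
      _ = _ := by ring
  rw [intervalIntegral.integral_const_mul] at h1
  rw [norm_smul, Real.norm_of_nonneg (Real.exp_pos _).le]
  calc _ ≤ Real.exp (-(k * t)) * (C * K * (Real.exp (k * t) / k)) := by
        gcongr
        refine h1.trans ?_
        gcongr
        exact integral_exp_mul_le hk
    _ = Real.exp (-(k * t)) * Real.exp (k * t) * (C / k * K) := by ring
    _ = _ := by rw [← Real.exp_add]; simp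

theorem intervalIntegrable_of_bounded {Y : Type*} [NormedAddCommGroup Y] {f : ℝ → Y} {C a b : ℝ}
    (B : Finset ℝ) (hm : AEStronglyMeasurable f (volume.restrict (uIoc a b)))
    (hC : ∀ t ∈ uIoc a b, t ∉ B → ‖f t‖ ≤ C) :
    IntervalIntegrable f volume a b := by
  rw [intervalIntegrable_iff]
  refine ⟨hm, ?_⟩
  refine HasFiniteIntegral.restrict_of_bounded C (by simp) ?_
  rw [ae_restrict_iff' measurableSet_uIoc]
  filter_upwards [B.finite_toSet.countable.ae_notMem volume] with t htB ht
  exact hC t ht (by simpa using htB)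

/-- The substitution `w(t) = exp(kt) v(t)` with `k = 2C + 1` gives the Volterra operator norm at
most `C/k ≤ 1/2`, so a single contraction covers the whole interval. The same estimate gives `‖v‖ ≤
‖w₀‖ + ‖v‖/2`, hence the bound. -/
theorem exists_volterra_solution [CompleteSpace X] {A : ℝ → X →L[ℝ] X} {C : ℝ}
    (hA : StronglyMeasurable A) (hC : ∀ t, ‖A t‖ ≤ C) (w₀ : X) :
    ∃ w : ℝ → X, Continuous w ∧ (∀ t ∈ Icc (0 : ℝ) 1, w t = w₀ + ∫ r in (0 : ℝ)..t, A r (w r)) ∧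
      ∀ t ∈ Icc (0 : ℝ) 1, ‖w t‖ ≤ 2 * Real.exp (2 * C + 1) * ‖w₀‖ := by
  have hC0 : 0 ≤ C := (norm_nonneg _).trans (hC 0)
  set k : ℝ := 2 * C + 1 with hk
  have hk0 : 0 < k := by positivity
  have hint : ∀ v : ℝ → X, Continuous v → ∀ a b : ℝ,
      IntervalIntegrable (fun r => A r (v r)) volume a b := by
    intro v hv a b
    obtain ⟨K, hK⟩ := isCompact_uIcc.exists_bound_of_continuousOn (s := uIcc a b) hv.continuousOn
    refine intervalIntegrable_of_bounded (C := C * K) ∅ ?_ ?_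
    · exact (isBoundedBilinearMap_apply.continuous.comp_stronglyMeasurable
        (hA.prodMk hv.stronglyMeasurable)).aestronglyMeasurable
    · intro t ht _
      exact ((A t).le_opNorm _).trans (mul_le_mul (hC t) (hK t (uIoc_subset_uIcc ht))
        (norm_nonneg _) hC0)
  let ext : C(Icc (0 : ℝ) 1, X) → ℝ → X := fun v => IccExtend zero_le_one v
  have hext : ∀ v, Continuous (ext v) := fun v => v.continuous.Icc_extend'
  let T : C(Icc (0 : ℝ) 1, X) → C(Icc (0 : ℝ) 1, X) := fun v =>
    ⟨fun t => Real.exp (-(k * t)) • (w₀ + ∫ r in (0 : ℝ)..t, A r (Real.exp (k * r) • ext v r)), by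
      have h := intervalIntegral.continuous_primitive
        (hint (fun r => Real.exp (k * r) • ext v r) (by have := hext v; fun_prop)) 0
      have h' := h.comp (continuous_subtype_val (p := fun t : ℝ => t ∈ Icc (0 : ℝ) 1))
      exact Continuous.smul (by fun_prop) (continuous_const.add h')⟩
  have hTc : ContractingWith (1 / 2) T := by
    refine ⟨by norm_num, LipschitzWith.of_dist_le_mul fun v v' => ?_⟩
    rw [ContinuousMap.dist_le (by positivity)]
    intro t
    have h : T v t - T v' t = Real.exp (-(k * t)) •
        ∫ r in (0 : ℝ)..t, A r (Real.exp (k * r) • (ext v r - ext v' r)) := by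
      simp only [T, ContinuousMap.coe_mk, smul_sub, map_sub]
      rw [intervalIntegral.integral_sub, ← smul_sub]
      · congr 1; abel
      · exact hint (fun r => Real.exp (k * r) • ext v r) (by have := hext v; fun_prop) _ _
      · exact hint (fun r => Real.exp (k * r) • ext v' r) (by have := hext v'; fun_prop) _ _
    rw [dist_eq_norm, h]
    refine (norm_weighted_integral_le hC hk0 (dist_nonneg (x := v) (y := v')) t.2.1 ?_).trans ?_
    · intro r
      rw [← dist_eq_norm]
      exact ContinuousMap.dist_apply_le_dist _
    · gcongr
      rw [div_le_iff₀ hk0]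
      simp
      linarith
  obtain ⟨v, hv⟩ : ∃ v, T v = v := ⟨hTc.fixedPoint, hTc.fixedPoint_isFixedPt⟩
  have hvt : ∀ t : Icc (0 : ℝ) 1, v t = Real.exp (-(k * t)) •
      (w₀ + ∫ r in (0 : ℝ)..t, A r (Real.exp (k * r) • ext v r)) := fun t => by
    conv_lhs => rw [← hv]
    rfl
  have hev : ∀ t (ht : t ∈ Icc (0 : ℝ) 1), ext v t = v ⟨t, ht⟩ := fun t ht =>
    IccExtend_of_mem _ _ ht
  refine ⟨fun t => Real.exp (k * t) • ext v t, by have := hext v; fun_prop, ?_, ?_⟩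
  · intro t ht
    simp only
    conv_lhs => rw [hev t ht, hvt ⟨t, ht⟩, smul_smul, ← Real.exp_add]
    simp
  · have hvn : ‖v‖ ≤ ‖w₀‖ + 1 / 2 * ‖v‖ := by
      rw [ContinuousMap.norm_le _ (by positivity)]
      intro t
      rw [hvt t, smul_add]
      refine (norm_add_le _ _).trans (add_le_add ?_ ?_)
      · rw [norm_smul, Real.norm_of_nonneg (Real.exp_pos _).le]
        refine mul_le_of_le_one_left (norm_nonneg _) (Real.exp_le_one_iff.2 ?_)
        have := mul_nonneg hk0.le t.2.1
        linarith
      · refine (norm_weighted_integral_le hC hk0 (norm_nonneg v) t.2.1 ?_).trans ?_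
        · intro r
          exact v.norm_coe_le_norm _
        · refine mul_le_mul_of_nonneg_right ?_ (norm_nonneg _)
          rw [div_le_iff₀ hk0]
          linarith
    intro t ht
    simp only
    rw [norm_smul, Real.norm_of_nonneg (Real.exp_pos _).le]
    calc Real.exp (k * t) * ‖ext v t‖ ≤ Real.exp k * (2 * ‖w₀‖) := by
          gcongr
          · have := ht.2
            nlinarith
          · rw [hev t ht]
            refine (v.norm_coe_le_norm _).trans ?_
            linarith
      _ = _ := by ring

/-- A function that is continuous on `[0,1]` and has derivative zero outside a finite set is
constant. -/
theorem eq_of_hasDerivAt_zero [CompleteSpace X] {f : ℝ → X} {B : Finset ℝ}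
    (hf : ContinuousOn f (Icc 0 1))
    (hd : ∀ t ∈ Ioo (0 : ℝ) 1, t ∉ B → HasDerivAt f 0 t) {s t : ℝ} (hs : s ∈ Icc (0 : ℝ) 1)
    (ht : t ∈ Icc (0 : ℝ) 1) : f s = f t := by
  wlog hst : s ≤ t generalizing s t
  · exact (this ht hs (le_of_not_ge hst)).symm
  have h := MeasureTheory.integral_eq_of_hasDerivAt_off_countable_of_le f (fun _ => 0) hst
    (B.finite_toSet.countable) (hf.mono (Icc_subset_Icc hs.1 ht.2))
    (fun r hr => hd r ⟨hs.1.trans_lt hr.1.1, hr.1.2.trans_le ht.2⟩ (by simpa using hr.2))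
    (by simp)
  simp at h
  exact (sub_eq_zero.1 h.symm).symm

end LinearODE

/-! ### Propagators and Duhamel's formula -/

section Propagator

variable {X : Type*} [NormedAddCommGroup X] [NormedSpace ℝ X]

/-- Coefficients of a linear ordinary differential equation on `[0,1]`: bounded, measurable and
continuous outside a finite set. -/
structure IsCoefficient (a : ℝ → X →L[ℝ] X) (B : Finset ℝ) (C : ℝ) : Prop where
  meas : StronglyMeasurable a
  nonneg : 0 ≤ C
  bound : ∀ t ∈ Ioo (0 : ℝ) 1, t ∉ B → ‖a t‖ ≤ C
  cont : ∀ t ∈ Ioo (0 : ℝ) 1, t ∉ B → ContinuousAt a t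

/-- `W` solves `W' = a W`, `W(0) = 1` on `[0,1]`, and `Z` is its inverse. -/
structure IsPropagator (a : ℝ → X →L[ℝ] X) (B : Finset ℝ) (C : ℝ) (W Z : ℝ → X →L[ℝ] X) :
    Prop where
  contW : Continuous W
  contZ : Continuous Z
  W_zero : W 0 = 1
  Z_zero : Z 0 = 1
  derivW : ∀ t ∈ Ioo (0 : ℝ) 1, t ∉ B → HasDerivAt W (a t * W t) t
  derivZ : ∀ t ∈ Ioo (0 : ℝ) 1, t ∉ B → HasDerivAt Z (-(Z t * a t)) t
  ZW : ∀ t ∈ Icc (0 : ℝ) 1, Z t * W t = 1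
  WZ : ∀ t ∈ Icc (0 : ℝ) 1, W t * Z t = 1
  boundW : ∀ t ∈ Icc (0 : ℝ) 1, ‖W t‖ ≤ 2 * Real.exp (2 * C + 1)
  boundZ : ∀ t ∈ Icc (0 : ℝ) 1, ‖Z t‖ ≤ 2 * Real.exp (2 * C + 1)

theorem exists_linearODE_solution {Y : Type*} [NormedAddCommGroup Y] [NormedSpace ℝ Y]
    [CompleteSpace Y] {A : ℝ → Y →L[ℝ] Y} {B : Finset ℝ} {C : ℝ} (hA : IsCoefficient A B C)
    (w₀ : Y) :
    ∃ w : ℝ → Y, Continuous w ∧ w 0 = w₀ ∧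
      (∀ t ∈ Ioo (0 : ℝ) 1, t ∉ B → HasDerivAt w (A t (w t)) t) ∧
      ∀ t ∈ Icc (0 : ℝ) 1, ‖w t‖ ≤ 2 * Real.exp (2 * C + 1) * ‖w₀‖ := by
  have hC0 : 0 ≤ C := hA.nonneg
  -- The coefficient is bounded only on this open set. Replacing it by zero elsewhere makes the
  -- bound global and changes nothing near a point of the set.
  let S : Set ℝ := Ioo 0 1 ∩ (B : Set ℝ)ᶜ
  have hS : IsOpen S := isOpen_Ioo.inter B.finite_toSet.isClosed.isOpen_compl
  let A' := S.indicator A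
  have hA' : StronglyMeasurable A' := hA.meas.indicator hS.measurableSet
  have hb : ∀ t, ‖A' t‖ ≤ C := fun t => by
    change ‖S.indicator A t‖ ≤ C
    by_cases ht : t ∈ S
    · rw [indicator_of_mem ht]
      exact hA.bound t ht.1 (by simpa using ht.2)
    · rw [indicator_of_notMem ht]
      simpa using hC0
  obtain ⟨w, hw, hw1, hw2⟩ := exists_volterra_solution hA' hb w₀
  refine ⟨w, hw, by simpa using hw1 0 (by simp), ?_, hw2⟩
  intro t ht htB
  have hmeas : StronglyMeasurable fun r => A' r (w r) :=
    isBoundedBilinearMap_apply.continuous.comp_stronglyMeasurable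
      (hA'.prodMk hw.stronglyMeasurable)
  have hev : A' =ᶠ[𝓝 t] A := by
    filter_upwards [hS.mem_nhds (show t ∈ S from ⟨ht, by simpa using htB⟩)] with r hr
    exact indicator_of_mem hr A
  have hcont : ContinuousAt (fun r => A' r (w r)) t :=
    ((hA.cont t ht htB).congr hev.symm).clm_apply hw.continuousAt
  obtain ⟨K, hK⟩ := isCompact_uIcc.exists_bound_of_continuousOn (s := uIcc 0 t) hw.continuousOn
  have hint : IntervalIntegrable (fun r => A' r (w r)) volume 0 t :=
    intervalIntegrable_of_bounded (C := C * K) ∅ hmeas.aestronglyMeasurable fun r hr _ =>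
      ((A' r).le_opNorm _).trans (mul_le_mul (hb r) (hK r (uIoc_subset_uIcc hr))
        (norm_nonneg _) hC0)
  have h := (intervalIntegral.integral_hasDerivAt_right hint
    hmeas.stronglyMeasurableAtFilter hcont).const_add w₀
  have h' : HasDerivAt w (A' t (w t)) t := by
    refine h.congr_of_eventuallyEq ?_
    filter_upwards [Ioo_mem_nhds ht.1 ht.2] with r hr
    exact hw1 r (Ioo_subset_Icc_self hr)
  rwa [hev.eq_of_nhds] at h'

/-- `W` and `Z` solve linear equations in the algebra of operators, whose coefficients are left
multiplication by `a` and minus right multiplication by `a`. Then `(Z W)' = 0`. -/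
theorem IsCoefficient.exists_propagator [FiniteDimensional ℝ X] {a : ℝ → X →L[ℝ] X}
    {B : Finset ℝ} {C : ℝ} (ha : IsCoefficient a B C) : ∃ W Z, IsPropagator a B C W Z := by
  have : CompleteSpace X := FiniteDimensional.complete ℝ X
  have hn : ‖(1 : X →L[ℝ] X)‖ ≤ 1 := ContinuousLinearMap.norm_id_le
  have hL : IsCoefficient (fun t => ContinuousLinearMap.mul ℝ (X →L[ℝ] X) (a t)) B C :=
    ⟨(ContinuousLinearMap.mul ℝ (X →L[ℝ] X)).continuous.comp_stronglyMeasurable ha.meas,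
      ha.nonneg, fun t ht htB =>
        (ContinuousLinearMap.opNorm_mul_apply_le ℝ _ (a t)).trans (ha.bound t ht htB),
      fun t ht htB => (ContinuousLinearMap.mul ℝ (X →L[ℝ] X)).continuous.continuousAt.comp
        (ha.cont t ht htB)⟩
  have hR : IsCoefficient (fun t => -(ContinuousLinearMap.mul ℝ (X →L[ℝ] X)).flip (a t)) B C := by
    refine ⟨?_, ha.nonneg, fun t ht htB => ?_, fun t ht htB => ?_⟩
    · exact ((ContinuousLinearMap.mul ℝ (X →L[ℝ] X)).flip.continuous.comp_stronglyMeasurable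
        ha.meas).neg
    · rw [norm_neg]
      refine (ContinuousLinearMap.opNorm_le_bound _ (norm_nonneg (a t)) fun x => ?_).trans
        (ha.bound t ht htB)
      simpa [mul_comm] using norm_mul_le x (a t)
    · exact ((ContinuousLinearMap.mul ℝ (X →L[ℝ] X)).flip.continuous.continuousAt.comp
        (ha.cont t ht htB)).neg
  obtain ⟨W, hW, hW0, hWd, hWb⟩ := exists_linearODE_solution hL 1
  obtain ⟨Z, hZ, hZ0, hZd, hZb⟩ := exists_linearODE_solution hR 1
  have hexp : ∀ {r : ℝ}, r ≤ 2 * Real.exp (2 * C + 1) * ‖(1 : X →L[ℝ] X)‖ →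
      r ≤ 2 * Real.exp (2 * C + 1) := fun h =>
    h.trans (mul_le_of_le_one_right (by positivity) hn)
  have hZW : ∀ t ∈ Icc (0 : ℝ) 1, Z t * W t = 1 := by
    intro t ht
    have h := eq_of_hasDerivAt_zero (f := fun t => Z t * W t) (B := B) (hZ.mul hW).continuousOn
      (fun r hr hrB => by
        have h := (hZd r hr hrB).mul (hWd r hr hrB)
        convert! h using 1
        simp [mul_assoc]) ht (left_mem_Icc.2 zero_le_one)
    simpa [hZ0, hW0] using h
  refine ⟨W, Z, hW, hZ, hW0, hZ0, fun t ht htB => by simpa using hWd t ht htB,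
    fun t ht htB => by simpa using hZd t ht htB, hZW, fun t ht => ?_,
    fun t ht => hexp (hWb t ht), fun t ht => hexp (hZb t ht)⟩
  have h := congrArg (fun L : X →L[ℝ] X => (L : X →ₗ[ℝ] X)) (hZW t ht)
  -- In finite dimension a one-sided inverse is two-sided.
  have h2 : ((W t : X →ₗ[ℝ] X)) * (Z t : X →ₗ[ℝ] X) = 1 := mul_eq_one_comm.1 h
  ext x
  exact congrArg (fun L : X →ₗ[ℝ] X => L x) h2

variable {a a' : ℝ → X →L[ℝ] X} {B B' : Finset ℝ} {C C' : ℝ} {W Z W' Z' : ℝ → X →L[ℝ] X}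

/-- Uniqueness of solutions of a linear ordinary differential equation. -/
theorem IsPropagator.apply_eq [CompleteSpace X] (h : IsPropagator a B C W Z) {w : ℝ → X}
    {B₁ : Finset ℝ} (hw : ContinuousOn w (Icc 0 1))
    (hd : ∀ t ∈ Ioo (0 : ℝ) 1, t ∉ B₁ → HasDerivAt w (a t (w t)) t) {s t : ℝ}
    (hs : s ∈ Icc (0 : ℝ) 1) (ht : t ∈ Icc (0 : ℝ) 1) : w t = W t (Z s (w s)) := by
  have key := eq_of_hasDerivAt_zero (f := fun t => Z t (w t)) (B := B ∪ B₁)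
    (h.contZ.continuousOn.clm_apply hw) (fun r hr hrB => by
      rw [Finset.mem_union, not_or] at hrB
      have h := (h.derivZ r hr hrB.1).clm_apply (hd r hr hrB.2)
      convert! h using 1
      simp) ht hs
  rw [← key]
  exact (congrArg (fun L : X →L[ℝ] X => L (w t)) (h.WZ t ht)).symm

theorem IsPropagator.hasDerivAt_apply (h : IsPropagator a B C W Z) (x : X) {t : ℝ}
    (ht : t ∈ Ioo (0 : ℝ) 1) (htB : t ∉ B) :
    HasDerivAt (fun t => W t x) (a t (W t x)) t := by
  simpa using (h.derivW t ht htB).clm_apply (hasDerivAt_const t x)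

/-- Duhamel's formula for the difference of two propagators. -/
theorem IsPropagator.sub_eq_integral [CompleteSpace X] (ha : IsCoefficient a B C)
    (ha' : IsCoefficient a' B' C') (h : IsPropagator a B C W Z) (h' : IsPropagator a' B' C' W' Z')
    {t : ℝ} (ht : t ∈ Icc (0 : ℝ) 1) :
    W' t - W t = W t * ∫ r in (0 : ℝ)..t, Z r * (a' r - a r) * W' r := by
  have hint : IntervalIntegrable (fun r => Z r * (a' r - a r) * W' r) volume 0 t := by
    refine intervalIntegrable_of_bounded
      (C := 2 * Real.exp (2 * C + 1) * (C' + C) * (2 * Real.exp (2 * C' + 1)))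
      (insert 1 (B ∪ B')) ?_ ?_
    · exact ((h.contZ.stronglyMeasurable.mul (ha'.meas.sub ha.meas)).mul
        h'.contW.stronglyMeasurable).aestronglyMeasurable
    · intro r hr hrB
      rw [uIoc_of_le ht.1] at hr
      simp only [Finset.mem_insert, Finset.mem_union, not_or] at hrB
      have hr' : r ∈ Icc (0 : ℝ) 1 := ⟨hr.1.le, hr.2.trans ht.2⟩
      have hr1 : r ∈ Ioo (0 : ℝ) 1 := ⟨hr.1, lt_of_le_of_ne hr'.2 hrB.1⟩
      have hCC : 0 ≤ C' + C := add_nonneg ha'.nonneg ha.nonneg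
      refine (norm_mul_le _ _).trans (mul_le_mul ((norm_mul_le _ _).trans (mul_le_mul
        (h.boundZ r hr') ((norm_sub_le _ _).trans
          (add_le_add (ha'.bound r hr1 hrB.2.2) (ha.bound r hr1 hrB.2.1)))
        (norm_nonneg _) (by positivity))) (h'.boundW r hr') (norm_nonneg _) (by positivity))
  -- Away from the break points, `(Z W')' = Z (a' - a) W'`; the terms with `a` and `a'` come from
  -- `Z` and `W'`.
  have h1 := MeasureTheory.integral_eq_of_hasDerivAt_off_countable_of_le
    (fun r => Z r * W' r) (fun r => Z r * (a' r - a r) * W' r) ht.1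
    ((B ∪ B').finite_toSet.countable) (h.contZ.mul h'.contW).continuousOn (fun r hr => by
      have hrB : r ∉ B ∧ r ∉ B' := by simpa using hr.2
      have hr' : r ∈ Ioo (0 : ℝ) 1 := ⟨hr.1.1, hr.1.2.trans_le ht.2⟩
      have h := (h.derivZ r hr' hrB.1).mul (h'.derivW r hr' hrB.2)
      convert! h using 1
      noncomm_ring) hint
  rw [h1, h.Z_zero, h'.W_zero, mul_sub, ← mul_assoc, h.WZ t ht]
  simp

end Propagator

end RepHomotopy

end

open Bundle Set MeasureTheory Filter
open scoped Manifold ContDiff DirectSum Topology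

noncomputable section

namespace RepHomotopy

/-! ### Subdivisions of the interval and of the square -/

section Subdivision

/-- `[a, b]` is a nontrivial subinterval of `[0,1]` with no point of `B` in its interior. -/
structure IsCell (B : Finset ℝ) (a b : ℝ) : Prop where
  nonneg : 0 ≤ a
  lt : a < b
  le_one : b ≤ 1
  free : ∀ r ∈ B, r ∉ Ioo a b

/-- Induction on the number of points of `B` in the open interval: cutting at such a point lowers
this number for both pieces. -/
theorem subdivision_induction (B : Finset ℝ) (P : ℝ → ℝ → Prop)
    (hcell : ∀ a b, IsCell B a b → P a b)
    (hadd : ∀ a c b, c ∈ B → 0 ≤ a → a < c → c < b → b ≤ 1 → P a c → P c b → P a b) {a b : ℝ}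
    (ha : 0 ≤ a) (hab : a < b) (hb : b ≤ 1) : P a b := by
  generalize hn : (B.filter (· ∈ Ioo a b)).card = n
  induction n using Nat.strong_induction_on generalizing a b with
  | _ n ih =>
    by_cases hfree : ∀ r ∈ B, r ∉ Ioo a b
    · exact hcell a b ⟨ha, hab, hb, hfree⟩
    · push Not at hfree
      obtain ⟨c, hcB, hc⟩ := hfree
      have h1 : (B.filter (· ∈ Ioo a c)).card < n := by
        rw [← hn]
        refine Finset.card_lt_card ⟨fun r hr => ?_, fun h => ?_⟩
        · simp only [Finset.mem_filter] at hr ⊢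
          exact ⟨hr.1, hr.2.1, hr.2.2.trans hc.2⟩
        · have := h (Finset.mem_filter.2 ⟨hcB, hc⟩)
          simp at this
      have h2 : (B.filter (· ∈ Ioo c b)).card < n := by
        rw [← hn]
        refine Finset.card_lt_card ⟨fun r hr => ?_, fun h => ?_⟩
        · simp only [Finset.mem_filter] at hr ⊢
          exact ⟨hr.1, hc.1.trans hr.2.1, hr.2.2⟩
        · have := h (Finset.mem_filter.2 ⟨hcB, hc⟩)
          simp at this
      exact hadd a c b hcB ha hc.1 hc.2 hb (ih _ h1 ha hc.1 (hc.2.le.trans hb) rfl)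
        (ih _ h2 (ha.trans hc.1.le) hc.2 hb rfl)

theorem exists_isCell {B : Finset ℝ} {t : ℝ} (ht : t ∈ Ioo (0 : ℝ) 1) (htB : t ∉ B) :
    ∃ a b, IsCell B a b ∧ t ∈ Ioo a b := by
  have h : Ioo (0 : ℝ) 1 ∩ (B : Set ℝ)ᶜ ∈ 𝓝 t :=
    (isOpen_Ioo.inter B.finite_toSet.isClosed.isOpen_compl).mem_nhds ⟨ht, by simpa using htB⟩
  obtain ⟨a, b, htab, hab⟩ := mem_nhds_iff_exists_Ioo_subset.1 h
  have hsub : Ioo a b ⊆ Ioo 0 1 := hab.trans inter_subset_left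
  have hlt : a < b := htab.1.trans htab.2
  obtain ⟨h1, h2⟩ := (Ioo_subset_Ioo_iff hlt).1 hsub
  exact ⟨a, b, ⟨h1, hlt, h2, fun r hr hr' => (hab hr').2 hr⟩, htab⟩

theorem continuousOn_of_cells {Y : Type*} [TopologicalSpace Y] {f : ℝ → Y} (B : Finset ℝ)
    (h : ∀ a b, IsCell B a b → ContinuousOn f (Icc a b)) : ContinuousOn f (Icc 0 1) := by
  refine subdivision_induction B (fun a b => ContinuousOn f (Icc a b)) h ?_ le_rfl one_pos le_rfl
  intro a c b _ _ hac hcb _ h1 h2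
  rw [← Icc_union_Icc_eq_Icc hac.le hcb.le]
  exact h1.union_of_isClosed h2 isClosed_Icc isClosed_Icc

/-- The cells are closed in the first variable and open in the second, because the bound must hold
for every value of the homotopy parameter, while finitely many times may be dropped. -/
theorem exists_bound_of_cells {Y : Type*} [NormedAddCommGroup Y] {f : ℝ × ℝ → Y} {B C : Finset ℝ}
    (h : ∀ a b a' b', IsCell B a b → IsCell C a' b' → ∃ g : ℝ × ℝ → Y,
      ContinuousOn g (Icc a b ×ˢ Icc a' b') ∧ ∀ e ∈ Icc a b, ∀ t ∈ Ioo a' b', f (e, t) = g (e, t)) :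
    ∃ K, 0 ≤ K ∧ ∀ e ∈ Icc (0 : ℝ) 1, ∀ t ∈ Ioo (0 : ℝ) 1, t ∉ C → ‖f (e, t)‖ ≤ K := by
  refine subdivision_induction B (fun a b => ∃ K, 0 ≤ K ∧ ∀ e ∈ Icc a b, ∀ t ∈ Ioo (0 : ℝ) 1,
    t ∉ C → ‖f (e, t)‖ ≤ K) ?_ ?_ le_rfl one_pos le_rfl
  · intro a b hab
    refine subdivision_induction C (fun a' b' => ∃ K, 0 ≤ K ∧ ∀ e ∈ Icc a b, ∀ t ∈ Ioo a' b',
      t ∉ C → ‖f (e, t)‖ ≤ K) ?_ ?_ le_rfl one_pos le_rfl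
    · intro a' b' hab'
      obtain ⟨g, hg, hfg⟩ := h a b a' b' hab hab'
      obtain ⟨K, hK⟩ := (isCompact_Icc.prod isCompact_Icc).exists_bound_of_continuousOn hg
      refine ⟨max K 0, le_max_right _ _, fun e he t ht _ => ?_⟩
      rw [hfg e he t ht]
      exact (hK (e, t) ⟨he, Ioo_subset_Icc_self ht⟩).trans (le_max_left _ _)
    · rintro a' c b' hcC _ hac hcb _ ⟨K, hK0, hK⟩ ⟨K', hK0', hK'⟩
      refine ⟨max K K', hK0.trans (le_max_left _ _), fun e he t ht htC => ?_⟩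
      rcases lt_or_ge t c with htc | htc
      · exact (hK e he t ⟨ht.1, htc⟩ htC).trans (le_max_left _ _)
      · have : c ≠ t := fun hct => htC (hct ▸ hcC)
        exact (hK' e he t ⟨lt_of_le_of_ne htc this, ht.2⟩ htC).trans (le_max_right _ _)
  · rintro a c b _ _ hac hcb _ ⟨K, hK0, hK⟩ ⟨K', hK0', hK'⟩
    refine ⟨max K K', hK0.trans (le_max_left _ _), fun e he t ht htC => ?_⟩
    rcases le_total e c with hec | hec
    · exact (hK e ⟨he.1, hec⟩ t ht htC).trans (le_max_left _ _)
    · exact (hK' e ⟨hec, he.2⟩ t ht htC).trans (le_max_right _ _)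

theorem exists_isCell_mem_Icc (B : Finset ℝ) {t : ℝ} (ht : t ∈ Icc (0 : ℝ) 1) :
    ∃ a b, IsCell B a b ∧ t ∈ Icc a b := by
  refine subdivision_induction B (fun a b => ∀ t ∈ Icc a b, ∃ a b, IsCell B a b ∧ t ∈ Icc a b)
    (fun a b h t ht => ⟨a, b, h, ht⟩) ?_ le_rfl one_pos le_rfl t ht
  intro a c b _ _ _ _ _ h1 h2 t ht
  rcases le_total t c with h | h
  · exact h1 t ⟨ht.1, h⟩
  · exact h2 t ⟨h, ht.2⟩

/-- A function on the square that extends continuously from the interior of each cell of a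
subdivision to the closed cell. -/
def IsCellwise {Y : Type*} [TopologicalSpace Y] (B C : Finset ℝ) (f : ℝ × ℝ → Y) : Prop :=
  ∀ a b a' b', IsCell B a b → IsCell C a' b' → ∃ g : ℝ × ℝ → Y,
    ContinuousOn g (Icc a b ×ˢ Icc a' b') ∧ EqOn f g (Ioo a b ×ˢ Ioo a' b')

theorem IsCell.prod_subset {B C : Finset ℝ} {a b a' b' : ℝ} (h : IsCell B a b)
    (h' : IsCell C a' b') : Icc a b ×ˢ Icc a' b' ⊆ Icc (0 : ℝ) 1 ×ˢ Icc (0 : ℝ) 1 :=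
  prod_mono (Icc_subset_Icc h.nonneg h.le_one) (Icc_subset_Icc h'.nonneg h'.le_one)

section Cellwise

variable {Y : Type*} [NormedAddCommGroup Y] {B C : Finset ℝ} {f g : ℝ × ℝ → Y}

theorem isCellwise_of_continuousOn (hf : ContinuousOn f (Icc 0 1 ×ˢ Icc 0 1)) :
    IsCellwise B C f :=
  fun _ _ _ _ h h' => ⟨f, hf.mono (h.prod_subset h'), fun _ _ => rfl⟩

theorem IsCellwise.congr (hf : IsCellwise B C f)
    (h : ∀ e ∈ Ioo (0 : ℝ) 1, e ∉ B → ∀ t ∈ Ioo (0 : ℝ) 1, t ∉ C → f (e, t) = g (e, t)) :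
    IsCellwise B C g := by
  intro a b a' b' hab hab'
  obtain ⟨k, hk, hfk⟩ := hf a b a' b' hab hab'
  refine ⟨k, hk, fun z hz => ?_⟩
  rw [← hfk hz]
  exact (h z.1 ⟨hab.nonneg.trans_lt hz.1.1, hz.1.2.trans_le hab.le_one⟩
    (fun hB => hab.free _ hB hz.1) z.2
    ⟨hab'.nonneg.trans_lt hz.2.1, hz.2.2.trans_le hab'.le_one⟩
    (fun hC => hab'.free _ hC hz.2)).symm

theorem IsCellwise.add (hf : IsCellwise B C f) (hg : IsCellwise B C g) :
    IsCellwise B C (fun z => f z + g z) := by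
  intro a b a' b' hab hab'
  obtain ⟨k, hk, hfk⟩ := hf a b a' b' hab hab'
  obtain ⟨l, hl, hgl⟩ := hg a b a' b' hab hab'
  exact ⟨fun z => k z + l z, hk.add hl, fun z hz => by simp only [hfk hz, hgl hz]⟩

theorem IsCellwise.sub (hf : IsCellwise B C f) (hg : IsCellwise B C g) :
    IsCellwise B C (fun z => f z - g z) := by
  intro a b a' b' hab hab'
  obtain ⟨k, hk, hfk⟩ := hf a b a' b' hab hab'
  obtain ⟨l, hl, hgl⟩ := hg a b a' b' hab hab'
  exact ⟨fun z => k z - l z, hk.sub hl, fun z hz => by simp only [hfk hz, hgl hz]⟩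

theorem IsCellwise.mul {R : Type*} [NormedRing R] {f g : ℝ × ℝ → R} (hf : IsCellwise B C f)
    (hg : IsCellwise B C g) : IsCellwise B C (fun z => f z * g z) := by
  intro a b a' b' hab hab'
  obtain ⟨k, hk, hfk⟩ := hf a b a' b' hab hab'
  obtain ⟨l, hl, hgl⟩ := hg a b a' b' hab hab'
  exact ⟨fun z => k z * l z, hk.mul hl, fun z hz => by simp only [hfk hz, hgl hz]⟩

/-- Half-open rectangles tile without overlap, and the boundary of a cell is a null set; on the open
cell the function agrees with one that is continuous on a compact set. -/
theorem IsCellwise.integrableOn (hf : IsCellwise B C f) :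
    IntegrableOn f (Icc 0 1 ×ˢ Icc 0 1) := by
  have key : IntegrableOn f (Ioc 0 1 ×ˢ Ioc 0 1) := by
    refine subdivision_induction B (fun a b => IntegrableOn f (Ioc a b ×ˢ Ioc 0 1)) ?_ ?_
      le_rfl one_pos le_rfl
    · intro a b hab
      refine subdivision_induction C (fun a' b' => IntegrableOn f (Ioc a b ×ˢ Ioc a' b')) ?_ ?_
        le_rfl one_pos le_rfl
      · intro a' b' hab'
        obtain ⟨k, hk, hfk⟩ := hf a b a' b' hab hab'
        have h1 : IntegrableOn k (Ioo a b ×ˢ Ioo a' b') :=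
          (hk.integrableOn_compact (isCompact_Icc.prod isCompact_Icc)).mono_set
            (prod_mono Ioo_subset_Icc_self Ioo_subset_Icc_self)
        have h2 : IntegrableOn f (Ioo a b ×ˢ Ioo a' b') :=
          h1.congr_fun hfk.symm (measurableSet_Ioo.prod measurableSet_Ioo)
        exact h2.congr_set_ae (Measure.set_prod_ae_eq Ioo_ae_eq_Ioc.symm Ioo_ae_eq_Ioc.symm)
      · intro a' c b' _ _ hac hcb _ h1 h2
        rw [← Ioc_union_Ioc_eq_Ioc hac.le hcb.le, prod_union]
        exact h1.union h2
    · intro a c b _ _ hac hcb _ h1 h2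
      rw [← Ioc_union_Ioc_eq_Ioc hac.le hcb.le, union_prod]
      exact h1.union h2
  exact key.congr_set_ae (Measure.set_prod_ae_eq Ioc_ae_eq_Icc.symm Ioc_ae_eq_Icc.symm)

theorem IsCellwise.intervalIntegrable_slice (hf : IsCellwise B C f) {e : ℝ}
    (he : e ∈ Ioo (0 : ℝ) 1) (heB : e ∉ B) :
    IntervalIntegrable (fun t => f (e, t)) volume 0 1 := by
  obtain ⟨p, q, hpq, hepq⟩ := exists_isCell he heB
  refine subdivision_induction C (fun a b => IntervalIntegrable (fun t => f (e, t)) volume a b)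
    ?_ ?_ le_rfl one_pos le_rfl
  · intro a b hab
    obtain ⟨k, hk, hfk⟩ := hf p q a b hpq hab
    have h1 : IntervalIntegrable (fun t => k (e, t)) volume a b :=
      ContinuousOn.intervalIntegrable_of_Icc hab.lt.le
        (hk.comp (by fun_prop) fun t ht => ⟨Ioo_subset_Icc_self hepq, ht⟩)
    rw [intervalIntegrable_iff_integrableOn_Ioo_of_le hab.lt.le] at h1 ⊢
    exact h1.congr_fun (fun t ht => (hfk ⟨hepq, ht⟩).symm) measurableSet_Ioo
  · intro a c b _ _ _ _ _ h1 h2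
    exact h1.trans h2

theorem intervalIntegrable_integral_of_integrableOn [NormedSpace ℝ Y]
    (hf : IntegrableOn f (Icc 0 1 ×ˢ Icc 0 1)) :
    IntervalIntegrable (fun e => ∫ t in (0 : ℝ)..1, f (e, t)) volume 0 1 := by
  have h : IntegrableOn f (Ioc 0 1 ×ˢ Ioc 0 1) :=
    hf.mono_set (prod_mono Ioc_subset_Icc_self Ioc_subset_Icc_self)
  rw [IntegrableOn, Measure.volume_eq_prod, ← Measure.prod_restrict] at h
  rw [intervalIntegrable_iff_integrableOn_Ioc_of_le zero_le_one]
  have h' := h.integral_prod_left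
  simp only [intervalIntegral.integral_of_le zero_le_one]
  exact h'

end Cellwise

section PartialDerivatives

variable {Y : Type*} [NormedAddCommGroup Y] [NormedSpace ℝ Y] {g : ℝ × ℝ → Y} {a b a' b' e t : ℝ}

/-- The segment in the first direction stays in the closed rectangle even when `t` is an end point,
so the derivative within the rectangle still computes a two-sided partial derivative. -/
theorem hasDerivAt_fst_of_contDiffOn (hg : ContDiffOn ℝ 1 g (Icc a b ×ˢ Icc a' b'))
    (he : e ∈ Ioo a b) (ht : t ∈ Icc a' b') :
    HasDerivAt (fun r => g (r, t)) (fderivWithin ℝ g (Icc a b ×ˢ Icc a' b') (e, t) (1, 0)) e := by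
  have h1 := ((hg.differentiableOn one_ne_zero) (e, t)
    (mk_mem_prod (Ioo_subset_Icc_self he) ht)).hasFDerivWithinAt
  have h2 : HasDerivWithinAt (fun r : ℝ => (r, t)) (1, 0) (Icc a b) e :=
    ((hasDerivAt_id e).prodMk (hasDerivAt_const e t)).hasDerivWithinAt
  exact (h1.comp_hasDerivWithinAt e h2 fun r hr => mk_mem_prod hr ht).hasDerivAt
    (Icc_mem_nhds he.1 he.2)

theorem hasDerivAt_snd_of_contDiffOn (hg : ContDiffOn ℝ 1 g (Icc a b ×ˢ Icc a' b'))
    (he : e ∈ Icc a b) (ht : t ∈ Ioo a' b') :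
    HasDerivAt (fun r => g (e, r)) (fderivWithin ℝ g (Icc a b ×ˢ Icc a' b') (e, t) (0, 1)) t := by
  have h1 := ((hg.differentiableOn one_ne_zero) (e, t)
    (mk_mem_prod he (Ioo_subset_Icc_self ht))).hasFDerivWithinAt
  have h2 : HasDerivWithinAt (fun r : ℝ => (e, r)) (0, 1) (Icc a' b') t :=
    ((hasDerivAt_const t e).prodMk (hasDerivAt_id t)).hasDerivWithinAt
  exact (h1.comp_hasDerivWithinAt t h2 fun r hr => mk_mem_prod he hr).hasDerivAt
    (Icc_mem_nhds ht.1 ht.2)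

theorem uniqueDiffOn_rectangle (hab : a < b) (hab' : a' < b') :
    UniqueDiffOn ℝ (Icc a b ×ˢ Icc a' b') :=
  (uniqueDiffOn_Icc hab).prod (uniqueDiffOn_Icc hab')

theorem continuousOn_fderivWithin_apply (hg : ContDiffOn ℝ 1 g (Icc a b ×ˢ Icc a' b'))
    (hab : a < b) (hab' : a' < b') (v : ℝ × ℝ) :
    ContinuousOn (fun z => fderivWithin ℝ g (Icc a b ×ˢ Icc a' b') z v)
      (Icc a b ×ˢ Icc a' b') :=
  (hg.continuousOn_fderivWithin (uniqueDiffOn_rectangle hab hab') le_rfl).clm_apply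
    continuousOn_const

end PartialDerivatives

end Subdivision

end RepHomotopy

end

open Bundle Set MeasureTheory Filter
open scoped Manifold ContDiff DirectSum Topology

noncomputable section

namespace RepHomotopy

/-! ### Variation of the propagator in a family -/

section Variation

variable {X : Type*} [NormedAddCommGroup X] [NormedSpace ℝ X]

/-- Coefficients in the two directions of the unit square of a connection on a trivial bundle that
is pulled back along a piecewise smooth homotopy with fixed end points. -/
structure IsHomotopyCoefficient (B C : Finset ℝ) (Gt Ge : ℝ → ℝ → X →L[ℝ] X) : Prop where
  -- Each coefficient may be wrong only on the break lines across its own direction. `Gt` must be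
  -- controlled for every `e`, since every curve needs a propagator, and `Ge` for every `t`, since
  -- it is integrated by parts over `[0,1]`.
  cell_t : ∀ a b a' b', IsCell B a b → IsCell C a' b' → ∃ g : ℝ × ℝ → X →L[ℝ] X,
    ContDiffOn ℝ 1 g (Icc a b ×ˢ Icc a' b') ∧ ∀ e ∈ Icc a b, ∀ t ∈ Ioo a' b', Gt e t = g (e, t)
  cell_e : ∀ a b a' b', IsCell B a b → IsCell C a' b' → ∃ g : ℝ × ℝ → X →L[ℝ] X,
    ContDiffOn ℝ 1 g (Icc a b ×ˢ Icc a' b') ∧ ∀ e ∈ Ioo a b, ∀ t ∈ Icc a' b', Ge e t = g (e, t)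
  meas : ∀ e, StronglyMeasurable (Gt e)
  left : ∀ e ∈ Ioo (0 : ℝ) 1, Ge e 0 = 0
  right : ∀ e ∈ Ioo (0 : ℝ) 1, Ge e 1 = 0

/-- The curvature of the connection with coefficients `Gt` and `Ge`. -/
def curvature (Gt Ge : ℝ → ℝ → X →L[ℝ] X) (e t : ℝ) : X →L[ℝ] X :=
  deriv (fun r => Ge e r) t - deriv (fun r => Gt r t) e + Ge e t * Gt e t - Gt e t * Ge e t

namespace IsHomotopyCoefficient

variable {B C : Finset ℝ} {Gt Ge : ℝ → ℝ → X →L[ℝ] X} (h : IsHomotopyCoefficient B C Gt Ge)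
include h

theorem continuousOn_fst {t : ℝ} (ht : t ∈ Ioo (0 : ℝ) 1) (htC : t ∉ C) :
    ContinuousOn (fun e => Gt e t) (Icc 0 1) := by
  obtain ⟨a', b', hab', ht'⟩ := exists_isCell ht htC
  refine continuousOn_of_cells B fun a b hab => ?_
  obtain ⟨g, hg, hGg⟩ := h.cell_t a b a' b' hab hab'
  refine ContinuousOn.congr (f := fun e => g (e, t)) ?_ fun e he => hGg e he t ht'
  exact hg.continuousOn.comp (by fun_prop) fun e he => mk_mem_prod he (Ioo_subset_Icc_self ht')

theorem exists_isCoefficient : ∃ K, ∀ e ∈ Icc (0 : ℝ) 1, IsCoefficient (Gt e) C K := by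
  obtain ⟨K, hK0, hK⟩ := exists_bound_of_cells (f := fun z => Gt z.1 z.2) (B := B) (C := C)
    fun a b a' b' hab hab' => by
      obtain ⟨g, hg, hGg⟩ := h.cell_t a b a' b' hab hab'
      exact ⟨g, hg.continuousOn, hGg⟩
  refine ⟨K, fun e he => ⟨h.meas e, hK0, fun t ht htC => hK e he t ht htC, fun t ht htC => ?_⟩⟩
  obtain ⟨a', b', hab', ht'⟩ := exists_isCell ht htC
  obtain ⟨a, b, hab, he'⟩ := exists_isCell_mem_Icc B he
  obtain ⟨g, hg, hGg⟩ := h.cell_t a b a' b' hab hab'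
  have h1 : ContinuousOn (fun r => g (e, r)) (Icc a' b') :=
    hg.continuousOn.comp (by fun_prop) fun r hr => mk_mem_prod he' hr
  refine (h1.continuousAt (Icc_mem_nhds ht'.1 ht'.2)).congr ?_
  filter_upwards [Ioo_mem_nhds ht'.1 ht'.2] with r hr
  exact (hGg e he' r hr).symm

theorem isCellwise_t : IsCellwise B C fun z => Gt z.1 z.2 := by
  intro a b a' b' hab hab'
  obtain ⟨g, hg, hGg⟩ := h.cell_t a b a' b' hab hab'
  exact ⟨g, hg.continuousOn, fun z hz => hGg z.1 (Ioo_subset_Icc_self hz.1) z.2 hz.2⟩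

theorem isCellwise_e : IsCellwise B C fun z => Ge z.1 z.2 := by
  intro a b a' b' hab hab'
  obtain ⟨g, hg, hGg⟩ := h.cell_e a b a' b' hab hab'
  exact ⟨g, hg.continuousOn, fun z hz => hGg z.1 hz.1 z.2 (Ioo_subset_Icc_self hz.2)⟩

theorem hasDerivAt_t_fst {e t : ℝ} (he : e ∈ Ioo (0 : ℝ) 1) (heB : e ∉ B)
    (ht : t ∈ Ioo (0 : ℝ) 1) (htC : t ∉ C) : DifferentiableAt ℝ (fun r => Gt r t) e := by
  obtain ⟨a', b', hab', ht'⟩ := exists_isCell ht htC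
  obtain ⟨a, b, hab, he'⟩ := exists_isCell he heB
  obtain ⟨g, hg, hGg⟩ := h.cell_t a b a' b' hab hab'
  refine ((hasDerivAt_fst_of_contDiffOn hg he' (Ioo_subset_Icc_self ht')).congr_of_eventuallyEq
    ?_).differentiableAt
  filter_upwards [Ioo_mem_nhds he'.1 he'.2] with r hr
  exact hGg r (Ioo_subset_Icc_self hr) t ht'

theorem hasDerivAt_e_snd {e t : ℝ} (he : e ∈ Ioo (0 : ℝ) 1) (heB : e ∉ B)
    (ht : t ∈ Ioo (0 : ℝ) 1) (htC : t ∉ C) : DifferentiableAt ℝ (fun r => Ge e r) t := by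
  obtain ⟨a', b', hab', ht'⟩ := exists_isCell ht htC
  obtain ⟨a, b, hab, he'⟩ := exists_isCell he heB
  obtain ⟨g, hg, hGg⟩ := h.cell_e a b a' b' hab hab'
  refine ((hasDerivAt_snd_of_contDiffOn hg (Ioo_subset_Icc_self he') ht').congr_of_eventuallyEq
    ?_).differentiableAt
  filter_upwards [Ioo_mem_nhds ht'.1 ht'.2] with r hr
  exact hGg e he' r (Ioo_subset_Icc_self hr)

theorem isCellwise_deriv_t : IsCellwise B C fun z => deriv (fun r => Gt r z.2) z.1 := by
  intro a b a' b' hab hab'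
  obtain ⟨g, hg, hGg⟩ := h.cell_t a b a' b' hab hab'
  refine ⟨_, continuousOn_fderivWithin_apply hg hab.lt hab'.lt (1, 0), fun z hz => ?_⟩
  refine ((hasDerivAt_fst_of_contDiffOn hg hz.1
    (Ioo_subset_Icc_self hz.2)).congr_of_eventuallyEq ?_).deriv
  filter_upwards [Ioo_mem_nhds hz.1.1 hz.1.2] with r hr
  exact hGg r (Ioo_subset_Icc_self hr) z.2 hz.2

theorem isCellwise_deriv_e : IsCellwise B C fun z => deriv (fun r => Ge z.1 r) z.2 := by
  intro a b a' b' hab hab'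
  obtain ⟨g, hg, hGg⟩ := h.cell_e a b a' b' hab hab'
  refine ⟨_, continuousOn_fderivWithin_apply hg hab.lt hab'.lt (0, 1), fun z hz => ?_⟩
  refine ((hasDerivAt_snd_of_contDiffOn hg (Ioo_subset_Icc_self hz.1)
    hz.2).congr_of_eventuallyEq ?_).deriv
  filter_upwards [Ioo_mem_nhds hz.2.1 hz.2.2] with r hr
  exact hGg z.1 hz.1 r (Ioo_subset_Icc_self hr)

theorem isCellwise_curvature : IsCellwise B C fun z => curvature Gt Ge z.1 z.2 :=
  (((h.isCellwise_deriv_e.sub h.isCellwise_deriv_t).add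
    (h.isCellwise_e.mul h.isCellwise_t))).sub (h.isCellwise_t.mul h.isCellwise_e)

theorem continuousOn_e_snd {e : ℝ} (he : e ∈ Ioo (0 : ℝ) 1) (heB : e ∉ B) :
    ContinuousOn (fun t => Ge e t) (Icc 0 1) := by
  obtain ⟨a, b, hab, he'⟩ := exists_isCell he heB
  refine continuousOn_of_cells C fun a' b' hab' => ?_
  obtain ⟨g, hg, hGg⟩ := h.cell_e a b a' b' hab hab'
  refine ContinuousOn.congr (f := fun t => g (e, t)) ?_ fun t ht => hGg e he' t ht
  exact hg.continuousOn.comp (by fun_prop) fun t ht => mk_mem_prod (Ioo_subset_Icc_self he') ht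

/-- The coefficients are Lipschitz in the homotopy parameter, uniformly in time. -/
theorem exists_lipschitz {p q : ℝ} (hpq : IsCell B p q) :
    ∃ L : ℝ, ∀ e ∈ Icc p q, ∀ e' ∈ Icc p q, ∀ t ∈ Ioo (0 : ℝ) 1, t ∉ C →
      ‖Gt e t - Gt e' t‖ ≤ L * |e - e'| := by
  refine subdivision_induction C (fun a b => ∃ L : ℝ, ∀ e ∈ Icc p q, ∀ e' ∈ Icc p q,
    ∀ t ∈ Ioo a b, t ∉ C → ‖Gt e t - Gt e' t‖ ≤ L * |e - e'|) ?_ ?_ le_rfl one_pos le_rfl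
  · intro a b hab
    obtain ⟨g, hg, hGg⟩ := h.cell_t p q a b hpq hab
    obtain ⟨L, hL⟩ := hg.exists_lipschitzOnWith one_ne_zero
      ((convex_Icc p q).prod (convex_Icc a b)) (isCompact_Icc.prod isCompact_Icc)
    refine ⟨L, fun e he e' he' t ht _ => ?_⟩
    rw [hGg e he t ht, hGg e' he' t ht, ← dist_eq_norm]
    refine (hL.dist_le_mul (e, t) (mk_mem_prod he (Ioo_subset_Icc_self ht)) (e', t)
      (mk_mem_prod he' (Ioo_subset_Icc_self ht))).trans_eq ?_
    simp [Prod.dist_eq, Real.dist_eq]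
  · rintro a c b hcC _ hac hcb _ ⟨L, hL⟩ ⟨L', hL'⟩
    refine ⟨max L L', fun e he e' he' t ht htC => ?_⟩
    rcases lt_or_ge t c with htc | htc
    · exact (hL e he e' he' t ⟨ht.1, htc⟩ htC).trans
        (mul_le_mul_of_nonneg_right (le_max_left _ _) (abs_nonneg _))
    · have : c ≠ t := fun hct => htC (hct ▸ hcC)
      exact (hL' e he e' he' t ⟨lt_of_le_of_ne htc this, ht.2⟩ htC).trans
        (mul_le_mul_of_nonneg_right (le_max_right _ _) (abs_nonneg _))

variable {K : ℝ} {W Z : ℝ → ℝ → X →L[ℝ] X}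

omit h in
theorem ae_uIoc_mem (C : Finset ℝ) :
    ∀ᵐ t : ℝ ∂volume, t ∈ uIoc (0 : ℝ) 1 → t ∈ Ioo (0 : ℝ) 1 ∧ t ∉ C := by
  filter_upwards [(insert 1 C).finite_toSet.countable.ae_notMem volume] with t ht ht'
  rw [uIoc_of_le zero_le_one] at ht'
  simp only [Finset.coe_insert, mem_insert_iff, Finset.mem_coe, not_or] at ht
  exact ⟨⟨ht'.1, lt_of_le_of_ne ht'.2 ht.1⟩, ht.2⟩

theorem tendsto_integral_norm_sub (hK : ∀ e ∈ Icc (0 : ℝ) 1, IsCoefficient (Gt e) C K) {e₀ : ℝ}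
    (he₀ : e₀ ∈ Icc (0 : ℝ) 1) :
    Tendsto (fun e => ∫ t in (0 : ℝ)..1, ‖Gt e t - Gt e₀ t‖) (𝓝[Icc 0 1] e₀) (𝓝 0) := by
  suffices key : Tendsto (fun e => ∫ t in (0 : ℝ)..1, ‖Gt e t - Gt e₀ t‖) (𝓝[Icc 0 1] e₀)
      (𝓝 (∫ t in (0 : ℝ)..1, (0 : ℝ))) by
    simpa using key
  refine intervalIntegral.tendsto_integral_filter_of_dominated_convergence (fun _ => K + K) ?_ ?_
    (by simp) ?_
  · exact Eventually.of_forall fun e =>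
      ((h.meas e).sub (h.meas e₀)).norm.aestronglyMeasurable
  · filter_upwards [self_mem_nhdsWithin] with e he
    filter_upwards [ae_uIoc_mem C] with t ht htm
    rw [norm_norm]
    exact (norm_sub_le _ _).trans (add_le_add ((hK e he).bound t (ht htm).1 (ht htm).2)
      ((hK e₀ he₀).bound t (ht htm).1 (ht htm).2))
  · filter_upwards [ae_uIoc_mem C] with t ht htm
    have h1 := h.continuousOn_fst (ht htm).1 (ht htm).2 e₀ he₀
    simpa using (h1.sub_const (Gt e₀ t)).norm

/-- Duhamel's formula contains three propagator factors, each with the same uniform bound; this is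
the cube. -/
theorem norm_W_sub_le [CompleteSpace X]
    (hK : ∀ e ∈ Icc (0 : ℝ) 1, IsCoefficient (Gt e) C K)
    (hW : ∀ e ∈ Icc (0 : ℝ) 1, IsPropagator (Gt e) C K (W e) (Z e)) {e e₀ t : ℝ}
    (he : e ∈ Icc (0 : ℝ) 1) (he₀ : e₀ ∈ Icc (0 : ℝ) 1) (ht : t ∈ Icc (0 : ℝ) 1) :
    ‖W e t - W e₀ t‖ ≤
      (2 * Real.exp (2 * K + 1)) ^ 3 * ∫ r in (0 : ℝ)..1, ‖Gt e r - Gt e₀ r‖ := by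
  set k := 2 * Real.exp (2 * K + 1) with hk
  have hk0 : 0 ≤ k := by positivity
  have hint : IntervalIntegrable (fun r => ‖Gt e r - Gt e₀ r‖) volume 0 1 := by
    refine intervalIntegrable_of_bounded (C := K + K) (insert 1 C)
      ((h.meas e).sub (h.meas e₀)).norm.aestronglyMeasurable fun r hr hrC => ?_
    rw [uIoc_of_le zero_le_one] at hr
    simp only [Finset.mem_insert, not_or] at hrC
    have hr' : r ∈ Ioo (0 : ℝ) 1 := ⟨hr.1, lt_of_le_of_ne hr.2 hrC.1⟩
    rw [norm_norm]
    exact (norm_sub_le _ _).trans (add_le_add ((hK e he).bound r hr' hrC.2)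
      ((hK e₀ he₀).bound r hr' hrC.2))
  have hint' : IntervalIntegrable (fun r => ‖Gt e r - Gt e₀ r‖) volume 0 t :=
    hint.mono_set (by
      rw [uIcc_of_le ht.1, uIcc_of_le zero_le_one]
      exact Icc_subset_Icc le_rfl ht.2)
  rw [(hW e₀ he₀).sub_eq_integral (hK e₀ he₀) (hK e he) (hW e he) ht]
  have h1 : ‖∫ r in (0 : ℝ)..t, Z e₀ r * (Gt e r - Gt e₀ r) * W e r‖ ≤
      ∫ r in (0 : ℝ)..t, k * k * ‖Gt e r - Gt e₀ r‖ := by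
    refine intervalIntegral.norm_integral_le_of_norm_le ht.1 ?_ (hint'.const_mul _)
    refine Eventually.of_forall fun r hr => ?_
    have hr' : r ∈ Icc (0 : ℝ) 1 := ⟨hr.1.le, hr.2.trans ht.2⟩
    calc ‖Z e₀ r * (Gt e r - Gt e₀ r) * W e r‖ ≤ ‖Z e₀ r‖ * ‖Gt e r - Gt e₀ r‖ * ‖W e r‖ :=
          (norm_mul_le _ _).trans (mul_le_mul_of_nonneg_right (norm_mul_le _ _) (norm_nonneg _))
      _ ≤ k * ‖Gt e r - Gt e₀ r‖ * k := by
          gcongr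
          · exact (hW e₀ he₀).boundZ r hr'
          · exact (hW e he).boundW r hr'
      _ = _ := by ring
  have h2 : ∫ r in (0 : ℝ)..t, k * k * ‖Gt e r - Gt e₀ r‖ ≤
      k * k * ∫ r in (0 : ℝ)..1, ‖Gt e r - Gt e₀ r‖ := by
    rw [intervalIntegral.integral_const_mul]
    refine mul_le_mul_of_nonneg_left ?_ (by positivity)
    exact intervalIntegral.integral_mono_interval le_rfl ht.1 ht.2
      (Eventually.of_forall fun _ => norm_nonneg _) hint
  refine (norm_mul_le _ _).trans ?_
  calc _ ≤ k * (k * k * ∫ r in (0 : ℝ)..1, ‖Gt e r - Gt e₀ r‖) :=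
        mul_le_mul ((hW e₀ he₀).boundW t ht) (h1.trans h2) (norm_nonneg _) hk0
    _ = _ := by ring

theorem continuousOn_W [CompleteSpace X]
    (hK : ∀ e ∈ Icc (0 : ℝ) 1, IsCoefficient (Gt e) C K)
    (hW : ∀ e ∈ Icc (0 : ℝ) 1, IsPropagator (Gt e) C K (W e) (Z e)) :
    ContinuousOn (fun z : ℝ × ℝ => W z.1 z.2) (Icc 0 1 ×ˢ Icc 0 1) := by
  rintro ⟨e₀, t₀⟩ ⟨he₀, ht₀⟩
  have h1 : Tendsto (fun z : ℝ × ℝ => (2 * Real.exp (2 * K + 1)) ^ 3 *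
      (∫ r in (0 : ℝ)..1, ‖Gt z.1 r - Gt e₀ r‖) + ‖W e₀ z.2 - W e₀ t₀‖)
      (𝓝[Icc 0 1 ×ˢ Icc 0 1] (e₀, t₀)) (𝓝 0) := by
    have ha : Tendsto (fun z : ℝ × ℝ => z.1) (𝓝[Icc 0 1 ×ˢ Icc 0 1] (e₀, t₀))
        (𝓝[Icc 0 1] e₀) := by
      rw [nhdsWithin_prod_eq]; exact tendsto_fst
    have hb : Tendsto (fun z : ℝ × ℝ => ‖W e₀ z.2 - W e₀ t₀‖)
        (𝓝[Icc 0 1 ×ˢ Icc 0 1] (e₀, t₀)) (𝓝 0) := by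
      have hc : Continuous fun z : ℝ × ℝ => ‖W e₀ z.2 - W e₀ t₀‖ :=
        (((hW e₀ he₀).contW.comp continuous_snd).sub continuous_const).norm
      have := hc.continuousAt (x := (e₀, t₀))
      simp only [ContinuousAt, sub_self, norm_zero] at this
      exact this.mono_left nhdsWithin_le_nhds
    have hc := (((h.tendsto_integral_norm_sub hK he₀).comp ha).const_mul
      ((2 * Real.exp (2 * K + 1)) ^ 3)).add hb
    simpa using hc
  refine tendsto_iff_norm_sub_tendsto_zero.2 (squeeze_zero' ?_ ?_ h1)
  · exact Eventually.of_forall fun _ => norm_nonneg _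
  · filter_upwards [self_mem_nhdsWithin] with z hz
    have h2 := h.norm_W_sub_le hK hW hz.1 he₀ hz.2
    calc ‖W z.1 z.2 - W e₀ t₀‖ = ‖(W z.1 z.2 - W e₀ z.2) + (W e₀ z.2 - W e₀ t₀)‖ := by
          congr 1; abel
      _ ≤ _ := (norm_add_le _ _).trans (add_le_add h2 le_rfl)

/-- `Z` is the pointwise inverse of `W`, and inversion is continuous at the units of a Banach
algebra. -/
theorem continuousOn_Z [CompleteSpace X]
    (hK : ∀ e ∈ Icc (0 : ℝ) 1, IsCoefficient (Gt e) C K)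
    (hW : ∀ e ∈ Icc (0 : ℝ) 1, IsPropagator (Gt e) C K (W e) (Z e)) :
    ContinuousOn (fun z : ℝ × ℝ => Z z.1 z.2) (Icc 0 1 ×ˢ Icc 0 1) := by
  have hinv : ∀ z ∈ Icc (0 : ℝ) 1 ×ˢ Icc (0 : ℝ) 1, Z z.1 z.2 = Ring.inverse (W z.1 z.2) := by
    intro z hz
    exact (Ring.inverse_unit ⟨W z.1 z.2, Z z.1 z.2, (hW z.1 hz.1).WZ z.2 hz.2,
      (hW z.1 hz.1).ZW z.2 hz.2⟩).symm
  refine ContinuousOn.congr (f := fun z : ℝ × ℝ => Ring.inverse (W z.1 z.2)) ?_ hinv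
  intro z hz
  have hu : IsUnit (W z.1 z.2) := ⟨⟨W z.1 z.2, Z z.1 z.2, (hW z.1 hz.1).WZ z.2 hz.2,
    (hW z.1 hz.1).ZW z.2 hz.2⟩, rfl⟩
  obtain ⟨u, hu⟩ := hu
  have h1 := NormedRing.inverse_continuousAt u
  rw [hu] at h1
  exact ContinuousAt.comp_continuousWithinAt (f := fun z : ℝ × ℝ => W z.1 z.2) h1
    (h.continuousOn_W hK hW z hz)

/-- Divide Duhamel's formula by `e - e₀` and pass to the limit under the integral. The Lipschitz
constant of the coefficients on a cell around `e₀` dominates the difference quotients. -/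
theorem hasDerivAt_W_one [CompleteSpace X]
    (hK : ∀ e ∈ Icc (0 : ℝ) 1, IsCoefficient (Gt e) C K)
    (hW : ∀ e ∈ Icc (0 : ℝ) 1, IsPropagator (Gt e) C K (W e) (Z e)) {e₀ : ℝ}
    (he₀ : e₀ ∈ Ioo (0 : ℝ) 1) (heB : e₀ ∉ B) :
    HasDerivAt (fun e => W e 1)
      (W e₀ 1 * ∫ t in (0 : ℝ)..1, Z e₀ t * deriv (fun r => Gt r t) e₀ * W e₀ t) e₀ := by
  have hI := Ioo_subset_Icc_self he₀
  obtain ⟨p, q, hpq, hepq⟩ := exists_isCell he₀ heB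
  obtain ⟨L, hL⟩ := h.exists_lipschitz hpq
  set k := 2 * Real.exp (2 * K + 1) with hk
  have hk0 : 0 ≤ k := by positivity
  have hmem : Icc p q ∈ 𝓝 e₀ := Icc_mem_nhds hepq.1 hepq.2
  have hsub : Icc p q ⊆ Icc 0 1 := Icc_subset_Icc hpq.nonneg hpq.le_one
  rw [hasDerivAt_iff_tendsto_slope]
  have key : Tendsto (fun e => ∫ t in (0 : ℝ)..1,
      Z e₀ t * ((e - e₀)⁻¹ • (Gt e t - Gt e₀ t)) * W e t) (𝓝[≠] e₀)
      (𝓝 (∫ t in (0 : ℝ)..1, Z e₀ t * deriv (fun r => Gt r t) e₀ * W e₀ t)) := by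
    refine intervalIntegral.tendsto_integral_filter_of_dominated_convergence
      (fun _ => k * |L| * k) ?_ ?_ (by simp) ?_
    · filter_upwards [nhdsWithin_le_nhds hmem] with e he
      have hm : StronglyMeasurable fun t => (e - e₀)⁻¹ • (Gt e t - Gt e₀ t) :=
        ((h.meas e).sub (h.meas e₀)).const_smul (e - e₀)⁻¹
      exact (((hW e₀ hI).contZ.stronglyMeasurable.mul hm).mul
        (hW e (hsub he)).contW.stronglyMeasurable).aestronglyMeasurable
    · filter_upwards [nhdsWithin_le_nhds hmem, self_mem_nhdsWithin] with e he hne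
      filter_upwards [ae_uIoc_mem C] with t ht htm
      obtain ⟨ht1, htC⟩ := ht htm
      have ht' := Ioo_subset_Icc_self ht1
      have h1 : ‖(e - e₀)⁻¹ • (Gt e t - Gt e₀ t)‖ ≤ |L| := by
        have hpos : 0 < |e - e₀| := abs_pos.2 (sub_ne_zero.2 hne)
        rw [norm_smul, norm_inv, Real.norm_eq_abs, inv_mul_le_iff₀ hpos, mul_comm]
        exact (hL e he e₀ (Ioo_subset_Icc_self hepq) t ht1 htC).trans
          (mul_le_mul_of_nonneg_right (le_abs_self L) hpos.le)
      exact (norm_mul_le _ _).trans (mul_le_mul ((norm_mul_le _ _).trans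
        (mul_le_mul ((hW e₀ hI).boundZ t ht') h1 (norm_nonneg _) hk0))
        ((hW e (hsub he)).boundW t ht') (norm_nonneg _) (mul_nonneg hk0 (abs_nonneg L)))
    · filter_upwards [ae_uIoc_mem C] with t ht htm
      obtain ⟨ht1, htC⟩ := ht htm
      have ht' := Ioo_subset_Icc_self ht1
      have h1 := (h.hasDerivAt_t_fst he₀ heB ht1 htC).hasDerivAt
      rw [hasDerivAt_iff_tendsto_slope] at h1
      have h2 : Tendsto (fun e => W e t) (𝓝[≠] e₀) (𝓝 (W e₀ t)) := by
        have h3 : ContinuousOn (fun e => W e t) (Icc 0 1) :=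
          (h.continuousOn_W hK hW).comp (f := fun e : ℝ => (e, t)) (by fun_prop)
            fun e he => mk_mem_prod he ht'
        exact (h3.continuousAt (Icc_mem_nhds he₀.1 he₀.2)).tendsto.mono_left nhdsWithin_le_nhds
      have h4 := ((tendsto_const_nhds (x := Z e₀ t)).mul h1).mul h2
      exact h4
  have key' := (tendsto_const_nhds (x := W e₀ 1)).mul key
  refine key'.congr' ?_
  filter_upwards [nhdsWithin_le_nhds hmem] with e he
  rw [slope_def_module, (hW e₀ hI).sub_eq_integral (hK e₀ hI) (hK e (hsub he)) (hW e (hsub he))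
    (right_mem_Icc.2 zero_le_one), ← mul_smul_comm, ← intervalIntegral.integral_smul]
  congr 1
  refine intervalIntegral.integral_congr fun t _ => ?_
  simp only [mul_smul_comm, smul_mul_assoc]

/-- Integrate `d/dt (Z Ge W) = Z (curvature + ∂Gt/∂e) W` over `[0,1]`. The boundary terms vanish
because `Ge` is zero at times 0 and 1, which is where the fixed end points enter. -/
theorem integral_deriv_eq [CompleteSpace X]
    (hK : ∀ e ∈ Icc (0 : ℝ) 1, IsCoefficient (Gt e) C K)
    (hW : ∀ e ∈ Icc (0 : ℝ) 1, IsPropagator (Gt e) C K (W e) (Z e)) {e : ℝ}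
    (he : e ∈ Ioo (0 : ℝ) 1) (heB : e ∉ B) :
    ∫ t in (0 : ℝ)..1, Z e t * deriv (fun r => Gt r t) e * W e t =
      -∫ t in (0 : ℝ)..1, Z e t * curvature Gt Ge e t * W e t := by
  have hI := Ioo_subset_Icc_self he
  have cW := isCellwise_of_continuousOn (B := B) (C := C) (h.continuousOn_W hK hW)
  have cZ := isCellwise_of_continuousOn (B := B) (C := C) (h.continuousOn_Z hK hW)
  have i1 := ((cZ.mul h.isCellwise_deriv_t).mul cW).intervalIntegrable_slice he heB
  have i2 := ((cZ.mul h.isCellwise_curvature).mul cW).intervalIntegrable_slice he heB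
  rw [eq_neg_iff_add_eq_zero, ← intervalIntegral.integral_add i1 i2,
    MeasureTheory.integral_eq_of_hasDerivAt_off_countable_of_le
      (fun t => Z e t * Ge e t * W e t) _ zero_le_one C.finite_toSet.countable
      (((hW e hI).contZ.continuousOn.mul (h.continuousOn_e_snd he heB)).mul
        (hW e hI).contW.continuousOn) ?_ (i1.add i2)]
  · simp [h.left e he, h.right e he]
  · intro t ht
    have htC : t ∉ C := by simpa using ht.2
    have h1 := (((hW e hI).derivZ t ht.1 htC).mul
      (h.hasDerivAt_e_snd he heB ht.1 htC).hasDerivAt).mul ((hW e hI).derivW t ht.1 htC)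
    convert! h1 using 1
    simp only [Pi.mul_apply, curvature]
    noncomm_ring

/-- The change of the propagator under a homotopy is the integral of the curvature. -/
theorem W_one_sub_eq_integral [CompleteSpace X]
    (hK : ∀ e ∈ Icc (0 : ℝ) 1, IsCoefficient (Gt e) C K)
    (hW : ∀ e ∈ Icc (0 : ℝ) 1, IsPropagator (Gt e) C K (W e) (Z e)) :
    W 1 1 - W 0 1 = -∫ e in (0 : ℝ)..1, ∫ t in (0 : ℝ)..1,
      W e 1 * (Z e t * curvature Gt Ge e t * W e t) := by
  have hW1 : ContinuousOn (fun z : ℝ × ℝ => W z.1 1) (Icc 0 1 ×ˢ Icc 0 1) :=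
    (h.continuousOn_W hK hW).comp (f := fun z : ℝ × ℝ => (z.1, (1 : ℝ))) (by fun_prop)
      fun z hz => mk_mem_prod hz.1 (right_mem_Icc.2 zero_le_one)
  have cW1 := isCellwise_of_continuousOn (B := B) (C := C) hW1
  have cW := isCellwise_of_continuousOn (B := B) (C := C) (h.continuousOn_W hK hW)
  have cZ := isCellwise_of_continuousOn (B := B) (C := C) (h.continuousOn_Z hK hW)
  have hint := intervalIntegrable_integral_of_integrableOn
    (cW1.mul ((cZ.mul h.isCellwise_curvature).mul cW)).integrableOn
  rw [← intervalIntegral.integral_neg]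
  symm
  refine MeasureTheory.integral_eq_of_hasDerivAt_off_countable_of_le (fun e => W e 1) _
    zero_le_one B.finite_toSet.countable ?_ ?_ hint.neg
  · exact (h.continuousOn_W hK hW).comp (f := fun e : ℝ => (e, (1 : ℝ))) (by fun_prop)
      fun e he => mk_mem_prod he (right_mem_Icc.2 zero_le_one)
  · intro e he
    have heB : e ∉ B := by simpa using he.2
    have i2 := ((cZ.mul h.isCellwise_curvature).mul cW).intervalIntegrable_slice he.1 heB
    have h1 := h.hasDerivAt_W_one hK hW he.1 heB
    rw [h.integral_deriv_eq hK hW he.1 heB] at h1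
    convert! h1 using 1
    rw [mul_neg]
    congr 1
    exact ((ContinuousLinearMap.mul ℝ (X →L[ℝ] X) (W e 1)).intervalIntegral_comp_comm i2)

end IsHomotopyCoefficient

end Variation

end RepHomotopy

end

open Bundle Set MeasureTheory Filter
open scoped Manifold ContDiff DirectSum Topology

noncomputable section

namespace RepHomotopy

variable {V : Type*} [NormedAddCommGroup V] [NormedSpace ℝ V]
  {M : Type*} [TopologicalSpace M] [ChartedSpace V M] [IsManifold 𝓘(ℝ, V) ∞ M]
  {F : Type*} [NormedAddCommGroup F] [NormedSpace ℝ F]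
  {E : M → Type*} [TopologicalSpace (TotalSpace F E)]
  [∀ x, AddCommGroup (E x)] [∀ x, Module ℝ (E x)] [∀ x, TopologicalSpace (E x)]
  [FiberBundle F E] [VectorBundle ℝ F E]

/-! ### Wedge products in low degrees -/

section WedgeAlgebra

section Alternating

variable {T W : Type*} [AddCommGroup T] [Module ℝ T] [AddCommGroup W] [Module ℝ W]

theorem alternatingMap_sum_apply {ι α : Type*} (s : Finset α) (f : α → T [⋀^ι]→ₗ[ℝ] W)
    (v : ι → T) : (∑ a ∈ s, f a) v = ∑ a ∈ s, f a v := by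
  induction s using Finset.cons_induction with
  | empty => simp
  | cons a s ha ih => rw [Finset.sum_cons, Finset.sum_cons, AlternatingMap.add_apply, ih]

theorem wedgeAlt_zero_left {k q : ℕ} (b : T [⋀^Fin q]→ₗ[ℝ] W) :
    wedgeAlt (0 : T [⋀^Fin k]→ₗ[ℝ] ℝ) q b = 0 := by
  ext v
  simp only [wedgeAlt, LinearMap.coe_mk, AddHom.coe_mk, ← AlternatingMap.domCoprod'_apply,
    TensorProduct.zero_tmul, map_zero]
  simp

theorem wedgeAlt_const (c : ℝ) {q : ℕ} (b : T [⋀^Fin q]→ₗ[ℝ] W) (v : Fin (0 + q) → T) :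
    wedgeAlt (AlternatingMap.constOfIsEmpty ℝ T (Fin 0) c) q b v =
      c • b (fun i => v (Fin.natAdd 0 i)) := by
  -- The first block is empty, so every permutation respects the blocks and there is only one
  -- shuffle.
  have hr : (Equiv.Perm.sumCongrHom (Fin 0) (Fin q)).range = ⊤ := by
    rw [eq_top_iff]
    intro σ _
    refine Equiv.Perm.mem_sumCongrHom_range_of_perm_mapsTo_inl ?_
    rintro _ ⟨i, rfl⟩
    exact i.elim0
  have hs : Subsingleton (Equiv.Perm.ModSumCongr (Fin 0) (Fin q)) := by
    unfold Equiv.Perm.ModSumCongr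
    rw [hr]
    exact QuotientGroup.subsingleton_quotient_top
  let σ₀ : Equiv.Perm.ModSumCongr (Fin 0) (Fin q) := Quotient.mk'' 1
  have hsum : ((AlternatingMap.constOfIsEmpty ℝ T (Fin 0) c).domCoprod b)
      (v ∘ finSumFinEquiv) = AlternatingMap.domCoprod.summand
        (AlternatingMap.constOfIsEmpty ℝ T (Fin 0) c) b σ₀ (v ∘ finSumFinEquiv) := by
    rw [AlternatingMap.domCoprod_apply]
    exact congrArg (fun m : MultilinearMap ℝ _ _ => m (v ∘ finSumFinEquiv))
      (Finset.sum_eq_single_of_mem σ₀ (Finset.mem_univ _)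
        fun σ _ hσ => absurd (Subsingleton.elim _ _) hσ)
  simp only [wedgeAlt, LinearMap.coe_mk, AddHom.coe_mk, AlternatingMap.domDomCongr_apply,
    LinearMap.compAlternatingMap_apply]
  rw [hsum, AlternatingMap.domCoprod.summand_mk'']
  simp

theorem wedgeAlt_one_zero (a : T [⋀^Fin 1]→ₗ[ℝ] ℝ) (b : T [⋀^Fin 0]→ₗ[ℝ] W)
    (v : Fin (1 + 0) → T) :
    wedgeAlt a 0 b v = a v • b ![] := by
  have hu : (Finset.univ : Finset (Equiv.Perm (Fin 1 ⊕ Fin 0))) = {1} := by decide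
  have h := MultilinearMap.domCoprod_alternization_eq a b
  simp only [Fintype.card_fin, Nat.factorial_one, Nat.factorial_zero, mul_one, one_smul] at h
  simp only [wedgeAlt, LinearMap.coe_mk, AddHom.coe_mk, AlternatingMap.domDomCongr_apply,
    LinearMap.compAlternatingMap_apply]
  rw [← h, MultilinearMap.alternatization_apply, hu, Finset.sum_singleton]
  simp only [Equiv.Perm.sign_one, one_smul, MultilinearMap.domDomCongr_apply,
    MultilinearMap.domCoprod_apply, Equiv.Perm.coe_one, id_eq, LinearEquiv.coe_coe,
    TensorProduct.lid_tmul, AlternatingMap.coe_multilinearMap, Function.comp_apply]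
  congr 2
  exact Subsingleton.elim _ _

theorem wedgeAlt_one_one (a : T [⋀^Fin 1]→ₗ[ℝ] ℝ) (b : T [⋀^Fin 1]→ₗ[ℝ] W)
    (X Y : T) :
    wedgeAlt a 1 b ![X, Y] = a ![X] • b ![Y] - a ![Y] • b ![X] := by
  have hu : (Finset.univ : Finset (Equiv.Perm (Fin 1 ⊕ Fin 1))) =
    {1, Equiv.swap (Sum.inl 0) (Sum.inr 0)} := by decide
  have h := MultilinearMap.domCoprod_alternization_eq a b
  simp only [Fintype.card_fin, Nat.factorial_one, mul_one, one_smul] at h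
  simp only [wedgeAlt, LinearMap.coe_mk, AddHom.coe_mk, AlternatingMap.domDomCongr_apply,
    LinearMap.compAlternatingMap_apply]
  rw [← h, MultilinearMap.alternatization_apply, hu, Finset.sum_pair (by decide)]
  have h1 : ∀ (f : Fin 1 → T), f = ![f 0] := fun f => by
    funext i
    rw [Subsingleton.elim i 0]
    rfl
  simp only [Equiv.Perm.sign_one, one_smul, MultilinearMap.domDomCongr_apply,
    MultilinearMap.domCoprod_apply, Equiv.Perm.coe_one, id_eq, LinearEquiv.coe_coe,
    AlternatingMap.coe_multilinearMap, Function.comp_apply, Equiv.Perm.sign_swap',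
    reduceCtorEq, if_false, Units.neg_smul, ← sub_eq_add_neg, map_sub, TensorProduct.lid_tmul]
  congr 2
  · congr 1; exact h1 _
  · congr 1; exact h1 _
  · congr 1; exact h1 _
  · congr 1; exact h1 _

/-- Each shuffle class contains `1! p!` permutations with equal contributions. With the factor `p!`
one can sum over the whole symmetric group instead of choosing representatives. -/
theorem factorial_smul_wedgeAlt (a : T [⋀^Fin 1]→ₗ[ℝ] ℝ) {p : ℕ} (b : T [⋀^Fin p]→ₗ[ℝ] W)
    (w : Fin (1 + p) → T) :
    (p.factorial : ℝ) • wedgeAlt a p b w =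
      ∑ σ : Equiv.Perm (Fin 1 ⊕ Fin p), ((Equiv.Perm.sign σ : ℤˣ) : ℤ) •
        (a (fun i => w (finSumFinEquiv (σ (Sum.inl i)))) •
          b (fun i => w (finSumFinEquiv (σ (Sum.inr i))))) := by
  have h := MultilinearMap.domCoprod_alternization_eq a b
  simp only [Fintype.card_fin, Nat.factorial_one, one_mul] at h
  have h' := congrArg (fun m => TensorProduct.lid ℝ W (m (w ∘ finSumFinEquiv))) h
  simp only [MultilinearMap.alternatization_apply, AlternatingMap.smul_apply, map_nsmul,
    map_sum] at h'
  simp only [wedgeAlt, LinearMap.coe_mk, AddHom.coe_mk, AlternatingMap.domDomCongr_apply,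
    LinearMap.compAlternatingMap_apply, LinearEquiv.coe_coe]
  rw [Nat.cast_smul_eq_nsmul]
  refine h'.symm.trans (Finset.sum_congr rfl fun σ _ => ?_)
  rw [Units.smul_def, map_zsmul]
  simp [Function.comp_def]

end Alternating

/-- A smooth function as a form of degree `0`. -/
def fnForm (f : C^∞⟮𝓘(ℝ, V), M; ℝ⟯) : ScalarForm V M 0 :=
  ⟨fun x => AlternatingMap.constOfIsEmpty ℝ _ (Fin 0) (f x), fun _ => f.contMDiff⟩

theorem contMDiff_mvfderiv_apply (f : C^∞⟮𝓘(ℝ, V), M; ℝ⟯) (X : VField V M) :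
    ContMDiff 𝓘(ℝ, V) 𝓘(ℝ, ℝ) ∞ (fun x => mvfderiv 𝓘(ℝ, V) f x (X x)) := by
  have h1 := f.contMDiff.contMDiff_tangentMap (m := ∞) (by simp)
  exact (contMDiff_snd_tangentBundle_modelSpace ℝ 𝓘(ℝ, ℝ)).comp (h1.comp X.contMDiff)

/-- The differential of a smooth function. -/
def dForm (f : C^∞⟮𝓘(ℝ, V), M; ℝ⟯) : ScalarForm V M 1 :=
  ⟨fun x => AlternatingMap.ofSubsingleton ℝ (TangentSpace 𝓘(ℝ, V) x) ℝ (0 : Fin 1)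
    (mvfderiv 𝓘(ℝ, V) f x).toLinearMap, fun X => contMDiff_mvfderiv_apply f (X 0)⟩

@[simp]
theorem dForm_apply (f : C^∞⟮𝓘(ℝ, V), M; ℝ⟯) (x : M) (X : TangentSpace 𝓘(ℝ, V) x) :
    (dForm f).1 x ![X] = mvfderiv 𝓘(ℝ, V) f x X := rfl

theorem isDeRham_fnForm (f : C^∞⟮𝓘(ℝ, V), M; ℝ⟯) : IsDeRham (fnForm f) (dForm f) := by
  intro X x
  have : ∀ i : Fin (0 + 1), (Finset.univ.filter fun j : Fin (0 + 1) => i < j) = ∅ := by decide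
  simp only [this, Finset.sum_empty, Finset.sum_const_zero, add_zero]
  simp
  rfl

theorem lof_apply_apply {m : ℕ} (c : Omega V F E m) (p : ℕ) (x : M)
    (w : Fin p → TangentSpace 𝓘(ℝ, V) x) :
    (DirectSum.lof ℝ ℕ (fun p => Omega V F E p) m c p).1 x w =
      if h : m = p then c.1 x (fun i => w (Fin.cast h i)) else 0 := by
  split_ifs with h
  · subst h
    rw [DirectSum.lof_apply]
    rfl
  · rw [DirectSum.lof_eq_of, DirectSum.of_eq_of_ne _ _ _ (Ne.symm h)]
    rfl

theorem wedge_lof {k q : ℕ} (α : ScalarForm V M k) (η : Omega V F E q) :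
    wedge α (DirectSum.lof ℝ ℕ (fun p => Omega V F E p) q η) =
      DirectSum.lof ℝ ℕ (fun p => Omega V F E p) (k + q)
        ⟨fun x => wedgeAlt (α.1 x) q (η.1 x), wedgeAlt_smooth α η⟩ := by
  rw [wedge, DirectSum.toModule_lof]
  rfl

theorem totalOmega_induction {P : TotalOmega V F E → Prop} (h0 : P 0)
    (hlof : ∀ q (η : Omega V F E q), P (DirectSum.lof ℝ ℕ (fun p => Omega V F E p) q η))
    (hadd : ∀ η η', P η → P η' → P (η + η')) (η : TotalOmega V F E) : P η :=
  DirectSum.induction_on η h0 hlof hadd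

theorem wedge_fnForm_apply (f : C^∞⟮𝓘(ℝ, V), M; ℝ⟯) (η : TotalOmega V F E) (p : ℕ) (x : M)
    (w : Fin p → TangentSpace 𝓘(ℝ, V) x) :
    (wedge (fnForm f) η p).1 x w = f x • (η p).1 x w := by
  induction η using totalOmega_induction with
  | h0 => simp
  | hadd η η' h h' =>
    rw [map_add, DirectSum.add_apply, DirectSum.add_apply]
    simp only [Submodule.coe_add, Pi.add_apply, AlternatingMap.add_apply, h, h', smul_add]
  | hlof q η =>
    rw [wedge_lof, lof_apply_apply, lof_apply_apply]
    by_cases h : q = p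
    · subst h
      rw [dif_pos (zero_add q), dif_pos rfl]
      refine (wedgeAlt_const (f x) (η.1 x) _).trans ?_
      congr 2
      funext i
      congr 1
      ext
      simp
    · rw [dif_neg h, dif_neg (by simpa using h), smul_zero]

theorem wedge_apply_add {k : ℕ} (α : ScalarForm V M k) (η : TotalOmega V F E) (r : ℕ) (x : M) :
    (wedge α η (k + r)).1 x = wedgeAlt (α.1 x) r ((η r).1 x) := by
  induction η using totalOmega_induction with
  | h0 => simp
  | hadd η η' h h' =>
    rw [map_add, DirectSum.add_apply, DirectSum.add_apply]
    simp only [Submodule.coe_add, Pi.add_apply, h, h', map_add]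
  | hlof q η =>
    rw [wedge_lof, DirectSum.lof_eq_of, DirectSum.lof_eq_of]
    by_cases h : q = r
    · subst h
      rw [DirectSum.of_eq_same, DirectSum.of_eq_same]
    · rw [DirectSum.of_eq_of_ne _ _ _ (fun h' => h (Nat.add_left_cancel h'.symm)),
        DirectSum.of_eq_of_ne _ _ _ (Ne.symm h)]
      simp

theorem wedge_apply_of_lt {k : ℕ} (α : ScalarForm V M k) (η : TotalOmega V F E) {q : ℕ}
    (h : q < k) : wedge α η q = 0 := by
  induction η using totalOmega_induction with
  | h0 => simp
  | hadd η η' h h' => rw [map_add, DirectSum.add_apply, h, h', add_zero]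
  | hlof r η => rw [wedge_lof, DirectSum.lof_eq_of, DirectSum.of_eq_of_ne _ _ _ (by omega)]

theorem wedge_one_apply_one (α : ScalarForm V M 1) (η : TotalOmega V F E) (x : M)
    (X : TangentSpace 𝓘(ℝ, V) x) :
    (wedge α η 1).1 x ![X] = α.1 x ![X] • (η 0).1 x ![] :=
  (DFunLike.congr_fun (wedge_apply_add α η 0 x) ![X]).trans (wedgeAlt_one_zero _ _ _)

theorem wedge_one_apply_two (α : ScalarForm V M 1) (η : TotalOmega V F E) (x : M)
    (X Y : TangentSpace 𝓘(ℝ, V) x) :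
    (wedge α η 2).1 x ![X, Y] =
      α.1 x ![X] • (η 1).1 x ![Y] - α.1 x ![Y] • (η 1).1 x ![X] :=
  (DFunLike.congr_fun (wedge_apply_add α η 1 x) ![X, Y]).trans (wedgeAlt_one_one _ _ _ _)

/-- A form vanishes as soon as all its values do. -/
theorem totalOmega_ext {η η' : TotalOmega V F E}
    (h : ∀ p x (w : Fin p → TangentSpace 𝓘(ℝ, V) x), (η p).1 x w = (η' p).1 x w) : η = η' := by
  ext p : 2
  exact funext fun x => AlternatingMap.ext (h p x)

theorem totalOmega_sum_apply {ι : Type*} (s : Finset ι) (η : ι → TotalOmega V F E) (p : ℕ) (x : M)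
    (w : Fin p → TangentSpace 𝓘(ℝ, V) x) :
    ((∑ i ∈ s, η i) p).1 x w = ∑ i ∈ s, (η i p).1 x w := by
  induction s using Finset.cons_induction with
  | empty => simp
  | cons a s ha ih =>
    rw [Finset.sum_cons, Finset.sum_cons, DirectSum.add_apply, ← ih]
    rfl

end WedgeAlgebra

end RepHomotopy

end

open Bundle Set MeasureTheory Filter
open scoped Manifold ContDiff DirectSum Topology

noncomputable section

namespace RepHomotopy

variable {V : Type*} [NormedAddCommGroup V] [NormedSpace ℝ V]
  {M : Type*} [TopologicalSpace M] [ChartedSpace V M] [IsManifold 𝓘(ℝ, V) ∞ M]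
  {F : Type*} [NormedAddCommGroup F] [NormedSpace ℝ F]
  {E : M → Type*} [TopologicalSpace (TotalSpace F E)]
  [∀ x, AddCommGroup (E x)] [∀ x, Module ℝ (E x)] [∀ x, TopologicalSpace (E x)]
  [FiberBundle F E] [VectorBundle ℝ F E]

/-! ### Frames, and the action of `D` on forms of positive degree -/

section DifferentialAlgebra

/-- The product of a smooth function and a smooth section. -/
def smulSec (f : C^∞⟮𝓘(ℝ, V), M; ℝ⟯) (s : Sec V F E) : Sec V F E :=
  ⟨fun x => f x • s x, f.contMDiff.smul_section s.contMDiff⟩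

@[simp]
theorem smulSec_apply (f : C^∞⟮𝓘(ℝ, V), M; ℝ⟯) (s : Sec V F E) (x : M) :
    smulSec f s x = f x • s x := rfl

theorem toTotal_apply (s : Sec V F E) (p : ℕ) (x : M) (w : Fin p → TangentSpace 𝓘(ℝ, V) x) :
    (s.toTotal p).1 x w = if p = 0 then s x else 0 := by
  rw [Sec.toTotal, lof_apply_apply]
  by_cases h : p = 0
  · rw [dif_pos h.symm, if_pos h]
    rfl
  · rw [dif_neg (Ne.symm h), if_neg h]

theorem toTotal_smulSec (f : C^∞⟮𝓘(ℝ, V), M; ℝ⟯) (s : Sec V F E) :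
    (smulSec f s).toTotal = wedge (fnForm f) s.toTotal := by
  refine totalOmega_ext fun p x w => ?_
  rw [wedge_fnForm_apply, toTotal_apply, toTotal_apply]
  split_ifs <;> simp

theorem toTotal_add (s t : Sec V F E) : (s + t).toTotal = s.toTotal + t.toTotal := by
  refine totalOmega_ext fun p x w => ?_
  rw [DirectSum.add_apply, Submodule.coe_add, Pi.add_apply, AlternatingMap.add_apply,
    toTotal_apply, toTotal_apply, toTotal_apply]
  split_ifs <;> simp

/-- A smooth frame for `E` and `TM` over the interior of the set where `cut = 1`: finitely many
sections `sec` and functionals `cov` with `∑ cov(u) sec = cut • u`, and finitely many functions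
`fn` and vector fields `vf` with `∑ d(fn)(v) vf = cut • v`. -/
structure Frame (V : Type*) [NormedAddCommGroup V] [NormedSpace ℝ V]
    {M : Type*} [TopologicalSpace M] [ChartedSpace V M] [IsManifold 𝓘(ℝ, V) ∞ M]
    (F : Type*) [NormedAddCommGroup F] [NormedSpace ℝ F]
    (E : M → Type*) [TopologicalSpace (TotalSpace F E)]
    [∀ x, AddCommGroup (E x)] [∀ x, Module ℝ (E x)] [∀ x, TopologicalSpace (E x)]
    [FiberBundle F E] [VectorBundle ℝ F E] where
  ι : Type
  κ : Type
  fintypeι : Fintype ι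
  fintypeκ : Fintype κ
  sec : ι → Sec V F E
  cov : ι → ∀ x, E x →ₗ[ℝ] ℝ
  cov_smooth : ∀ i, ContMDiff (𝓘(ℝ, V).prod 𝓘(ℝ, F)) 𝓘(ℝ, ℝ) ∞
    (fun v : TotalSpace F E => cov i v.1 v.2)
  fn : κ → C^∞⟮𝓘(ℝ, V), M; ℝ⟯
  vf : κ → VField V M
  cut : C^∞⟮𝓘(ℝ, V), M; ℝ⟯
  sum_sec : ∀ x (u : E x), ∑ i, cov i x u • sec i x = cut x • u
  sum_vf : ∀ x (v : TangentSpace 𝓘(ℝ, V) x),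
    ∑ m, mvfderiv 𝓘(ℝ, V) (fn m) x v • vf m x = cut x • v

attribute [instance] Frame.fintypeι Frame.fintypeκ

namespace Frame

variable (Fr : Frame V F E)

/-- The frame is a frame near `x`. -/
def Good (x : M) : Prop := ∀ᶠ y in 𝓝 x, Fr.cut y = 1

/-- The coefficient functions of a section. -/
def coef (i : Fr.ι) (s : Sec V F E) : C^∞⟮𝓘(ℝ, V), M; ℝ⟯ :=
  ⟨fun x => Fr.cov i x (s x), (Fr.cov_smooth i).comp s.contMDiff⟩

@[simp]
theorem coef_apply (i : Fr.ι) (s : Sec V F E) (x : M) : Fr.coef i s x = Fr.cov i x (s x) := rfl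

variable {Fr} {x : M}

theorem Good.cut_eq (hx : Fr.Good x) : Fr.cut x = 1 := hx.self_of_nhds

theorem Good.sum_sec (hx : Fr.Good x) (u : E x) : ∑ i, Fr.cov i x u • Fr.sec i x = u := by
  rw [Fr.sum_sec, hx.cut_eq, one_smul]

theorem Good.sum_vf (hx : Fr.Good x) (v : TangentSpace 𝓘(ℝ, V) x) :
    ∑ m, mvfderiv 𝓘(ℝ, V) (Fr.fn m) x v • Fr.vf m x = v := by
  rw [Fr.sum_vf, hx.cut_eq, one_smul]

theorem Good.mvfderiv_cut (hx : Fr.Good x) : mvfderiv 𝓘(ℝ, V) Fr.cut x = 0 := by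
  have h : mfderiv 𝓘(ℝ, V) 𝓘(ℝ, ℝ) Fr.cut x =
      mfderiv 𝓘(ℝ, V) 𝓘(ℝ, ℝ) (fun _ : M => (1 : ℝ)) x :=
    Filter.EventuallyEq.mfderiv_eq hx
  have h' : mvfderiv 𝓘(ℝ, V) (fun _ : M => (1 : ℝ)) x = 0 := mvfderiv_const 1
  rw [← h']
  ext v
  exact congrArg (fun L : TangentSpace 𝓘(ℝ, V) x →L[ℝ] ℝ => L v) h

variable (Fr) in
/-- A section through a vector. -/
def through (x : M) (u : E x) : Sec V F E := ∑ i, Fr.cov i x u • Fr.sec i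

omit [IsManifold 𝓘(ℝ, V) ∞ M] in
theorem sec_sum_apply {ι : Type*} (t : Finset ι) (s : ι → Sec V F E) (x : M) :
    (∑ i ∈ t, s i) x = ∑ i ∈ t, s i x := by
  induction t using Finset.cons_induction with
  | empty => simp
  | cons a t ha ih =>
    rw [Finset.sum_cons, Finset.sum_cons, ← ih]
    rfl

theorem Good.through_apply (hx : Fr.Good x) (u : E x) : Fr.through x u x = u := by
  rw [through, sec_sum_apply]
  exact hx.sum_sec u

theorem toTotal_sum {ι : Type*} (t : Finset ι) (s : ι → Sec V F E) :
    (∑ i ∈ t, s i).toTotal = ∑ i ∈ t, (s i).toTotal := by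
  refine totalOmega_ext fun p x w => ?_
  rw [totalOmega_sum_apply, toTotal_apply, sec_sum_apply]
  simp only [toTotal_apply]
  split_ifs <;> simp

theorem wedge_cut_toTotal (s : Sec V F E) :
    wedge (fnForm Fr.cut) s.toTotal =
      ∑ i, wedge (fnForm (Fr.coef i s)) (Fr.sec i).toTotal := by
  simp only [← toTotal_smulSec]
  rw [← toTotal_sum]
  congr 1
  ext x
  rw [sec_sum_apply]
  exact (Fr.sum_sec x (s x)).symm

/-- The contraction of a form with a vector field. -/
def contract {p : ℕ} (X : VField V M) (η : Omega V F E (p + 1)) : Omega V F E p :=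
  ⟨fun x => (η.1 x).curryLeft (X x), fun Y => by
    refine (η.2 (Fin.cons X Y)).congr fun x => ?_
    congr 1
    simp only [AlternatingMap.curryLeft_apply_apply]
    congr 1
    funext i
    refine Fin.cases rfl (fun j => rfl) i⟩

/-- For each of the `(p + 1)!` permutations, summing over the frame puts one argument back into the
contracted slot. What remains is `η` at permuted arguments, and its sign cancels the sign of the
permutation. -/
theorem sum_factorial_smul_wedgeAlt {p : ℕ} (η : Omega V F E (p + 1)) (x : M)
    (v : Fin (p + 1) → TangentSpace 𝓘(ℝ, V) x) :
    (p.factorial : ℝ) • ∑ m, wedgeAlt ((dForm (Fr.fn m)).1 x) p ((contract (Fr.vf m) η).1 x)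
      (fun i => v (Fin.cast (Nat.add_comm 1 p) i)) =
    ((p + 1).factorial : ℝ) • Fr.cut x • η.1 x v := by
  let e : Fin 1 ⊕ Fin p ≃ Fin (p + 1) := finSumFinEquiv.trans (finCongr (Nat.add_comm 1 p))
  simp only [Finset.smul_sum, factorial_smul_wedgeAlt]
  rw [Finset.sum_comm]
  have hterm : ∀ σ : Equiv.Perm (Fin 1 ⊕ Fin p),
      ∑ m, ((Equiv.Perm.sign σ : ℤˣ) : ℤ) •
        ((dForm (Fr.fn m)).1 x (fun i => v (Fin.cast (Nat.add_comm 1 p)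
          (finSumFinEquiv (σ (Sum.inl i))))) •
          (contract (Fr.vf m) η).1 x (fun i => v (Fin.cast (Nat.add_comm 1 p)
            (finSumFinEquiv (σ (Sum.inr i)))))) = Fr.cut x • η.1 x v := by
    intro σ
    rw [← Finset.smul_sum]
    have h1 : ∑ m, (dForm (Fr.fn m)).1 x (fun i => v (Fin.cast (Nat.add_comm 1 p)
          (finSumFinEquiv (σ (Sum.inl i))))) •
          (contract (Fr.vf m) η).1 x (fun i => v (Fin.cast (Nat.add_comm 1 p)
            (finSumFinEquiv (σ (Sum.inr i))))) =
        (η.1 x).curryLeft (∑ m, mvfderiv 𝓘(ℝ, V) (Fr.fn m) x (v (e (σ (Sum.inl 0)))) •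
          Fr.vf m x) (fun i => v (e (σ (Sum.inr i)))) := by
      rw [map_sum, alternatingMap_sum_apply]
      refine Finset.sum_congr rfl fun m _ => ?_
      rw [map_smul]
      rfl
    rw [h1, Fr.sum_vf, map_smul, AlternatingMap.smul_apply, smul_comm]
    congr 1
    -- Under `e` the single left index is 0 and the right indices are the successors, as in the
    -- slots of `curryLeft`.
    let τ : Equiv.Perm (Fin (p + 1)) := e.permCongr σ
    have h2 : (η.1 x).curryLeft (v (e (σ (Sum.inl 0)))) (fun i => v (e (σ (Sum.inr i)))) =
        η.1 x (v ∘ τ) := by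
      rw [AlternatingMap.curryLeft_apply_apply]
      congr 1
      funext i
      refine Fin.cases ?_ (fun j => ?_) i
      · have : e.symm 0 = Sum.inl 0 := by
          rw [Equiv.symm_apply_eq]
          ext
          simp [e]
        simp [τ, this]
      · have : e.symm j.succ = Sum.inr j := by
          rw [Equiv.symm_apply_eq]
          ext
          simp [e]
        simp [τ, this]
    rw [h2, AlternatingMap.map_perm, Equiv.Perm.sign_permCongr, Units.smul_def, smul_smul]
    rcases Int.units_eq_one_or (Equiv.Perm.sign σ) with hσ | hσ <;> simp [hσ]
  rw [Finset.sum_congr rfl fun σ _ => hterm σ, Finset.sum_const, Finset.card_univ,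
    Fintype.card_perm, Fintype.card_sum, Fintype.card_fin, Fintype.card_fin, Nat.add_comm 1 p,
    Nat.cast_smul_eq_nsmul]

/-- The identity `∑ df_m ∧ ι_{e_m} η = (p + 1) η`, cut off and with factorials cleared; it reduces
`D` on forms of degree `p + 1` to degree `p`. -/
theorem sum_wedge_contract {p : ℕ} (η : Omega V F E (p + 1)) :
    (p.factorial : ℝ) • ∑ m, wedge (dForm (Fr.fn m))
        (DirectSum.lof ℝ ℕ (fun p => Omega V F E p) p (contract (Fr.vf m) η)) =
      ((p + 1).factorial : ℝ) • wedge (fnForm Fr.cut)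
        (DirectSum.lof ℝ ℕ (fun p => Omega V F E p) (p + 1) η) := by
  refine totalOmega_ext fun q x w => ?_
  rw [DirectSum.smul_apply, DirectSum.smul_apply]
  simp only [Submodule.coe_smul, Pi.smul_apply, AlternatingMap.smul_apply]
  rw [totalOmega_sum_apply, wedge_fnForm_apply]
  simp only [wedge_lof, lof_apply_apply]
  by_cases h : p + 1 = q
  · subst h
    simp only [Nat.add_comm 1 p, dif_pos]
    exact sum_factorial_smul_wedgeAlt η x w
  · rw [dif_neg h]
    simp [show ¬(1 + p = q) by omega]

end Frame

namespace RepUpToHomotopy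

variable {G : Grading V F E} (R : RepUpToHomotopy G)

theorem D_wedge_fnForm (f : C^∞⟮𝓘(ℝ, V), M; ℝ⟯) (η : TotalOmega V F E) :
    R.D (wedge (fnForm f) η) = wedge (dForm f) η + wedge (fnForm f) (R.D η) := by
  rw [R.derivation 0 _ _ (isDeRham_fnForm f)]
  simp

/-- Apply `D` to the Leibniz rule for `f` and use `D² = 0` on both sides. The derivation axiom is
thus needed for functions only. -/
theorem D_wedge_dForm (f : C^∞⟮𝓘(ℝ, V), M; ℝ⟯) (η : TotalOmega V F E) :
    R.D (wedge (dForm f) η) = -wedge (dForm f) (R.D η) := by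
  have h := congrArg R.D (R.D_wedge_fnForm f η)
  rw [R.sq_zero, map_add, D_wedge_fnForm, R.sq_zero, map_zero, add_zero] at h
  exact eq_neg_of_add_eq_zero_left h.symm

variable {R} {Fr : Frame V F E} {x : M}

/-- Locality of `D`: at a good point the cut-off function has value 1 and differential 0. -/
theorem D_wedge_cut (hx : Fr.Good x) (η : TotalOmega V F E) (p : ℕ) :
    (R.D (wedge (fnForm Fr.cut) η) p).1 x = (R.D η p).1 x := by
  rw [D_wedge_fnForm, DirectSum.add_apply, Submodule.coe_add, Pi.add_apply]
  have h1 : (wedge (dForm Fr.cut) η p).1 x = 0 := by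
    rcases Nat.lt_or_ge p 1 with h | h
    · rw [wedge_apply_of_lt _ _ h]
      rfl
    · obtain ⟨r, rfl⟩ := Nat.exists_eq_add_of_le h
      rw [wedge_apply_add]
      have : (dForm Fr.cut).1 x = 0 := by
        ext v
        simp only [dForm, hx.mvfderiv_cut]
        simp
      rw [this, wedgeAlt_zero_left]
  rw [h1, zero_add]
  ext w
  rw [wedge_fnForm_apply, hx.cut_eq, one_smul]

/-- The value of `D η` for a form of positive degree in terms of contractions of `η`. -/
theorem D_lof_succ (hx : Fr.Good x) {p : ℕ} (η : Omega V F E (p + 1)) (q : ℕ)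
    (w : Fin q → TangentSpace 𝓘(ℝ, V) x) :
    ((p + 1 : ℕ) : ℝ) • (R.D (DirectSum.lof ℝ ℕ (fun p => Omega V F E p) (p + 1) η) q).1 x w =
      -∑ m, (wedge (dForm (Fr.fn m)) (R.D (DirectSum.lof ℝ ℕ (fun p => Omega V F E p) p
        (Frame.contract (Fr.vf m) η))) q).1 x w := by
  have h := congrArg (fun ζ => ((R.D ζ) q).1 x w) (Frame.sum_wedge_contract (Fr := Fr) η)
  simp only [map_smul, map_sum, D_wedge_dForm] at h
  rw [DirectSum.smul_apply, DirectSum.smul_apply] at h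
  simp only [Submodule.coe_smul, Pi.smul_apply, AlternatingMap.smul_apply] at h
  rw [D_wedge_cut hx, totalOmega_sum_apply, Nat.factorial_succ, Nat.cast_mul, mul_comm, mul_smul]
    at h
  have h0 : (p.factorial : ℝ) ≠ 0 := Nat.cast_ne_zero.2 (Nat.factorial_ne_zero p)
  rw [← smul_right_injective _ h0 h, ← Finset.sum_neg_distrib]
  refine Finset.sum_congr rfl fun m _ => ?_
  rfl

/-- `D` does not lower the form degree. -/
theorem D_lof_of_lt (hFr : ∀ x : M, ∃ Fr : Frame V F E, Fr.Good x) {p q : ℕ}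
    (η : Omega V F E p) (hq : q < p) :
    R.D (DirectSum.lof ℝ ℕ (fun p => Omega V F E p) p η) q = 0 := by
  induction p generalizing q with
  | zero => omega
  | succ p ih =>
    ext1
    funext x
    obtain ⟨Fr, hx⟩ := hFr x
    ext w
    have h0 : ((p + 1 : ℕ) : ℝ) ≠ 0 := Nat.cast_ne_zero.2 (Nat.succ_ne_zero p)
    refine (smul_eq_zero_iff_right h0).1 ((D_lof_succ hx η q w).trans ?_)
    rw [neg_eq_zero]
    refine Finset.sum_eq_zero fun m _ => ?_
    -- Wedging with a one-form raises the degree by one, so degree `q` only sees degree `q - 1` of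
    -- `D` on a form of degree `p`.
    rcases Nat.lt_or_ge q 1 with h | h
    · rw [wedge_apply_of_lt _ _ h]
      rfl
    · obtain ⟨r, rfl⟩ := Nat.exists_eq_add_of_le h
      rw [wedge_apply_add, ih _ (by omega)]
      simp

/-- Applied to `η = D s`, this splits `D² s = 0` into finitely many terms in each form degree. -/
theorem D_apply_eq_sum (hFr : ∀ x : M, ∃ Fr : Frame V F E, Fr.Good x) (η : TotalOmega V F E)
    (q : ℕ) :
    R.D η q = ∑ p ∈ Finset.range (q + 1),
      R.D (DirectSum.lof ℝ ℕ (fun p => Omega V F E p) p (η p)) q := by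
  induction η using totalOmega_induction with
  | h0 => simp
  | hadd η η' h h' =>
    simp only [map_add, DirectSum.add_apply, Finset.sum_add_distrib, h, h']
  | hlof r η =>
    rcases Nat.lt_or_ge q r with h | h
    · rw [D_lof_of_lt hFr η h]
      symm
      refine Finset.sum_eq_zero fun p hp => ?_
      have hpr : p ≠ r := by
        have := Finset.mem_range.1 hp
        omega
      rw [DirectSum.lof_eq_of ℝ ℕ _ r, DirectSum.of_eq_of_ne _ _ _ hpr]
      simp
    · rw [Finset.sum_eq_single_of_mem r (Finset.mem_range.2 (by omega))]
      · rw [DirectSum.lof_eq_of ℝ ℕ _ r, DirectSum.of_eq_same]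
        rfl
      · intro p _ hpr
        rw [DirectSum.lof_eq_of ℝ ℕ _ r, DirectSum.of_eq_of_ne _ _ _ hpr]
        simp

end RepUpToHomotopy

end DifferentialAlgebra

end RepHomotopy

end

open Bundle Set MeasureTheory Filter
open scoped Manifold ContDiff DirectSum Topology

noncomputable section

namespace RepHomotopy

variable {V : Type*} [NormedAddCommGroup V] [NormedSpace ℝ V]
  {M : Type*} [TopologicalSpace M] [ChartedSpace V M] [IsManifold 𝓘(ℝ, V) ∞ M]
  {F : Type*} [NormedAddCommGroup F] [NormedSpace ℝ F]
  {E : M → Type*} [TopologicalSpace (TotalSpace F E)]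
  [∀ x, AddCommGroup (E x)] [∀ x, Module ℝ (E x)] [∀ x, TopologicalSpace (E x)]
  [FiberBundle F E] [VectorBundle ℝ F E]

/-! ### The components of `D² = 0` in form degrees 0, 1 and 2 -/

section Components

namespace RepUpToHomotopy

variable {G : Grading V F E} {R : RepUpToHomotopy G} {Fr : Frame V F E} {x : M}

theorem delSec_smulSec (f : C^∞⟮𝓘(ℝ, V), M; ℝ⟯) (s : Sec V F E) :
    R.delSec (smulSec f s) x = f x • R.delSec s x := by
  rw [delSec, toTotal_smulSec, D_wedge_fnForm, DirectSum.add_apply, Submodule.coe_add,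
    Pi.add_apply, AlternatingMap.add_apply, wedge_apply_of_lt _ _ one_pos, wedge_fnForm_apply]
  simp [delSec]

theorem nabla_smulSec (f : C^∞⟮𝓘(ℝ, V), M; ℝ⟯) (s : Sec V F E) (X : TangentSpace 𝓘(ℝ, V) x) :
    R.nabla (smulSec f s) x X =
      mvfderiv 𝓘(ℝ, V) f x X • s x + f x • R.nabla s x X := by
  rw [nabla, toTotal_smulSec, D_wedge_fnForm, DirectSum.add_apply, Submodule.coe_add,
    Pi.add_apply, AlternatingMap.add_apply, wedge_one_apply_one, wedge_fnForm_apply,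
    toTotal_apply, if_pos rfl, dForm_apply]
  rfl

theorem omega2Sec_smulSec (f : C^∞⟮𝓘(ℝ, V), M; ℝ⟯) (s : Sec V F E)
    (X Y : TangentSpace 𝓘(ℝ, V) x) :
    R.omega2Sec (smulSec f s) x X Y = f x • R.omega2Sec s x X Y := by
  rw [omega2Sec, toTotal_smulSec, D_wedge_fnForm, DirectSum.add_apply, Submodule.coe_add,
    Pi.add_apply, AlternatingMap.add_apply, wedge_one_apply_two, wedge_fnForm_apply,
    toTotal_apply, toTotal_apply, if_neg one_ne_zero]
  simp [omega2Sec]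

theorem D_toTotal_apply (hx : Fr.Good x) (s : Sec V F E) (p : ℕ)
    (w : Fin p → TangentSpace 𝓘(ℝ, V) x) :
    (R.D s.toTotal p).1 x w =
      ∑ i, (R.D (smulSec (Fr.coef i s) (Fr.sec i)).toTotal p).1 x w := by
  rw [← D_wedge_cut hx, Frame.wedge_cut_toTotal, map_sum, totalOmega_sum_apply]
  simp only [toTotal_smulSec]

theorem delSec_eq_sum (hx : Fr.Good x) (s : Sec V F E) :
    R.delSec s x = ∑ i, Fr.cov i x (s x) • R.delSec (Fr.sec i) x := by
  rw [delSec, D_toTotal_apply hx]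
  exact Finset.sum_congr rfl fun i _ => delSec_smulSec _ _

theorem nabla_eq_sum (hx : Fr.Good x) (s : Sec V F E) (X : TangentSpace 𝓘(ℝ, V) x) :
    R.nabla s x X = ∑ i, (mvfderiv 𝓘(ℝ, V) (Fr.coef i s) x X • Fr.sec i x +
      Fr.cov i x (s x) • R.nabla (Fr.sec i) x X) := by
  rw [nabla, D_toTotal_apply hx]
  exact Finset.sum_congr rfl fun i _ => nabla_smulSec _ _ _

theorem omega2Sec_eq_sum (hx : Fr.Good x) (s : Sec V F E) (X Y : TangentSpace 𝓘(ℝ, V) x) :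
    R.omega2Sec s x X Y = ∑ i, Fr.cov i x (s x) • R.omega2Sec (Fr.sec i) x X Y := by
  rw [omega2Sec, D_toTotal_apply hx]
  exact Finset.sum_congr rfl fun i _ => omega2Sec_smulSec _ _ _ _

/-- The degree zero part of `D` is linear over functions, hence pointwise. The frame writes down an
explicit linear map with the property by which `del` is chosen. -/
theorem del_apply_sec (hx : Fr.Good x) (s : Sec V F E) : R.del x (s x) = R.delSec s x := by
  have h : ∃ L : E x →ₗ[ℝ] E x, ∀ s : Sec V F E, L (s x) = R.delSec s x := by
    refine ⟨∑ i, (Fr.cov i x).smulRight (R.delSec (Fr.sec i) x), fun s => ?_⟩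
    rw [delSec_eq_sum hx]
    simp
  exact Classical.epsilon_spec h s

theorem omega2_apply_sec (hx : Fr.Good x) (s : Sec V F E) (X Y : TangentSpace 𝓘(ℝ, V) x) :
    R.omega2 x ![X, Y] (s x) = R.omega2Sec s x X Y := by
  have h : ∃ W : (TangentSpace 𝓘(ℝ, V) x) [⋀^Fin 2]→ₗ[ℝ] Module.End ℝ (E x),
      ∀ (s : Sec V F E) (X Y : TangentSpace 𝓘(ℝ, V) x),
        W ![X, Y] (s x) = R.omega2Sec s x X Y := by
    refine ⟨∑ i, ((LinearMap.smulRightₗ : (E x →ₗ[ℝ] ℝ) →ₗ[ℝ] E x →ₗ[ℝ] E x →ₗ[ℝ] E x)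
      (Fr.cov i x)).compAlternatingMap ((R.D (Fr.sec i).toTotal 2).1 x), fun s X Y => ?_⟩
    rw [omega2Sec_eq_sum hx, alternatingMap_sum_apply, LinearMap.sum_apply]
    rfl
  exact Classical.epsilon_spec h s X Y

variable (R) in
/-- The section `∂ s`. -/
def delSection (s : Sec V F E) : Sec V F E :=
  ⟨fun x => R.delSec s x, ((R.D s.toTotal 0).2 ![]).congr fun x => by
    rw [delSec]
    congr 2
    exact Subsingleton.elim _ _⟩

variable (R) in
/-- The section `∇_X s`. -/
def nablaSection (X : VField V M) (s : Sec V F E) : Sec V F E :=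
  ⟨fun x => R.nabla s x (X x), ((R.D s.toTotal 1).2 ![X]).congr fun x => by
    rw [nabla]
    congr 2
    funext i
    rw [Subsingleton.elim i 0]
    rfl⟩

variable (R) in
/-- The section `ω₂(X, Y) s`. -/
def omega2Section (X Y : VField V M) (s : Sec V F E) : Sec V F E :=
  ⟨fun x => R.omega2Sec s x (X x) (Y x), ((R.D s.toTotal 2).2 ![X, Y]).congr fun x => by
    rw [omega2Sec]
    congr 2
    funext i
    fin_cases i <;> rfl⟩

@[simp]
theorem delSection_apply (s : Sec V F E) (x : M) : R.delSection s x = R.delSec s x := rfl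

@[simp]
theorem nablaSection_apply (X : VField V M) (s : Sec V F E) (x : M) :
    R.nablaSection X s x = R.nabla s x (X x) := rfl

theorem nabla_sum {ι : Type*} (t : Finset ι) (X : ι → TangentSpace 𝓘(ℝ, V) x) (c : ι → ℝ)
    (s : Sec V F E) : R.nabla s x (∑ m ∈ t, c m • X m) = ∑ m ∈ t, c m • R.nabla s x (X m) := by
  have h : ∀ Y, R.nabla s x Y = (AlternatingMap.ofSubsingleton ℝ (TangentSpace 𝓘(ℝ, V) x) (E x)
      (0 : Fin 1)).symm ((R.D s.toTotal 1).1 x) Y := by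
    intro Y
    rw [nabla]
    change _ = ((R.D s.toTotal 1).1 x) _
    congr 1
    funext i
    rw [Subsingleton.elim i 0]
    rfl
  simp only [h, map_sum, map_smul]

theorem nabla_eq_sum_vf (hx : Fr.Good x) (s : Sec V F E) (X : TangentSpace 𝓘(ℝ, V) x) :
    R.nabla s x X = ∑ m, mvfderiv 𝓘(ℝ, V) (Fr.fn m) x X • R.nabla s x (Fr.vf m x) := by
  conv_lhs => rw [← hx.sum_vf X]
  exact nabla_sum _ _ _ _

theorem toForm_zero_apply (η : Omega V F E 0) (s : Sec V F E) (h : ∀ x, s x = η.1 x ![]) :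
    DirectSum.lof ℝ ℕ (fun p => Omega V F E p) 0 η = s.toTotal := by
  refine totalOmega_ext fun p x w => ?_
  rw [toTotal_apply, lof_apply_apply]
  by_cases hp : p = 0
  · subst hp
    rw [dif_pos rfl, if_pos rfl, h]
    congr 1
    exact Subsingleton.elim _ _
  · rw [dif_neg (Ne.symm hp), if_neg hp]

variable (hFr : ∀ x : M, ∃ Fr : Frame V F E, Fr.Good x)
include hFr

omit hFr in
theorem lof_D_zero (s : Sec V F E) :
    DirectSum.lof ℝ ℕ (fun p => Omega V F E p) 0 (R.D s.toTotal 0) = (R.delSection s).toTotal :=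
  toForm_zero_apply _ _ fun _ => rfl

theorem delSec_delSection (s : Sec V F E) : R.delSec (R.delSection s) x = 0 := by
  have h := D_apply_eq_sum (R := R) hFr (R.D s.toTotal) 0
  rw [R.sq_zero, Finset.sum_range_one, lof_D_zero] at h
  rw [delSec, ← h]
  rfl

theorem del_comp_del (x : M) : R.del x ∘ₗ R.del x = 0 := by
  obtain ⟨Fr, hx⟩ := hFr x
  ext u
  rw [LinearMap.comp_apply]
  conv_lhs => rw [← hx.through_apply u]
  rw [del_apply_sec hx, ← delSection_apply, del_apply_sec hx, delSec_delSection hFr]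
  rfl

omit hFr in
theorem contract_one_toTotal (X : VField V M) (η : Omega V F E 1) (s : Sec V F E)
    (h : ∀ x, s x = η.1 x ![X x]) :
    DirectSum.lof ℝ ℕ (fun p => Omega V F E p) 0 (Frame.contract X η) = s.toTotal :=
  toForm_zero_apply _ _ h

omit hFr in
/-- `∂` anticommutes with one-forms. -/
theorem D_lof_one (hx : Fr.Good x) (η : Omega V F E 1) (X : TangentSpace 𝓘(ℝ, V) x) :
    (R.D (DirectSum.lof ℝ ℕ (fun p => Omega V F E p) 1 η) 1).1 x ![X] =
      -R.del x (η.1 x ![X]) := by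
  have h := D_lof_succ (R := R) hx η 1 ![X]
  simp only [zero_add, Nat.cast_one, one_smul] at h
  rw [h]
  congr 1
  let s : Fr.κ → Sec V F E := fun m => ⟨fun x => η.1 x ![Fr.vf m x], (η.2 ![Fr.vf m]).congr
    fun x => by
      congr 2
      funext i
      rw [Subsingleton.elim i 0]
      rfl⟩
  have hs : ∀ m, (wedge (dForm (Fr.fn m)) (R.D (DirectSum.lof ℝ ℕ (fun p => Omega V F E p) 0
      (Frame.contract (Fr.vf m) η))) 1).1 x ![X] =
      mvfderiv 𝓘(ℝ, V) (Fr.fn m) x X • R.del x (η.1 x ![Fr.vf m x]) := by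
    intro m
    rw [contract_one_toTotal (Fr.vf m) η (s m) fun _ => rfl, wedge_one_apply_one, dForm_apply]
    congr 1
    exact (del_apply_sec hx (s m)).symm
  simp only [hs, ← map_smul, ← map_sum]
  congr 1
  have h2 : ∀ Y, η.1 x ![Y] = (AlternatingMap.ofSubsingleton ℝ (TangentSpace 𝓘(ℝ, V) x) (E x)
      (0 : Fin 1)).symm (η.1 x) Y := by
    intro Y
    change _ = (η.1 x) _
    congr 1
    funext i
    rw [Subsingleton.elim i 0]
    rfl
  simp only [h2, ← map_smul, ← map_sum]
  rw [hx.sum_vf]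

/-- `∇` commutes with `∂`. -/
theorem nabla_delSection (s : Sec V F E) (X : TangentSpace 𝓘(ℝ, V) x) :
    R.nabla (R.delSection s) x X = R.del x (R.nabla s x X) := by
  obtain ⟨Fr, hx⟩ := hFr x
  -- Degree one receives `∇` of the section `∂ s`, and `D` of the one-form `∇ s`, which contributes
  -- `-∂ ∇ s`.
  have h := D_apply_eq_sum (R := R) hFr (R.D s.toTotal) 1
  rw [R.sq_zero, Finset.sum_range_succ, Finset.sum_range_one, lof_D_zero] at h
  have h' := congrArg (fun ζ : Omega V F E 1 => ζ.1 x ![X]) h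
  simp only [Submodule.coe_add, Pi.add_apply, AlternatingMap.add_apply] at h'
  rw [D_lof_one hx] at h'
  exact (sub_eq_zero.1 (by rw [sub_eq_add_neg]; exact h'.symm))

omit hFr in
/-- `∂` commutes with two-forms. -/
theorem D_lof_two (hx : Fr.Good x) (η : Omega V F E 2) (X Y : TangentSpace 𝓘(ℝ, V) x) :
    (R.D (DirectSum.lof ℝ ℕ (fun p => Omega V F E p) 2 η) 2).1 x ![X, Y] =
      R.del x (η.1 x ![X, Y]) := by
  have h := D_lof_succ (R := R) hx η 2 ![X, Y]
  have hs : ∀ m, (wedge (dForm (Fr.fn m)) (R.D (DirectSum.lof ℝ ℕ (fun p => Omega V F E p) 1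
      (Frame.contract (Fr.vf m) η))) 2).1 x ![X, Y] =
      -R.del x (mvfderiv 𝓘(ℝ, V) (Fr.fn m) x X • (η.1 x).curryLeft (Fr.vf m x) ![Y] -
        mvfderiv 𝓘(ℝ, V) (Fr.fn m) x Y • (η.1 x).curryLeft (Fr.vf m x) ![X]) := by
    intro m
    rw [wedge_one_apply_two, D_lof_one hx, D_lof_one hx, map_sub, map_smul, map_smul, dForm_apply,
      dForm_apply, smul_neg, smul_neg, neg_sub, sub_neg_eq_add, neg_add_eq_sub]
    rfl
  simp only [hs, ← map_sum, Finset.sum_neg_distrib, neg_neg, Finset.sum_sub_distrib] at h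
  have h2 : ∀ Y Z : TangentSpace 𝓘(ℝ, V) x, ∑ m, mvfderiv 𝓘(ℝ, V) (Fr.fn m) x Y •
      (η.1 x).curryLeft (Fr.vf m x) ![Z] = η.1 x ![Y, Z] := by
    intro Y Z
    have h3 : ∑ m, mvfderiv 𝓘(ℝ, V) (Fr.fn m) x Y • (η.1 x).curryLeft (Fr.vf m x) ![Z] =
        (η.1 x).curryLeft (∑ m, mvfderiv 𝓘(ℝ, V) (Fr.fn m) x Y • Fr.vf m x) ![Z] := by
      rw [map_sum, alternatingMap_sum_apply]
      refine Finset.sum_congr rfl fun m _ => ?_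
      rw [map_smul]
      rfl
    rw [h3, hx.sum_vf]
    rfl
  have h4 : η.1 x ![Y, X] = -η.1 x ![X, Y] := by
    have h5 := (η.1 x).map_swap ![X, Y] (i := 0) (j := 1) (by decide)
    rw [← h5]
    congr 1
    funext i
    fin_cases i <;> simp
  -- By antisymmetry the two terms agree, and the resulting 2 cancels the factor `p + 1 = 2` of
  -- `D_lof_succ`.
  rw [h2, h2, h4, sub_neg_eq_add, map_add, ← two_smul ℝ (R.del x _)] at h
  refine smul_right_injective (E x) (two_ne_zero (α := ℝ)) (Eq.trans ?_ h)
  norm_num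

/-- The curvature of `∇` is the commutator of `∂` and `ω₂`, up to sign. -/
theorem sum_nabla_nabla (hx : Fr.Good x) (s : Sec V F E) (X Y : TangentSpace 𝓘(ℝ, V) x) :
    ∑ m, (mvfderiv 𝓘(ℝ, V) (Fr.fn m) x X • R.nabla (R.nablaSection (Fr.vf m) s) x Y -
      mvfderiv 𝓘(ℝ, V) (Fr.fn m) x Y • R.nabla (R.nablaSection (Fr.vf m) s) x X) =
    R.omega2 x ![X, Y] (R.del x (s x)) + R.del x (R.omega2 x ![X, Y] (s x)) := by
  -- Degree two receives `ω₂` of `∂ s`, `D` of the one-form `∇ s`, and `∂` of the two-form `ω₂ s`.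
  -- The middle term is expanded in the frame fields, which replaces the bracket term of the usual
  -- curvature formula.
  have h := D_apply_eq_sum (R := R) hFr (R.D s.toTotal) 2
  rw [R.sq_zero, Finset.sum_range_succ, Finset.sum_range_succ, Finset.sum_range_one,
    lof_D_zero] at h
  have h' := congrArg (fun ζ : Omega V F E 2 => ζ.1 x ![X, Y]) h
  simp only [Submodule.coe_add, Pi.add_apply, AlternatingMap.add_apply] at h'
  rw [D_lof_two hx] at h'
  have h1 := D_lof_succ (R := R) hx (R.D s.toTotal 1) 2 ![X, Y]
  simp only [zero_add, Nat.cast_one, one_smul] at h1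
  rw [h1] at h'
  have hs : ∀ m, (wedge (dForm (Fr.fn m)) (R.D (DirectSum.lof ℝ ℕ (fun p => Omega V F E p) 0
      (Frame.contract (Fr.vf m) (R.D s.toTotal 1)))) 2).1 x ![X, Y] =
      mvfderiv 𝓘(ℝ, V) (Fr.fn m) x X • R.nabla (R.nablaSection (Fr.vf m) s) x Y -
      mvfderiv 𝓘(ℝ, V) (Fr.fn m) x Y • R.nabla (R.nablaSection (Fr.vf m) s) x X := by
    intro m
    rw [contract_one_toTotal (Fr.vf m) _ (R.nablaSection (Fr.vf m) s) fun _ => rfl,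
      wedge_one_apply_two]
    rfl
  simp only [hs] at h'
  rw [del_apply_sec hx, omega2_apply_sec hx, ← delSection_apply, omega2_apply_sec hx]
  have h3 : R.omega2Sec (R.delSection s) x X Y +
      -∑ m, (mvfderiv 𝓘(ℝ, V) (Fr.fn m) x X • R.nabla (R.nablaSection (Fr.vf m) s) x Y -
      mvfderiv 𝓘(ℝ, V) (Fr.fn m) x Y • R.nabla (R.nablaSection (Fr.vf m) s) x X) +
      R.del x (R.omega2Sec s x X Y) = 0 := h'.symm
  rw [add_right_comm, ← sub_eq_add_neg, sub_eq_zero] at h3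
  exact h3.symm

end RepUpToHomotopy

end Components

end RepHomotopy

end

open Bundle Set MeasureTheory Filter
open scoped Manifold ContDiff DirectSum Topology

noncomputable section

namespace RepHomotopy

variable {V : Type*} [NormedAddCommGroup V] [NormedSpace ℝ V]
  {M : Type*} [TopologicalSpace M] [ChartedSpace V M] [IsManifold 𝓘(ℝ, V) ∞ M]
  {F : Type*} [NormedAddCommGroup F] [NormedSpace ℝ F]
  {E : M → Type*} [TopologicalSpace (TotalSpace F E)]
  [∀ x, AddCommGroup (E x)] [∀ x, Module ℝ (E x)] [∀ x, TopologicalSpace (E x)]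
  [FiberBundle F E] [VectorBundle ℝ F E]


/-! ### Existence of frames near compact sets -/

section FrameExistence

namespace Frame

/-- The union of two frames. -/
def union (A B : Frame V F E) : Frame V F E where
  ι := A.ι ⊕ B.ι
  κ := A.κ ⊕ B.κ
  fintypeι := inferInstance
  fintypeκ := inferInstance
  -- With cut-offs `a` and `b`, damping the second frame by `1 - a` gives the cut-off `1 - (1 - a)(1
  -- - b)`, which is 1 wherever `a` or `b` is.
  sec := Sum.elim A.sec fun i => smulSec (1 - A.cut) (B.sec i)
  cov := Sum.elim A.cov B.cov
  cov_smooth := by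
    rintro (i | i)
    · exact A.cov_smooth i
    · exact B.cov_smooth i
  fn := Sum.elim A.fn B.fn
  vf := Sum.elim A.vf fun m => ⟨fun x => (1 - A.cut) x • B.vf m x,
    (1 - A.cut).contMDiff.smul_section (B.vf m).contMDiff⟩
  cut := A.cut + (1 - A.cut) * B.cut
  sum_sec x u := by
    simp only [Fintype.sum_sum_type, Sum.elim_inl, Sum.elim_inr, smulSec_apply, A.sum_sec]
    simp only [smul_comm _ ((1 - A.cut) x), ← Finset.smul_sum, B.sum_sec]
    rw [smul_smul, ← add_smul]
    rfl
  sum_vf x v := by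
    simp only [Fintype.sum_sum_type, Sum.elim_inl, Sum.elim_inr, A.sum_vf, ContMDiffSection.coeFn_mk]
    simp only [smul_comm _ ((1 - A.cut) x), ← Finset.smul_sum, B.sum_vf]
    rw [smul_smul, ← add_smul]
    rfl

theorem Good.union_left {A : Frame V F E} {x : M} (hx : A.Good x) (B : Frame V F E) :
    (A.union B).Good x := by
  filter_upwards [hx] with y hy
  change A.cut y + (1 - A.cut y) * B.cut y = 1
  rw [hy]
  ring

theorem Good.union_right {B : Frame V F E} {x : M} (hx : B.Good x) (A : Frame V F E) :
    (A.union B).Good x := by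
  filter_upwards [hx] with y hy
  change A.cut y + (1 - A.cut y) * B.cut y = 1
  rw [hy]
  ring

/-- The frame without members. -/
def empty : Frame V F E where
  ι := PEmpty
  κ := PEmpty
  fintypeι := inferInstance
  fintypeκ := inferInstance
  sec := PEmpty.elim
  cov := fun i => i.elim
  cov_smooth := fun i => i.elim
  fn := PEmpty.elim
  vf := PEmpty.elim
  cut := 0
  sum_sec x u := by
    change _ = (0 : ℝ) • u
    simp
  sum_vf x v := by
    change _ = (0 : ℝ) • v
    simp

variable [T2Space M] [FiniteDimensional ℝ V] [FiniteDimensional ℝ F]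
  [ContMDiffVectorBundle ∞ F E 𝓘(ℝ, V)]

/-- A local frame, cut off with two bump functions. -/
def ofBump (p : M) (ρ₁ ρ₂ : SmoothBumpFunction 𝓘(ℝ, V) p)
    (h₁ : tsupport ρ₁ ⊆ (trivializationAt F E p).baseSet)
    (h₂ : tsupport ρ₂ ⊆ {x | ∀ᶠ y in 𝓝 x, ρ₁ y = 1}) : Frame V F E where
  ι := Fin (Module.finrank ℝ F)
  κ := Fin (Module.finrank ℝ V)
  fintypeι := inferInstance
  fintypeκ := inferInstance
  sec i := ⟨fun x => ρ₂ x • (trivializationAt F E p).localFrame (Module.finBasis ℝ F) i x,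
    ContMDiffOn.smul_section_of_tsupport ρ₂.contMDiff.contMDiffOn
      (trivializationAt F E p).open_baseSet
      (fun x hx => h₁ (subset_closure (by
        rw [Function.mem_support, (h₂ hx).self_of_nhds]; exact one_ne_zero)))
      ((trivializationAt F E p).contMDiffOn_localFrame_baseSet ∞ (Module.finBasis ℝ F) i)⟩
  -- The functionals and functions are cut off by `ρ₁`, the sections and vector fields by `ρ₂`.
  -- Since `ρ₁ = 1` near the support of `ρ₂`, neither `ρ₁` nor its derivative appears in the sums,
  -- and the total cut-off is `ρ₂`.
  cov i x := ρ₁ x • ((Module.finBasis ℝ F).coord i ∘ₗ (trivializationAt F E p).linearMapAt ℝ x)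
  cov_smooth i := by
    intro v
    by_cases hv : v.1 ∈ (trivializationAt F E p).baseSet
    · have hev := ((trivializationAt F E p).contMDiffOn (IB := 𝓘(ℝ, V)) (n := ∞)).contMDiffAt
        ((trivializationAt F E p).open_source.mem_nhds
          ((trivializationAt F E p).mem_source.2 hv))
      have h1 : ContMDiffAt (𝓘(ℝ, V).prod 𝓘(ℝ, F)) 𝓘(ℝ, ℝ) ∞
          (fun v : TotalSpace F E => ρ₁ v.1 *
            (LinearMap.toContinuousLinearMap ((Module.finBasis ℝ F).coord i))
              (trivializationAt F E p v).2) v :=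
        (ρ₁.contMDiff.contMDiffAt.comp v (Bundle.contMDiff_proj E).contMDiffAt).mul
          ((LinearMap.toContinuousLinearMap ((Module.finBasis ℝ F).coord i)).contMDiff.contMDiffAt.comp
            v hev.snd)
      refine h1.congr_of_eventuallyEq ?_
      filter_upwards [(FiberBundle.continuous_proj F E).continuousAt.preimage_mem_nhds
        ((trivializationAt F E p).open_baseSet.mem_nhds hv)] with w hw
      simp only [LinearMap.smul_apply, LinearMap.comp_apply, smul_eq_mul]
      rw [Trivialization.coe_linearMapAt_of_mem _ hw]
      rfl
    · have hv' : v.1 ∉ tsupport ρ₁ := fun h => hv (h₁ h)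
      refine (contMDiffAt_const (c := (0 : ℝ))).congr_of_eventuallyEq ?_
      filter_upwards [(FiberBundle.continuous_proj F E).continuousAt.preimage_mem_nhds
        ((isClosed_tsupport _).isOpen_compl.mem_nhds hv')] with w hw
      simp [image_eq_zero_of_notMem_tsupport hw]
  fn m := ⟨fun x => ρ₁ x • (Module.finBasis ℝ V).coord m (extChartAt 𝓘(ℝ, V) p x),
    ρ₁.contMDiff_smul ((LinearMap.toContinuousLinearMap
      ((Module.finBasis ℝ V).coord m)).contMDiff.comp_contMDiffOn contMDiffOn_extChartAt)⟩
  vf m := ⟨fun x => ρ₂ x •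
      (trivializationAt V (TangentSpace 𝓘(ℝ, V)) p).localFrame (Module.finBasis ℝ V) m x,
    ContMDiffOn.smul_section_of_tsupport ρ₂.contMDiff.contMDiffOn
      (trivializationAt V (TangentSpace 𝓘(ℝ, V)) p).open_baseSet
      (fun x hx => ρ₂.tsupport_subset_chartAt_source hx)
      ((trivializationAt V (TangentSpace 𝓘(ℝ, V)) p).contMDiffOn_localFrame_baseSet ∞
        (Module.finBasis ℝ V) m)⟩
  cut := ⟨ρ₂, ρ₂.contMDiff⟩
  sum_sec x u := by
    change ∑ i : Fin _, (ρ₁ x • (Module.finBasis ℝ F).coord i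
      ((trivializationAt F E p).linearMapAt ℝ x u)) • ρ₂ x •
        (trivializationAt F E p).localFrame (Module.finBasis ℝ F) i x = ρ₂ x • u
    by_cases hx : x ∈ tsupport ρ₂
    · have h1 : ρ₁ x = 1 := (h₂ hx).self_of_nhds
      have hb : x ∈ (trivializationAt F E p).baseSet := h₁ (subset_closure (by
        rw [Function.mem_support, h1]; exact one_ne_zero))
      simp only [smul_comm _ (ρ₂ x), ← Finset.smul_sum, h1, one_smul]
      congr 1
      conv_rhs => rw [← ((trivializationAt F E p).basisAt (Module.finBasis ℝ F) hb).sum_repr u]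
      refine Finset.sum_congr rfl fun i _ => ?_
      rw [Trivialization.localFrame_apply_of_mem_baseSet _ _ hb]
      congr 1
      simp [Trivialization.basisAt, Trivialization.coe_linearMapAt_of_mem _ hb]
    · simp [image_eq_zero_of_notMem_tsupport hx]
  sum_vf x v := by
    change ∑ m : Fin _, mvfderiv 𝓘(ℝ, V) (fun x => ρ₁ x • (Module.finBasis ℝ V).coord m
      (extChartAt 𝓘(ℝ, V) p x)) x v • (ρ₂ x • (trivializationAt V (TangentSpace 𝓘(ℝ, V)) p).localFrame
        (Module.finBasis ℝ V) m x : TangentSpace 𝓘(ℝ, V) x) = ρ₂ x • v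
    by_cases hx : x ∈ tsupport ρ₂
    · have hs : x ∈ (chartAt V p).source := ρ₂.tsupport_subset_chartAt_source hx
      have hb : x ∈ (trivializationAt V (TangentSpace 𝓘(ℝ, V)) p).baseSet := hs
      simp only [smul_comm _ (ρ₂ x), ← Finset.smul_sum]
      congr 1
      conv_rhs => rw [← ((trivializationAt V (TangentSpace 𝓘(ℝ, V)) p).basisAt
        (Module.finBasis ℝ V) hb).sum_repr v]
      refine Finset.sum_congr rfl fun m _ => ?_
      rw [Trivialization.localFrame_apply_of_mem_baseSet _ _ hb]
      congr 1
      have hc := mvfderiv_comp_apply (I := 𝓘(ℝ, V)) (I' := 𝓘(ℝ, V))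
        (g := LinearMap.toContinuousLinearMap ((Module.finBasis ℝ V).coord m)) x
        (LinearMap.toContinuousLinearMap
          ((Module.finBasis ℝ V).coord m)).differentiableAt.mdifferentiableAt
        (mdifferentiableAt_extChartAt (I := 𝓘(ℝ, V)) hs) v
      have he : (fun x => ρ₁ x • (Module.finBasis ℝ V).coord m (extChartAt 𝓘(ℝ, V) p x)) =ᶠ[𝓝 x]
          LinearMap.toContinuousLinearMap ((Module.finBasis ℝ V).coord m) ∘
            extChartAt 𝓘(ℝ, V) p := by
        filter_upwards [h₂ hx] with y hy
        rw [hy, one_smul]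
        rfl
      have he' := congrArg (fun L : TangentSpace 𝓘(ℝ, V) x →L[ℝ] ℝ => L v)
        (he.mfderiv_eq (I := 𝓘(ℝ, V)) (I' := 𝓘(ℝ, ℝ)))
      refine Eq.trans he' (hc.trans ?_)
      rw [← TangentBundle.continuousLinearMapAt_trivializationAt hs]
      have hd : ∀ (L : V →L[ℝ] ℝ) (y w : V), mvfderiv 𝓘(ℝ, V) L y w = L w := by
        intro L y w
        change mfderiv 𝓘(ℝ, V) 𝓘(ℝ, ℝ) L y w = L w
        rw [mfderiv_eq_fderiv, L.fderiv]
        rfl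
      refine (hd _ _ _).trans ?_
      change (Module.finBasis ℝ V).repr _ m = _
      simp only [Trivialization.basisAt, Module.Basis.map_repr, LinearEquiv.symm_symm,
        LinearEquiv.trans_apply, Trivialization.linearEquivAt_apply]
      have hl : (trivializationAt V (TangentSpace 𝓘(ℝ, V)) p).continuousLinearMapAt ℝ x v =
          (trivializationAt V (TangentSpace 𝓘(ℝ, V)) p ⟨x, v⟩).2 := by
        rw [Trivialization.continuousLinearMapAt_apply, Trivialization.coe_linearMapAt_of_mem _ hb]
      exact congrArg (fun w : V => (Module.finBasis ℝ V).repr w m) hl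
    · simp [image_eq_zero_of_notMem_tsupport hx]

theorem exists_good_point (p : M) : ∃ Fr : Frame V F E, Fr.Good p := by
  obtain ⟨ρ₁, -, h₁⟩ := (SmoothBumpFunction.nhds_basis_tsupport (I := 𝓘(ℝ, V)) p).mem_iff.1
    ((trivializationAt F E p).open_baseSet.mem_nhds (FiberBundle.mem_baseSet_trivializationAt' p))
  obtain ⟨ρ₂, -, h₂⟩ := (SmoothBumpFunction.nhds_basis_tsupport (I := 𝓘(ℝ, V)) p).mem_iff.1
    ρ₁.eventuallyEq_one.eventually_nhds
  exact ⟨ofBump p ρ₁ ρ₂ h₁ h₂, ρ₂.eventuallyEq_one⟩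

/-- Frames exist near each point, and unions of frames stay good, so compactness suffices. One
redundant frame along a whole path or homotopy makes it unnecessary to patch local trivializations.
-/
theorem exists_good {K : Set M} (hK : IsCompact K) :
    ∃ Fr : Frame V F E, ∀ x ∈ K, Fr.Good x := by
  refine hK.induction_on (p := fun s => ∃ Fr : Frame V F E, ∀ x ∈ s, Fr.Good x)
    ⟨empty, fun x hx => hx.elim⟩ (fun s t hst ht => ht.imp fun Fr h x hx => h x (hst hx)) ?_ ?_
  · rintro s t ⟨A, hA⟩ ⟨B, hB⟩
    exact ⟨A.union B, fun x hx => hx.elim (fun h => (hA x h).union_left B)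
      fun h => (hB x h).union_right A⟩
  · intro x _
    obtain ⟨Fr, h⟩ := exists_good_point (V := V) (F := F) (E := E) x
    exact ⟨_, mem_nhdsWithin_of_mem_nhds (eventually_eventually_nhds.2 h), Fr, fun y hy => hy⟩

end Frame

end FrameExistence

end RepHomotopy

end

open Bundle Set MeasureTheory Filter
open scoped Manifold ContDiff DirectSum Topology

noncomputable section

namespace RepHomotopy

variable {V : Type*} [NormedAddCommGroup V] [NormedSpace ℝ V]
  {M : Type*} [TopologicalSpace M] [ChartedSpace V M] [IsManifold 𝓘(ℝ, V) ∞ M]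
  {F : Type*} [NormedAddCommGroup F] [NormedSpace ℝ F]
  {E : M → Type*} [TopologicalSpace (TotalSpace F E)]
  [∀ x, AddCommGroup (E x)] [∀ x, Module ℝ (E x)] [∀ x, TopologicalSpace (E x)]
  [FiberBundle F E] [VectorBundle ℝ F E]


/-! ### Parallel transport in the coordinates of a frame -/

section Coordinates

namespace Frame

variable (Fr : Frame V F E)

/-- The coordinates of a vector of `E` with respect to a frame. -/
def coords (x : M) : E x →ₗ[ℝ] (Fr.ι → ℝ) := LinearMap.pi fun i => Fr.cov i x

/-- The vector with given coordinates. -/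
def comb (x : M) : (Fr.ι → ℝ) →ₗ[ℝ] E x := Fintype.linearCombination ℝ fun i => Fr.sec i x

@[simp]
theorem coords_apply (x : M) (u : E x) (i : Fr.ι) : Fr.coords x u i = Fr.cov i x u := rfl

theorem comb_apply (x : M) (w : Fr.ι → ℝ) : Fr.comb x w = ∑ i, w i • Fr.sec i x := by
  rw [comb, Fintype.linearCombination_apply]

variable {Fr} in
theorem Good.comb_coords {x : M} (hx : Fr.Good x) (u : E x) : Fr.comb x (Fr.coords x u) = u := by
  rw [comb_apply]
  exact hx.sum_sec u

/-- The operator on coordinates that maps the `k`-th basis vector to the coordinates of `s k`. -/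
def matrix (s : Fr.ι → Sec V F E) (x : M) : (Fr.ι → ℝ) →L[ℝ] (Fr.ι → ℝ) :=
  LinearMap.toContinuousLinearMap
    (Fr.coords x ∘ₗ Fintype.linearCombination ℝ fun k => s k x)

theorem matrix_apply (s : Fr.ι → Sec V F E) (x : M) (w : Fr.ι → ℝ) :
    Fr.matrix s x w = Fr.coords x (∑ k, w k • s k x) := by
  simp [matrix, Fintype.linearCombination_apply]

theorem contMDiff_matrix (s : Fr.ι → Sec V F E) :
    ContMDiff 𝓘(ℝ, V) 𝓘(ℝ, (Fr.ι → ℝ) →L[ℝ] (Fr.ι → ℝ)) ∞ (Fr.matrix s) := by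
  classical
  have h : Fr.matrix s = fun x => ∑ i, ∑ k, Fr.coef i (s k) x •
      (ContinuousLinearMap.proj (R := ℝ) (φ := fun _ : Fr.ι => ℝ) k).smulRight
        (Pi.single i (1 : ℝ) : Fr.ι → ℝ) := by
    funext x
    ext w j
    rw [matrix_apply]
    simp [Finset.sum_apply, Pi.single_apply, mul_comm]
  rw [h]
  refine contMDiff_finsetSum fun i _ => contMDiff_finsetSum fun k _ => ?_
  exact (Fr.coef i (s k)).contMDiff.smul contMDiff_const

/-- The projection of the trivial bundle onto the image of `E`. -/
abbrev proj : M → (Fr.ι → ℝ) →L[ℝ] (Fr.ι → ℝ) := Fr.matrix Fr.sec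

theorem proj_apply (x : M) (w : Fr.ι → ℝ) : Fr.proj x w = Fr.coords x (Fr.comb x w) := by
  rw [matrix_apply, comb_apply]

/-- The coordinates of a smooth section. -/
def coordsSec (s : Sec V F E) (x : M) : Fr.ι → ℝ := Fr.coords x (s x)

theorem contMDiff_coordsSec (s : Sec V F E) :
    ContMDiff 𝓘(ℝ, V) 𝓘(ℝ, Fr.ι → ℝ) ∞ (Fr.coordsSec s) :=
  contMDiff_pi_space.2 fun i => (Fr.coef i s).contMDiff

/-- The coordinates of a point of the total space. -/
def coordsTotal (v : TotalSpace F E) : Fr.ι → ℝ := Fr.coords v.1 v.2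

theorem continuous_coordsTotal : Continuous Fr.coordsTotal :=
  continuous_pi fun i => (Fr.cov_smooth i).continuous

end Frame

namespace RepUpToHomotopy

variable {G : Grading V F E} (R : RepUpToHomotopy G) (Fr : Frame V F E)

/-- The coefficient of the equation of parallel transport in coordinates, as a function of the
point of `M`, the derivatives of the functions `fn`, and the derivative of the projection. -/
def coefAt (x : M) (df : Fr.κ → ℝ) (dP : (Fr.ι → ℝ) →L[ℝ] (Fr.ι → ℝ)) :
    (Fr.ι → ℝ) →L[ℝ] (Fr.ι → ℝ) :=
  -- If `y = P y` along a curve, then `(1 - P) y' = (1 - P) P' y`. The second summand is therefore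
  -- the part of `y'` that leaves the image of `P`, and the first is the connection matrix.
  -∑ m, df m • Fr.matrix (fun k => R.nablaSection (Fr.vf m) (Fr.sec k)) x + (1 - Fr.proj x) * dP

/-- The coefficient of the equation of parallel transport along a curve, in coordinates. -/
def curveCoef (c : ℝ → M) (t : ℝ) : (Fr.ι → ℝ) →L[ℝ] (Fr.ι → ℝ) :=
  R.coefAt Fr (c t) (fun m => deriv (fun τ => Fr.fn m (c τ)) t) (deriv (fun τ => Fr.proj (c τ)) t)

/-- The velocity of a curve. -/
def velocity (c : ℝ → M) (t : ℝ) : TangentSpace 𝓘(ℝ, V) (c t) :=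
  mfderiv 𝓘(ℝ, ℝ) 𝓘(ℝ, V) c t (1 : ℝ)

variable {R Fr} {c : ℝ → M} {t : ℝ}

omit [IsManifold 𝓘(ℝ, V) ∞ M] in
theorem hasDerivAt_comp_curve {Y : Type*} [NormedAddCommGroup Y] [NormedSpace ℝ Y] {f : M → Y}
    (hf : ContMDiff 𝓘(ℝ, V) 𝓘(ℝ, Y) ∞ f) (hc : MDifferentiableAt 𝓘(ℝ, ℝ) 𝓘(ℝ, V) c t) :
    HasDerivAt (fun τ => f (c τ)) (mvfderiv 𝓘(ℝ, V) f (c t) (velocity c t)) t := by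
  have h1 : MDifferentiableAt 𝓘(ℝ, V) 𝓘(ℝ, Y) f (c t) := hf.mdifferentiableAt (by simp)
  have h2 : HasFDerivAt (f ∘ c) (mvfderiv 𝓘(ℝ, V) f (c t) ∘L mfderiv 𝓘(ℝ, ℝ) 𝓘(ℝ, V) c t :
      ℝ →L[ℝ] Y) t := hasMFDerivAt_iff_hasFDerivAt.1 (h1.hasMFDerivAt.comp t hc.hasMFDerivAt)
  exact h2.hasDerivAt

theorem curveCoef_eq (hc : MDifferentiableAt 𝓘(ℝ, ℝ) 𝓘(ℝ, V) c t) (m : Fr.κ) :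
    deriv (fun τ => Fr.fn m (c τ)) t = mvfderiv 𝓘(ℝ, V) (Fr.fn m) (c t) (velocity c t) :=
  (hasDerivAt_comp_curve (Fr.fn m).contMDiff hc).deriv

theorem sum_deriv_smul_nabla (hx : Fr.Good (c t)) (hc : MDifferentiableAt 𝓘(ℝ, ℝ) 𝓘(ℝ, V) c t)
    (s : Sec V F E) :
    ∑ m, deriv (fun τ => Fr.fn m (c τ)) t • R.nabla s (c t) (Fr.vf m (c t)) =
      R.nabla s (c t) (velocity c t) := by
  rw [nabla_eq_sum_vf hx s (velocity c t)]
  simp only [curveCoef_eq hc]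

theorem curveCoef_apply (hx : Fr.Good (c t)) (hc : MDifferentiableAt 𝓘(ℝ, ℝ) 𝓘(ℝ, V) c t)
    (w : Fr.ι → ℝ) : R.curveCoef Fr c t w =
      -Fr.coords (c t) (∑ k, w k • R.nabla (Fr.sec k) (c t) (velocity c t)) +
      (1 - Fr.proj (c t)) (deriv (fun τ => Fr.proj (c τ)) t w) := by
  rw [curveCoef, coefAt, add_apply, neg_apply, sum_apply,
    mul_apply_eq_comp]
  congr 2
  simp only [smul_apply, Frame.matrix_apply, nablaSection_apply, ← map_smul,
    ← map_sum]
  congr 1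
  simp only [Finset.smul_sum, ← sum_deriv_smul_nabla hx hc]
  rw [Finset.sum_comm]
  simp only [smul_comm (w _)]

/-- A combination of frame sections whose coordinates solve the equation is parallel. -/
theorem comb_curveCoef (hx : Fr.Good (c t)) (hc : MDifferentiableAt 𝓘(ℝ, ℝ) 𝓘(ℝ, V) c t)
    (w : Fr.ι → ℝ) : Fr.comb (c t) (R.curveCoef Fr c t w) +
      ∑ k, w k • R.nabla (Fr.sec k) (c t) (velocity c t) = 0 := by
  rw [curveCoef_apply hx hc, map_add, map_neg, hx.comb_coords, sub_apply,
    map_sub, Frame.proj_apply, hx.comb_coords]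
  simp

/-- In coordinates the covariant derivative is `y' - A y` with `A` the coefficient: the connection
matrix accounts for the part of `y'` in the image of `P`, and `(1 - P) P'` for the rest. -/
theorem hasDerivAt_coordsSec (hx : Fr.Good (c t)) (hc : MDifferentiableAt 𝓘(ℝ, ℝ) 𝓘(ℝ, V) c t)
    (s : Sec V F E) :
    HasDerivAt (fun τ => Fr.coordsSec s (c τ)) (R.curveCoef Fr c t (Fr.coordsSec s (c t)) +
      Fr.coords (c t) (R.nabla s (c t) (velocity c t))) t := by
  have hy := hasDerivAt_comp_curve (Fr.contMDiff_coordsSec s) hc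
  have hP := hasDerivAt_comp_curve (Fr.contMDiff_matrix Fr.sec) hc
  set y' := mvfderiv 𝓘(ℝ, V) (Fr.coordsSec s) (c t) (velocity c t) with hy'
  set P' := mvfderiv 𝓘(ℝ, V) (Fr.matrix Fr.sec) (c t) (velocity c t) with hP'
  have hPy : (fun τ => Fr.proj (c τ) (Fr.coordsSec s (c τ))) =ᶠ[𝓝 t]
      fun τ => Fr.coordsSec s (c τ) := by
    filter_upwards [hc.continuousAt.eventually (eventually_eventually_nhds.2 hx)] with τ hτ
    have hτ' : Fr.Good (c τ) := hτ
    rw [Frame.proj_apply, Frame.coordsSec, hτ'.comb_coords]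
  -- This is `P y = y` differentiated along the curve; it holds near `t` because goodness is an open
  -- condition.
  have hE : P' (Fr.coordsSec s (c t)) + Fr.proj (c t) y' = y' :=
    ((hP.clm_apply hy).congr_of_eventuallyEq hPy.symm).unique hy
  have hcomp : ∀ i, y' i = mvfderiv 𝓘(ℝ, V) (Fr.coef i s) (c t) (velocity c t) := fun i =>
    (hasDerivAt_pi.1 hy i).unique (hasDerivAt_comp_curve (Fr.coef i s).contMDiff hc)
  have hn : Fr.coords (c t) (R.nabla s (c t) (velocity c t)) = Fr.proj (c t) y' +
      Fr.coords (c t) (∑ k, Fr.coordsSec s (c t) k • R.nabla (Fr.sec k) (c t) (velocity c t)) := by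
    rw [Frame.proj_apply, ← map_add, Frame.comb_apply, ← Finset.sum_add_distrib,
      nabla_eq_sum hx]
    simp only [hcomp]
    rfl
  have hPP : Fr.proj (c t) (Fr.proj (c t) y') = Fr.proj (c t) y' := by
    rw [Frame.proj_apply, Frame.proj_apply, hx.comb_coords]
  convert! hy using 1
  rw [curveCoef_apply hx hc, hP.deriv, hn, eq_sub_of_add_eq hE, sub_apply,
    map_sub, map_sub, hPP]
  simp
  abel

/-- The derivative of the coordinates of a combination of sections along a curve. -/
theorem hasDerivAt_coords_sum {ι : Type*} [Fintype ι] (hx : Fr.Good (c t))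
    (hc : MDifferentiableAt 𝓘(ℝ, ℝ) 𝓘(ℝ, V) c t) (s : ι → Sec V F E) {f : ι → ℝ → ℝ} {f' : ι → ℝ}
    (hf : ∀ i, HasDerivAt (f i) (f' i) t) :
    HasDerivAt (fun τ => Fr.coords (c τ) (∑ i, f i τ • s i (c τ)))
      (R.curveCoef Fr c t (Fr.coords (c t) (∑ i, f i t • s i (c t))) + Fr.coords (c t)
        (∑ i, (f' i • s i (c t) + f i t • R.nabla (s i) (c t) (velocity c t)))) t := by
  have h := HasDerivAt.fun_sum (u := Finset.univ) fun i _ =>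
    (hf i).smul (hasDerivAt_coordsSec (R := R) hx hc (s i))
  convert! h using 1
  · funext τ
    simp [Frame.coordsSec]
  · simp only [map_sum, map_add, map_smul, ← Finset.sum_add_distrib, smul_add, Frame.coordsSec]
    refine Finset.sum_congr rfl fun i _ => ?_
    abel

theorem HasCovDerivAt.hasDerivAt (hx : Fr.Good (c t)) {σ : ℝ → TotalSpace F E} {v : E (c t)}
    (h : R.HasCovDerivAt c σ t v) :
    HasDerivAt (fun τ => Fr.coordsTotal (σ τ))
      (R.curveCoef Fr c t (Fr.coordsTotal (σ t)) + Fr.coords (c t) v) t := by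
  obtain ⟨hc, n, s, f, hf, hσ, rfl⟩ := h
  have h := hasDerivAt_coords_sum (R := R) hx hc s fun i => (hf i).hasDerivAt
  have he : (fun τ => Fr.coordsTotal (σ τ)) =ᶠ[𝓝 t]
      fun τ => Fr.coords (c τ) (∑ i, f i τ • s i (c τ)) := by
    filter_upwards [hσ] with τ hτ
    rw [hτ]
    rfl
  rw [he.eq_of_nhds]
  exact h.congr_of_eventuallyEq he

theorem hasCovDerivAt_comb (hx : Fr.Good (c t)) (hc : MDifferentiableAt 𝓘(ℝ, ℝ) 𝓘(ℝ, V) c t)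
    {w : ℝ → Fr.ι → ℝ} (hw : HasDerivAt w (R.curveCoef Fr c t (w t)) t) :
    R.HasCovDerivAt c (fun τ => ⟨c τ, Fr.comb (c τ) (w τ)⟩) t 0 := by
  let e := Fintype.equivFin Fr.ι
  have hw' := hasDerivAt_pi.1 hw
  refine ⟨hc, Fintype.card Fr.ι, fun i => Fr.sec (e.symm i), fun i τ => w τ (e.symm i),
    fun i => (hw' _).differentiableAt, Eventually.of_forall fun τ => ?_, ?_⟩
  · simp only [Frame.comb_apply]
    rw [← e.symm.sum_comp]
  · rw [← comb_curveCoef (R := R) hx hc (w t), Frame.comb_apply, ← Finset.sum_add_distrib,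
      ← e.symm.sum_comp]
    refine Finset.sum_congr rfl fun i _ => ?_
    rw [(hw' _).deriv]
    rfl

end RepUpToHomotopy

end Coordinates

end RepHomotopy

end

open Bundle Set MeasureTheory Filter
open scoped Manifold ContDiff DirectSum Topology

noncomputable section

namespace RepHomotopy

variable {V : Type*} [NormedAddCommGroup V] [NormedSpace ℝ V]
  {M : Type*} [TopologicalSpace M] [ChartedSpace V M] [IsManifold 𝓘(ℝ, V) ∞ M]
  {F : Type*} [NormedAddCommGroup F] [NormedSpace ℝ F]
  {E : M → Type*} [TopologicalSpace (TotalSpace F E)]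
  [∀ x, AddCommGroup (E x)] [∀ x, Module ℝ (E x)] [∀ x, TopologicalSpace (E x)]
  [FiberBundle F E] [VectorBundle ℝ F E]


/-! ### Existence, uniqueness and naturality of parallel transport -/

section Transport

variable {G : Grading V F E} {R : RepUpToHomotopy G} {Fr : Frame V F E}

namespace Frame

theorem continuousOn_comb {c : ℝ → M} {w : ℝ → Fr.ι → ℝ} {S : Set ℝ} (hc : ContinuousOn c S)
    (hw : ContinuousOn w S) :
    ContinuousOn (fun τ => (⟨c τ, Fr.comb (c τ) (w τ)⟩ : TotalSpace F E)) S := by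
  intro t ht
  rw [FiberBundle.continuousWithinAt_totalSpace]
  refine ⟨hc t ht, ?_⟩
  set e := trivializationAt F E (c t) with he
  have hb : c t ∈ e.baseSet := FiberBundle.mem_baseSet_trivializationAt' _
  have h1 : ∀ k, ContinuousWithinAt (fun τ => (e ⟨c τ, Fr.sec k (c τ)⟩).2) S t := by
    intro k
    have h2 : ContinuousAt (fun x => (e ⟨x, Fr.sec k x⟩).2) (c t) :=
      continuousAt_snd.comp ((e.continuousAt (e.mem_source.2 hb)).comp
        (Fr.sec k).contMDiff.continuous.continuousAt)
    exact h2.tendsto.comp (hc t ht)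
  have h3 : ContinuousWithinAt (fun τ => ∑ k, w τ k • (e ⟨c τ, Fr.sec k (c τ)⟩).2) S t :=
    tendsto_finsetSum _ fun k _ => (continuousWithinAt_pi.1 (hw t ht) k).smul (h1 k)
  have h4 : ∀ τ, c τ ∈ e.baseSet → (e ⟨c τ, Fr.comb (c τ) (w τ)⟩).2 =
      ∑ k, w τ k • (e ⟨c τ, Fr.sec k (c τ)⟩).2 := by
    intro τ hτ
    have h5 : ∀ u : E (c τ), (e ⟨c τ, u⟩).2 = e.linearMapAt ℝ (c τ) u := fun u => by
      rw [Trivialization.coe_linearMapAt_of_mem _ hτ]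
    simp only [h5, comb_apply, map_sum, map_smul]
  refine h3.congr_of_eventuallyEq ?_ (h4 t hb)
  filter_upwards [hc t ht (e.open_baseSet.mem_nhds hb)] with τ hτ
  exact h4 τ hτ

end Frame

namespace RepUpToHomotopy

variable {c : ℝ → M} {C : Finset ℝ} {K : ℝ} {W Z : ℝ → (Fr.ι → ℝ) →L[ℝ] (Fr.ι → ℝ)}

variable (R Fr) in
/-- The curve `c` has a propagator `W` for the equation of parallel transport in the coordinates
of a frame. -/
structure HasPropagator (c : ℝ → M) (C : Finset ℝ) (K : ℝ)
    (W Z : ℝ → (Fr.ι → ℝ) →L[ℝ] (Fr.ι → ℝ)) : Prop where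
  cont : Continuous c
  good : ∀ t, Fr.Good (c t)
  diff : ∀ t ∈ Ioo (0 : ℝ) 1, t ∉ C → MDifferentiableAt 𝓘(ℝ, ℝ) 𝓘(ℝ, V) c t
  propagator : IsPropagator (R.curveCoef Fr c) C K W Z

namespace HasPropagator

variable (h : HasPropagator R Fr c C K W Z) {s t : ℝ} (hs : s ∈ Icc (0 : ℝ) 1)
  (ht : t ∈ Icc (0 : ℝ) 1)
include h

theorem W_Z_apply (hs : s ∈ Icc (0 : ℝ) 1) (w : Fr.ι → ℝ) : W s (Z s w) = w :=
  congrArg (fun L => L w) (h.propagator.WZ s hs)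

theorem hasDerivAt {t : ℝ} (ht : t ∈ Ioo (0 : ℝ) 1) (htC : t ∉ C) (w : Fr.ι → ℝ) :
    HasDerivAt (fun t => W t w) (R.curveCoef Fr c t (W t w)) t :=
  h.propagator.hasDerivAt_apply w ht htC

theorem isParallel_comb (w : Fr.ι → ℝ) :
    R.IsParallel c fun τ => ⟨c τ, Fr.comb (c τ) (W τ w)⟩ :=
  ⟨fun _ _ => rfl, Frame.continuousOn_comb h.cont.continuousOn
    (h.propagator.contW.clm_apply continuous_const).continuousOn, C, fun t ht htC =>
      hasCovDerivAt_comb (h.good t) (h.diff t ht htC) (h.hasDerivAt ht htC w)⟩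

-- The coordinates of any parallel section solve the linear system, so its uniqueness theorem gives
-- that of parallel sections.
include hs ht in
theorem coordsTotal_eq {σ : ℝ → TotalSpace F E} (hσ : R.IsParallel c σ) :
    Fr.coordsTotal (σ t) = W t (Z s (Fr.coordsTotal (σ s))) := by
  obtain ⟨-, hcont, B, hB⟩ := hσ
  refine h.propagator.apply_eq (B₁ := B) (Fr.continuous_coordsTotal.comp_continuousOn hcont) ?_ hs ht
  intro r hr hrB
  have h1 := (hB r hr hrB).hasDerivAt (h.good r)
  rw [map_zero, add_zero] at h1
  exact h1

include hs ht in
/-- An operator on sections that commutes with the covariant derivative commutes with parallel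
transport. -/
theorem comb_comm (A : ∀ x, E x →ₗ[ℝ] E x) (AS : Sec V F E → Sec V F E)
    (hA : ∀ s x, AS s x = A x (s x))
    (hn : ∀ (s : Sec V F E) (x : M) (X : TangentSpace 𝓘(ℝ, V) x),
      R.nabla (AS s) x X = A x (R.nabla s x X)) (w : Fr.ι → ℝ) :
    A (c t) (Fr.comb (c t) (W t w)) =
      Fr.comb (c t) (W t (Z s (Fr.coords (c s) (A (c s) (Fr.comb (c s) (W s w)))))) := by
  have hw : ∀ τ, A (c τ) (Fr.comb (c τ) (W τ w)) = ∑ k, W τ w k • AS (Fr.sec k) (c τ) := by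
    intro τ
    rw [Frame.comb_apply]
    simp only [map_sum, map_smul, hA]
  -- The operator maps the parallel section to another parallel one, so the coordinates of the image
  -- solve the same system and are determined by their value at time `s`.
  have key := h.propagator.apply_eq
    (w := fun τ => Fr.coords (c τ) (A (c τ) (Fr.comb (c τ) (W τ w)))) (B₁ := C) ?_ ?_ hs ht
  · rw [← key, (h.good t).comb_coords]
  · simp only [hw, map_sum, map_smul]
    refine (continuous_finsetSum _ fun k _ => ?_).continuousOn
    exact (((continuous_apply k).comp (h.propagator.contW.clm_apply continuous_const))).smul
      ((Fr.contMDiff_coordsSec (AS (Fr.sec k))).continuous.comp h.cont)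
  · intro r hr hrC
    have h1 := hasDerivAt_coords_sum (R := R) (h.good r) (h.diff r hr hrC)
      (fun k => AS (Fr.sec k)) (hasDerivAt_pi.1 (h.hasDerivAt hr hrC w))
    simp only [hw]
    convert! h1 using 1
    rw [left_eq_add]
    simp only [hA, hn, ← map_smul, ← map_add, ← map_sum]
    rw [Finset.sum_add_distrib, ← Frame.comb_apply,
      comb_curveCoef (h.good r) (h.diff r hr hrC), map_zero, map_zero]

-- The system also has solutions outside the image of `coords`. One that starts in the image is the
-- coordinate vector of a parallel section and so stays there.
include hs ht in
theorem coords_comb (u : E (c s)) :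
    Fr.coords (c t) (Fr.comb (c t) (W t (Z s (Fr.coords (c s) u)))) =
      W t (Z s (Fr.coords (c s) u)) := by
  have h1 := h.coordsTotal_eq hs ht (h.isParallel_comb (Z s (Fr.coords (c s) u)))
  have h2 : Fr.coordsTotal (⟨c s, Fr.comb (c s) (W s (Z s (Fr.coords (c s) u)))⟩ : TotalSpace F E) =
      Fr.coords (c s) u := by
    rw [h.W_Z_apply hs, (h.good s).comb_coords]
    rfl
  rw [h2] at h1
  exact h1

include hs ht in
theorem isParallelTransport {p q : M} (hp : c s = p) (hq : c t = q) :
    R.IsParallelTransport c s t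
      (Fr.comb q ∘ₗ (W t * Z s : (Fr.ι → ℝ) →L[ℝ] (Fr.ι → ℝ)).toLinearMap ∘ₗ Fr.coords p) := by
  subst hp hq
  refine ⟨fun u => ⟨_, h.isParallel_comb (Z s (Fr.coords (c s) u)), ?_⟩, fun u σ hσ hu => ?_⟩
  · simp only [h.W_Z_apply hs, (h.good s).comb_coords]
  · have h1 := h.coordsTotal_eq hs ht hσ
    have h2 : Fr.coordsTotal (σ s) = Fr.coords (c s) u := by
      rw [hu]
      rfl
    rw [h2] at h1
    obtain ⟨v, h3⟩ : ∃ v : E (c t), σ t = ⟨c t, v⟩ := by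
      have h4 := hσ.1 t ht
      generalize σ t = v at h4 ⊢
      obtain ⟨x, v⟩ := v
      subst h4
      exact ⟨v, rfl⟩
    rw [h3] at h1 ⊢
    congr 1
    refine ((h.good t).comb_coords _).symm.trans ?_
    exact congrArg _ h1

-- A parallel section passes through every vector, so two linear maps with the transport property
-- agree; the choice made in `transport` does not matter.
include hs ht in
theorem transport_eq {p q : M} (hp : c s = p) (hq : c t = q) :
    R.transport c s t p q =
      Fr.comb q ∘ₗ (W t * Z s : (Fr.ι → ℝ) →L[ℝ] (Fr.ι → ℝ)).toLinearMap ∘ₗ Fr.coords p := by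
  have h1 := h.isParallelTransport hs ht hp hq
  have h2 : R.IsParallelTransport c s t (R.transport c s t p q) :=
    Classical.epsilon_spec ⟨_, h1⟩
  ext u
  obtain ⟨σ, hσ, hu⟩ := h1.exists_parallel u
  have h3 := (h2.eq_apply u σ hσ hu).symm.trans (h1.eq_apply u σ hσ hu)
  exact eq_of_heq (TotalSpace.mk.inj h3).2

include hs ht in
theorem transport_apply {p q : M} (hp : c s = p) (hq : c t = q) (u : E p) :
    R.transport c s t p q u = Fr.comb q (W t (Z s (Fr.coords p u))) := by
  rw [h.transport_eq hs ht hp hq]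
  rfl

include hs ht in
theorem transport_comm (A : ∀ x, E x →ₗ[ℝ] E x) (AS : Sec V F E → Sec V F E)
    (hA : ∀ s x, AS s x = A x (s x))
    (hn : ∀ (s : Sec V F E) (x : M) (X : TangentSpace 𝓘(ℝ, V) x),
      R.nabla (AS s) x X = A x (R.nabla s x X)) {p q : M} (hp : c s = p) (hq : c t = q) (u : E p) :
    A q (R.transport c s t p q u) = R.transport c s t p q (A p u) := by
  rw [h.transport_apply hs ht hp hq, h.transport_apply hs ht hp hq]
  subst hp hq
  rw [h.comb_comm hs ht A AS hA hn, h.W_Z_apply hs, (h.good s).comb_coords]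

end HasPropagator

end RepUpToHomotopy

end Transport

end RepHomotopy

end

open Bundle Set MeasureTheory Filter
open scoped Manifold ContDiff DirectSum Topology

noncomputable section

namespace RepHomotopy

variable {V : Type*} [NormedAddCommGroup V] [NormedSpace ℝ V]
  {M : Type*} [TopologicalSpace M] [ChartedSpace V M] [IsManifold 𝓘(ℝ, V) ∞ M]
  {F : Type*} [NormedAddCommGroup F] [NormedSpace ℝ F]
  {E : M → Type*} [TopologicalSpace (TotalSpace F E)]
  [∀ x, AddCommGroup (E x)] [∀ x, Module ℝ (E x)] [∀ x, TopologicalSpace (E x)]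
  [FiberBundle F E] [VectorBundle ℝ F E]


/-! ### Families of curves and their curvature -/

section Families

/-- A continuous family of curves from `x` to `y` that is smooth on each closed rectangle of a
subdivision of the unit square. -/
structure IsSmoothFamily (V : Type*) [NormedAddCommGroup V] [NormedSpace ℝ V] {M : Type*}
    [TopologicalSpace M] [ChartedSpace V M] (B C : Finset ℝ) (H : ℝ → ℝ → M) (x y : M) :
    Prop where
  cont : Continuous fun z : ℝ × ℝ => H z.1 z.2
  smooth : ∀ a b a' b', IsCell B a b → IsCell C a' b' →
    ContMDiffOn 𝓘(ℝ, ℝ × ℝ) 𝓘(ℝ, V) ∞ (fun z : ℝ × ℝ => H z.1 z.2) (Icc a b ×ˢ Icc a' b')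
  left : ∀ e, H e 0 = x
  right : ∀ e, H e 1 = y

theorem contDiffOn_fderivWithin_apply {Y : Type*} [NormedAddCommGroup Y] [NormedSpace ℝ Y]
    {g : ℝ × ℝ → Y} {a b a' b' : ℝ} (hg : ContDiffOn ℝ ∞ g (Icc a b ×ˢ Icc a' b'))
    (hab : a < b) (hab' : a' < b') (v : ℝ × ℝ) :
    ContDiffOn ℝ 1 (fun z => fderivWithin ℝ g (Icc a b ×ˢ Icc a' b') z v) (Icc a b ×ˢ Icc a' b') :=
  (hg.fderivWithin (uniqueDiffOn_rectangle hab hab') (m := 1) (by norm_cast)).clm_apply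
    contDiffOn_const

/-- The mixed second partial derivatives agree. -/
theorem exists_hasDerivAt_deriv {Y : Type*} [NormedAddCommGroup Y] [NormedSpace ℝ Y]
    {g : ℝ × ℝ → Y} {e t : ℝ} (hg : ContDiffAt ℝ 2 g (e, t)) :
    ∃ d, HasDerivAt (fun r => deriv (fun τ => g (r, τ)) t) d e ∧
      HasDerivAt (fun τ => deriv (fun r => g (r, τ)) e) d t := by
  have h1 : ∀ᶠ z in 𝓝 (e, t), DifferentiableAt ℝ g z :=
    (hg.eventually (by simp)).mono fun z hz => hz.differentiableAt two_ne_zero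
  have h2 : HasFDerivAt (fderiv ℝ g) (fderiv ℝ (fderiv ℝ g) (e, t)) (e, t) :=
    ((hg.fderiv_right (m := 1) (by norm_num)).differentiableAt one_ne_zero).hasFDerivAt
  have hsymm : fderiv ℝ (fderiv ℝ g) (e, t) (1, 0) (0, 1) =
      fderiv ℝ (fderiv ℝ g) (e, t) (0, 1) (1, 0) :=
    (hg.isSymmSndFDerivAt (by simp)).eq _ _
  refine ⟨fderiv ℝ (fderiv ℝ g) (e, t) (1, 0) (0, 1), ?_, ?_⟩
  · have hl : HasDerivAt (fun r : ℝ => (r, t)) (1, 0) e :=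
      (hasDerivAt_id e).prodMk (hasDerivAt_const e t)
    have h3 : HasDerivAt (fun r => fderiv ℝ g (r, t)) (fderiv ℝ (fderiv ℝ g) (e, t) (1, 0)) e :=
      HasFDerivAt.comp_hasDerivAt (f := fun r : ℝ => (r, t)) e h2 hl
    have h4 : HasDerivAt (fun r => fderiv ℝ g (r, t) (0, 1))
        (fderiv ℝ (fderiv ℝ g) (e, t) (1, 0) (0, 1)) e := by
      simpa using h3.clm_apply (hasDerivAt_const e ((0, 1) : ℝ × ℝ))
    have h6 : ∀ᶠ r in 𝓝 e, DifferentiableAt ℝ g (r, t) :=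
      (show Tendsto (fun r : ℝ => (r, t)) (𝓝 e) (𝓝 (e, t)) from hl.continuousAt).eventually h1
    refine h4.congr_of_eventuallyEq (h6.mono fun r hr => ?_)
    have h5 : HasDerivAt (fun τ => g (r, τ)) (fderiv ℝ g (r, t) (0, 1)) t :=
      HasFDerivAt.comp_hasDerivAt (f := fun τ : ℝ => (r, τ)) t hr.hasFDerivAt
        ((hasDerivAt_const t r).prodMk (hasDerivAt_id t))
    exact h5.deriv
  · have hl : HasDerivAt (fun τ : ℝ => (e, τ)) (0, 1) t :=
      (hasDerivAt_const t e).prodMk (hasDerivAt_id t)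
    have h3 : HasDerivAt (fun r => fderiv ℝ g (e, r)) (fderiv ℝ (fderiv ℝ g) (e, t) (0, 1)) t :=
      HasFDerivAt.comp_hasDerivAt (f := fun r : ℝ => (e, r)) t h2 hl
    have h4 : HasDerivAt (fun r => fderiv ℝ g (e, r) (1, 0))
        (fderiv ℝ (fderiv ℝ g) (e, t) (1, 0) (0, 1)) t := by
      rw [hsymm]
      simpa using h3.clm_apply (hasDerivAt_const t ((1, 0) : ℝ × ℝ))
    have h6 : ∀ᶠ r in 𝓝 t, DifferentiableAt ℝ g (e, r) :=
      (show Tendsto (fun r : ℝ => (e, r)) (𝓝 t) (𝓝 (e, t)) from hl.continuousAt).eventually h1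
    refine h4.congr_of_eventuallyEq (h6.mono fun r hr => ?_)
    have h5 : HasDerivAt (fun τ => g (τ, r)) (fderiv ℝ g (e, r) (1, 0)) e :=
      HasFDerivAt.comp_hasDerivAt (f := fun τ : ℝ => (τ, r)) e hr.hasFDerivAt
        ((hasDerivAt_id e).prodMk (hasDerivAt_const e r))
    exact h5.deriv

variable {G : Grading V F E} {R : RepUpToHomotopy G} {Fr : Frame V F E}

namespace IsSmoothFamily

variable {B C : Finset ℝ} {H : ℝ → ℝ → M} {x y : M} (h : IsSmoothFamily V B C H x y)
include h

omit [IsManifold 𝓘(ℝ, V) ∞ M] in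
theorem contDiffOn_comp {Y : Type*} [NormedAddCommGroup Y] [NormedSpace ℝ Y] {f : M → Y}
    (hf : ContMDiff 𝓘(ℝ, V) 𝓘(ℝ, Y) ∞ f) {a b a' b' : ℝ} (hab : IsCell B a b)
    (hab' : IsCell C a' b') :
    ContDiffOn ℝ ∞ (fun z : ℝ × ℝ => f (H z.1 z.2)) (Icc a b ×ˢ Icc a' b') :=
  contMDiffOn_iff_contDiffOn.1 (hf.comp_contMDiffOn (h.smooth a b a' b' hab hab'))

omit [IsManifold 𝓘(ℝ, V) ∞ M] in
theorem contDiffAt_comp {Y : Type*} [NormedAddCommGroup Y] [NormedSpace ℝ Y] {f : M → Y}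
    (hf : ContMDiff 𝓘(ℝ, V) 𝓘(ℝ, Y) ∞ f) {e t : ℝ} (he : e ∈ Ioo (0 : ℝ) 1) (heB : e ∉ B)
    (ht : t ∈ Ioo (0 : ℝ) 1) (htC : t ∉ C) :
    ContDiffAt ℝ 2 (fun z : ℝ × ℝ => f (H z.1 z.2)) (e, t) := by
  obtain ⟨a, b, hab, he'⟩ := exists_isCell he heB
  obtain ⟨a', b', hab', ht'⟩ := exists_isCell ht htC
  exact ((h.contDiffOn_comp hf hab hab').contDiffAt
    (prod_mem_nhds (Icc_mem_nhds he'.1 he'.2) (Icc_mem_nhds ht'.1 ht'.2))).of_le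
      (by norm_cast)

omit [IsManifold 𝓘(ℝ, V) ∞ M] in
theorem mdifferentiableAt_snd {e t : ℝ} (he : e ∈ Icc (0 : ℝ) 1)
    (ht : t ∈ Ioo (0 : ℝ) 1) (htC : t ∉ C) :
    MDifferentiableAt 𝓘(ℝ, ℝ) 𝓘(ℝ, V) (H e) t := by
  obtain ⟨a, b, hab, he'⟩ := exists_isCell_mem_Icc B he
  obtain ⟨a', b', hab', ht'⟩ := exists_isCell ht htC
  have h1 : ContMDiffOn 𝓘(ℝ, ℝ) 𝓘(ℝ, ℝ × ℝ) ∞ (fun τ : ℝ => (e, τ)) (Icc a' b') :=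
    (contDiff_const.prodMk contDiff_id).contMDiff.contMDiffOn
  exact (((h.smooth a b a' b' hab hab').comp h1 fun τ hτ => mk_mem_prod he' hτ).contMDiffAt
    (Icc_mem_nhds ht'.1 ht'.2)).mdifferentiableAt (by simp)

omit [IsManifold 𝓘(ℝ, V) ∞ M] in
theorem mdifferentiableAt_fst {e t : ℝ} (he : e ∈ Ioo (0 : ℝ) 1) (heB : e ∉ B)
    (ht : t ∈ Icc (0 : ℝ) 1) :
    MDifferentiableAt 𝓘(ℝ, ℝ) 𝓘(ℝ, V) (fun r => H r t) e := by
  obtain ⟨a, b, hab, he'⟩ := exists_isCell he heB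
  obtain ⟨a', b', hab', ht'⟩ := exists_isCell_mem_Icc C ht
  have h1 : ContMDiffOn 𝓘(ℝ, ℝ) 𝓘(ℝ, ℝ × ℝ) ∞ (fun τ : ℝ => (τ, t)) (Icc a b) :=
    (contDiff_id.prodMk contDiff_const).contMDiff.contMDiffOn
  exact (((h.smooth a b a' b' hab hab').comp h1 fun τ hτ => mk_mem_prod hτ ht').contMDiffAt
    (Icc_mem_nhds he'.1 he'.2)).mdifferentiableAt (by simp)

theorem contDiffOn_coefAt {a b a' b' : ℝ} (hab : IsCell B a b) (hab' : IsCell C a' b')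
    (v : ℝ × ℝ) :
    ContDiffOn ℝ 1 (fun z : ℝ × ℝ => R.coefAt Fr (H z.1 z.2)
      (fun m => fderivWithin ℝ (fun z : ℝ × ℝ => Fr.fn m (H z.1 z.2)) (Icc a b ×ˢ Icc a' b') z v)
      (fderivWithin ℝ (fun z : ℝ × ℝ => Fr.proj (H z.1 z.2)) (Icc a b ×ˢ Icc a' b') z v))
      (Icc a b ×ˢ Icc a' b') := by
  have hle : (1 : WithTop ℕ∞) ≤ ∞ := by norm_cast
  have h1 : ContDiffOn ℝ 1 (fun z : ℝ × ℝ => ∑ m, fderivWithin ℝ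
      (fun z : ℝ × ℝ => Fr.fn m (H z.1 z.2)) (Icc a b ×ˢ Icc a' b') z v •
        Fr.matrix (fun k => R.nablaSection (Fr.vf m) (Fr.sec k)) (H z.1 z.2))
      (Icc a b ×ˢ Icc a' b') :=
    ContDiffOn.sum fun m _ =>
      (contDiffOn_fderivWithin_apply (h.contDiffOn_comp (Fr.fn m).contMDiff hab hab')
        hab.lt hab'.lt v).smul ((h.contDiffOn_comp (Fr.contMDiff_matrix _) hab hab').of_le hle)
  exact h1.neg.add ((contDiffOn_const.sub
    ((h.contDiffOn_comp (Fr.contMDiff_matrix _) hab hab').of_le hle)).mul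
      (contDiffOn_fderivWithin_apply (h.contDiffOn_comp (Fr.contMDiff_matrix _) hab hab')
        hab.lt hab'.lt v))

/-- The coefficients involve the family only through smooth functions composed with `H` and their
first partial derivatives, which are `C¹` on each closed cell. At times 0 and 1 the curve in the
direction of `e` is constant, so its coefficient vanishes. -/
theorem isHomotopyCoefficient :
    IsHomotopyCoefficient B C (fun e t => R.curveCoef Fr (H e) t)
      (fun e t => R.curveCoef Fr (fun r => H r t) e) := by
  have hle : (1 : WithTop ℕ∞) ≤ ∞ := by norm_cast
  have h0 : ∀ (p : M) (e : ℝ), R.curveCoef Fr (fun _ => p) e = 0 := by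
    intro p e
    simp [RepUpToHomotopy.curveCoef, RepUpToHomotopy.coefAt]
  refine ⟨fun a b a' b' hab hab' => ⟨_, h.contDiffOn_coefAt (R := R) (Fr := Fr) hab hab' (0, 1),
      fun e he t ht => ?_⟩,
    fun a b a' b' hab hab' => ⟨_, h.contDiffOn_coefAt (R := R) (Fr := Fr) hab hab' (1, 0),
      fun e he t ht => ?_⟩,
    fun e => ?_, fun e _ => ?_, fun e _ => ?_⟩
  · have hd : ∀ {Y : Type} [NormedAddCommGroup Y] [NormedSpace ℝ Y] {f : M → Y},
        ContMDiff 𝓘(ℝ, V) 𝓘(ℝ, Y) ∞ f → deriv (fun τ => f (H e τ)) t = fderivWithin ℝ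
          (fun z : ℝ × ℝ => f (H z.1 z.2)) (Icc a b ×ˢ Icc a' b') (e, t) (0, 1) := fun hf =>
      (hasDerivAt_snd_of_contDiffOn ((h.contDiffOn_comp hf hab hab').of_le hle) he ht).deriv
    simp only [RepUpToHomotopy.curveCoef, hd (Fr.contMDiff_matrix Fr.sec),
      fun m => hd (Fr.fn m).contMDiff]
  · have hd : ∀ {Y : Type} [NormedAddCommGroup Y] [NormedSpace ℝ Y] {f : M → Y},
        ContMDiff 𝓘(ℝ, V) 𝓘(ℝ, Y) ∞ f → deriv (fun r => f (H r t)) e = fderivWithin ℝ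
          (fun z : ℝ × ℝ => f (H z.1 z.2)) (Icc a b ×ˢ Icc a' b') (e, t) (1, 0) := fun hf =>
      (hasDerivAt_fst_of_contDiffOn ((h.contDiffOn_comp hf hab hab').of_le hle) he ht).deriv
    simp only [RepUpToHomotopy.curveCoef, hd (Fr.contMDiff_matrix Fr.sec),
      fun m => hd (Fr.fn m).contMDiff]
  · have hcont : Continuous (H e) := h.cont.comp (by fun_prop : Continuous fun t : ℝ => (e, t))
    have hm : ∀ s : Fr.ι → Sec V F E, StronglyMeasurable fun t => Fr.matrix s (H e t) := fun s =>
      ((Fr.contMDiff_matrix s).continuous.comp hcont).stronglyMeasurable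
    refine StronglyMeasurable.add (StronglyMeasurable.neg ?_) (StronglyMeasurable.mul
      (stronglyMeasurable_const.sub (hm _)) (stronglyMeasurable_deriv _))
    exact Finset.stronglyMeasurable_fun_sum _ fun m _ =>
      (stronglyMeasurable_deriv fun τ => Fr.fn m (H e τ)).smul
        (hm fun k => R.nablaSection (Fr.vf m) (Fr.sec k))
  · simp only [h.left, h0]
  · simp only [h.right, h0]

theorem exists_hasPropagator (hgood : ∀ e t, Fr.Good (H e t)) :
    ∃ (K : ℝ) (W Z : ℝ → ℝ → (Fr.ι → ℝ) →L[ℝ] (Fr.ι → ℝ)), ∀ e ∈ Icc (0 : ℝ) 1,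
      IsCoefficient (R.curveCoef Fr (H e)) C K ∧ R.HasPropagator Fr (H e) C K (W e) (Z e) := by
  obtain ⟨K, hK⟩ := (h.isHomotopyCoefficient (R := R) (Fr := Fr)).exists_isCoefficient
  choose! W Z hW using fun e he => (hK e he).exists_propagator
  exact ⟨K, W, Z, fun e he => ⟨hK e he, h.cont.comp (by fun_prop : Continuous fun t : ℝ => (e, t)),
    hgood e, fun t ht htC => h.mdifferentiableAt_snd he ht htC, hW e he⟩⟩

end IsSmoothFamily

namespace RepUpToHomotopy

variable {H : ℝ → ℝ → M} {e t : ℝ}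

/-- The mixed second derivative of the coordinates of a section along a family of curves. -/
theorem hasDerivAt_deriv_coordsSec (hgood : ∀ e t, Fr.Good (H e t))
    (h1 : ∀ᶠ r in 𝓝 e, MDifferentiableAt 𝓘(ℝ, ℝ) 𝓘(ℝ, V) (H r) t)
    (h2 : MDifferentiableAt 𝓘(ℝ, ℝ) 𝓘(ℝ, V) (fun r => H r t) e)
    (hG : DifferentiableAt ℝ (fun r => R.curveCoef Fr (H r) t) e) {d : Fr.κ → ℝ}
    (hd : ∀ m, HasDerivAt (fun r => deriv (fun τ => Fr.fn m (H r τ)) t) (d m) e)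
    (s : Sec V F E) :
    HasDerivAt (fun r => deriv (fun τ => Fr.coordsSec s (H r τ)) t)
      (deriv (fun r => R.curveCoef Fr (H r) t) e (Fr.coordsSec s (H e t)) +
        R.curveCoef Fr (H e) t (R.curveCoef Fr (fun r => H r t) e (Fr.coordsSec s (H e t)) +
          Fr.coords (H e t) (∑ m, deriv (fun r => Fr.fn m (H r t)) e •
            R.nablaSection (Fr.vf m) s (H e t))) +
        ∑ m, (deriv (fun τ => Fr.fn m (H e τ)) t •
          (R.curveCoef Fr (fun r => H r t) e (Fr.coordsSec (R.nablaSection (Fr.vf m) s) (H e t)) +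
            Fr.coords (H e t) (R.nabla (R.nablaSection (Fr.vf m) s) (H e t)
              (velocity (fun r => H r t) e))) +
          d m • Fr.coordsSec (R.nablaSection (Fr.vf m) s) (H e t))) e := by
  have h3 : (fun r => deriv (fun τ => Fr.coordsSec s (H r τ)) t) =ᶠ[𝓝 e] fun r =>
      R.curveCoef Fr (H r) t (Fr.coordsSec s (H r t)) +
        ∑ m, deriv (fun τ => Fr.fn m (H r τ)) t •
          Fr.coordsSec (R.nablaSection (Fr.vf m) s) (H r t) := by
    filter_upwards [h1] with r hr
    rw [(hasDerivAt_coordsSec (R := R) (hgood r t) hr s).deriv,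
      ← sum_deriv_smul_nabla (hgood r t) hr]
    simp only [map_sum, map_smul]
    rfl
  have h4 := hasDerivAt_coordsSec (R := R) (c := fun r => H r t) (hgood e t) h2 s
  rw [← sum_deriv_smul_nabla (c := fun r => H r t) (hgood e t) h2] at h4
  refine HasDerivAt.congr_of_eventuallyEq ?_ h3
  exact (hG.hasDerivAt.clm_apply h4).add (HasDerivAt.fun_sum fun m _ => (hd m).smul
    (hasDerivAt_coordsSec (R := R) (c := fun r => H r t) (hgood e t) h2
      (R.nablaSection (Fr.vf m) s)))

end RepUpToHomotopy

namespace IsSmoothFamily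

variable {B C : Finset ℝ} {H : ℝ → ℝ → M} {x y : M} (h : IsSmoothFamily V B C H x y)
include h

/-- The curvature in coordinates is the commutator of `∂` and `ω₂`. -/
theorem curvature_apply (hFr : ∀ x : M, ∃ Fr : Frame V F E, Fr.Good x)
    (hgood : ∀ e t, Fr.Good (H e t)) {e t : ℝ} (he : e ∈ Ioo (0 : ℝ) 1) (heB : e ∉ B)
    (ht : t ∈ Ioo (0 : ℝ) 1) (htC : t ∉ C) (s : Sec V F E) :
    curvature (fun e t => R.curveCoef Fr (H e) t) (fun e t => R.curveCoef Fr (fun r => H r t) e) e t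
      (Fr.coordsSec s (H e t)) =
    Fr.coords (H e t)
      (R.omega2 (H e t) ![RepUpToHomotopy.velocity (H e) t,
        RepUpToHomotopy.velocity (fun r => H r t) e] (R.del (H e t) (s (H e t))) +
      R.del (H e t) (R.omega2 (H e t) ![RepUpToHomotopy.velocity (H e) t,
        RepUpToHomotopy.velocity (fun r => H r t) e] (s (H e t)))) := by
  have hG := h.isHomotopyCoefficient (R := R) (Fr := Fr)
  have hnear : ∀ {D : Finset ℝ} {r : ℝ}, r ∈ Ioo (0 : ℝ) 1 → r ∉ D →
      ∀ᶠ r in 𝓝 r, r ∈ Ioo (0 : ℝ) 1 ∧ r ∉ D := fun {D r} hr hrD =>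
    (isOpen_Ioo.inter D.finite_toSet.isClosed.isOpen_compl).mem_nhds ⟨hr, by simpa using hrD⟩
  choose d hd hd' using fun m : Fr.κ =>
    exists_hasDerivAt_deriv (h.contDiffAt_comp (Fr.fn m).contMDiff he heB ht htC)
  obtain ⟨k, hk, hk'⟩ :=
    exists_hasDerivAt_deriv (h.contDiffAt_comp (Fr.contMDiff_coordsSec s) he heB ht htC)
  have hmt := h.mdifferentiableAt_snd (Ioo_subset_Icc_self he) ht htC
  have hme := h.mdifferentiableAt_fst he heB (Ioo_subset_Icc_self ht)
  have h1 := RepUpToHomotopy.hasDerivAt_deriv_coordsSec (R := R) (Fr := Fr) (H := H) hgood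
    ((hnear (D := ∅) he (by simp)).mono fun r hr =>
      h.mdifferentiableAt_snd (Ioo_subset_Icc_self hr.1) ht htC) hme
    (hG.hasDerivAt_t_fst he heB ht htC) hd s
  -- The same formula with the two parameters interchanged.
  have h2 := RepUpToHomotopy.hasDerivAt_deriv_coordsSec (R := R) (Fr := Fr)
    (H := fun t e => H e t) (e := t) (t := e) (fun _ _ => hgood _ _)
    ((hnear (D := ∅) ht (by simp)).mono fun r hr =>
      h.mdifferentiableAt_fst he heB (Ioo_subset_Icc_self hr.1)) hmt
    (hG.hasDerivAt_e_snd he heB ht htC) hd' s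
  -- Equality of the mixed derivatives of the coordinates of `s`: the difference of the two sides
  -- contains the curvature of the coefficients and the nested covariant derivatives of
  -- `sum_nabla_nabla`.
  have key := (h1.unique hk).trans (hk'.unique h2)
  rw [← RepUpToHomotopy.sum_nabla_nabla hFr (hgood e t)]
  have hft := fun m => RepUpToHomotopy.curveCoef_eq (Fr := Fr) hmt m
  have hfe := fun m => RepUpToHomotopy.curveCoef_eq (Fr := Fr) hme m
  simp only [← hft, ← hfe]
  simp only [curvature, sub_apply, add_apply, mul_apply_eq_comp]
  simp only [map_add, map_sub, map_sum, map_smul, smul_add, Finset.sum_add_distrib,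
    Finset.sum_sub_distrib] at key ⊢
  simp only [Frame.coordsSec] at key ⊢
  rw [← sub_eq_zero] at key
  rw [← sub_eq_zero, ← neg_eq_zero, ← key]
  abel

end IsSmoothFamily

end Families

end RepHomotopy

end

open Bundle Set MeasureTheory Filter
open scoped Manifold ContDiff DirectSum Topology

noncomputable section

namespace RepHomotopy

variable {V : Type*} [NormedAddCommGroup V] [NormedSpace ℝ V]
  {M : Type*} [TopologicalSpace M] [ChartedSpace V M] [IsManifold 𝓘(ℝ, V) ∞ M]
  {F : Type*} [NormedAddCommGroup F] [NormedSpace ℝ F]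
  {E : M → Type*} [TopologicalSpace (TotalSpace F E)]
  [∀ x, AddCommGroup (E x)] [∀ x, Module ℝ (E x)] [∀ x, TopologicalSpace (E x)]
  [FiberBundle F E] [VectorBundle ℝ F E]


/-! ### Compatibility with the grading -/

section Degrees

namespace Grading

variable (G : Grading V F E)

theorem isCompl (x : M) (n : ℤ) :
    IsCompl (G.piece x n) (⨆ m : {m : ℤ // m ≠ n}, G.piece x m) := by
  have h := (DirectSum.isInternal_submodule_iff_iSupIndep_and_iSup_eq_top _).1 (G.isInternal x)
  rw [iSup_subtype' (p := fun m => m ≠ n) (f := fun m _ => G.piece x m) |>.symm]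
  refine ⟨h.1 n, codisjoint_iff.2 (top_unique ?_)⟩
  rw [← h.2]
  refine iSup_le fun m => ?_
  by_cases hm : m = n
  · rw [hm]
    exact le_sup_left
  · exact le_sup_of_le_right (le_iSup₂_of_le m hm le_rfl)

/-- The projection of a fibre to its part of degree `n`. -/
def pr (x : M) (n : ℤ) : E x →ₗ[ℝ] E x := (G.piece x n).projection _ (G.isCompl x n)

variable {G} {x : M} {n m : ℤ}

theorem pr_mem (u : E x) : G.pr x n u ∈ G.piece x n :=
  Submodule.projection_apply_mem (G.isCompl x n) u

theorem pr_eq_self {u : E x} (hu : u ∈ G.piece x n) : G.pr x n u = u :=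
  Submodule.projection_apply_left (G.isCompl x n) ⟨u, hu⟩

theorem pr_eq_zero {u : E x} (hu : u ∈ G.piece x m) (h : m ≠ n) : G.pr x n u = 0 :=
  Submodule.projection_apply_right (G.isCompl x n) ⟨u, Submodule.mem_iSup_of_mem ⟨m, h⟩ hu⟩

theorem pr_sub_mem (u : E x) : u - G.pr x n u ∈ ⨆ m : {m : ℤ // m ≠ n}, G.piece x m := by
  rw [← Submodule.projection_apply_eq_zero_iff (G.isCompl x n), map_sub]
  exact sub_eq_zero.2 (pr_eq_self (pr_mem u)).symm

variable (G) in
/-- The part of degree `n` of a section. -/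
def prSection (n : ℤ) (s : Sec V F E) : Sec V F E :=
  ⟨fun x => G.pr x n (s x), G.smooth n s _ (fun _ => pr_mem _) fun _ => pr_sub_mem _⟩

@[simp]
theorem prSection_apply (n : ℤ) (s : Sec V F E) (x : M) : G.prSection n s x = G.pr x n (s x) := rfl

theorem exists_section {Fr : Frame V F E} (hx : Fr.Good x) {u : E x} (hu : u ∈ G.piece x n) :
    ∃ s : Sec V F E, s x = u ∧ ∀ y, s y ∈ G.piece y n :=
  ⟨G.prSection n (Fr.through x u), by rw [prSection_apply, hx.through_apply, pr_eq_self hu],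
    fun _ => pr_mem _⟩

end Grading

namespace RepUpToHomotopy

variable {G : Grading V F E} {R : RepUpToHomotopy G} {Fr : Frame V F E} {x : M} {n : ℤ}

theorem delSec_mem {s : Sec V F E} (hs : ∀ y, s y ∈ G.piece y n) (x : M) :
    R.delSec s x ∈ G.piece x (n + 1) := by
  have h := R.degree 0 n s.toForm (fun y _ => hs y) 0 x ![]
  rwa [show n + (0 : ℕ) + 1 - (0 : ℕ) = n + 1 by push_cast; ring] at h

theorem nabla_mem {s : Sec V F E} (hs : ∀ y, s y ∈ G.piece y n) (x : M)
    (X : TangentSpace 𝓘(ℝ, V) x) : R.nabla s x X ∈ G.piece x n := by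
  have h := R.degree 0 n s.toForm (fun y _ => hs y) 1 x ![X]
  rwa [show n + (0 : ℕ) + 1 - (1 : ℕ) = n by push_cast; ring] at h

theorem omega2Sec_mem {s : Sec V F E} (hs : ∀ y, s y ∈ G.piece y n) (x : M)
    (X Y : TangentSpace 𝓘(ℝ, V) x) : R.omega2Sec s x X Y ∈ G.piece x (n - 1) := by
  have h := R.degree 0 n s.toForm (fun y _ => hs y) 2 x ![X, Y]
  rwa [show n + (0 : ℕ) + 1 - (2 : ℕ) = n - 1 by push_cast; ring] at h

theorem del_mem (hx : Fr.Good x) {u : E x} (hu : u ∈ G.piece x n) :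
    R.del x u ∈ G.piece x (n + 1) := by
  obtain ⟨s, rfl, hs⟩ := Grading.exists_section hx hu
  rw [del_apply_sec hx]
  exact delSec_mem hs x

theorem omega2_mem (hx : Fr.Good x) (X Y : TangentSpace 𝓘(ℝ, V) x) {u : E x}
    (hu : u ∈ G.piece x n) : R.omega2 x ![X, Y] u ∈ G.piece x (n - 1) := by
  obtain ⟨s, rfl, hs⟩ := Grading.exists_section hx hu
  rw [omega2_apply_sec hx]
  exact omega2Sec_mem hs x X Y

theorem nabla_add (s t : Sec V F E) (X : TangentSpace 𝓘(ℝ, V) x) :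
    R.nabla (s + t) x X = R.nabla s x X + R.nabla t x X := by
  rw [nabla, toTotal_add, map_add]
  rfl

/-- A tensorial operator on sections vanishes if it vanishes on homogeneous sections. -/
theorem eq_zero_of_tensorial (hx : Fr.Good x) (δ : Sec V F E → E x)
    (hadd : ∀ s t, δ (s + t) = δ s + δ t) (hsmul : ∀ f s, δ (smulSec f s) = f x • δ s)
    (hhom : ∀ (m : ℤ) (s : Sec V F E), (∀ y, s y ∈ G.piece y m) → δ s = 0) (s : Sec V F E) :
    δ s = 0 := by
  have hsum : ∀ t : Finset Fr.ι, ∀ s : Fr.ι → Sec V F E, δ (∑ i ∈ t, s i) = ∑ i ∈ t, δ (s i) := by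
    have h0 : δ 0 = 0 := by simpa using hadd 0 0
    intro t s
    induction t using Finset.cons_induction with
    | empty => simpa using h0
    | cons a t ha ih => rw [Finset.sum_cons, hadd, ih, Finset.sum_cons]
  have hval : ∀ s, δ s = ∑ i, Fr.cov i x (s x) • δ (Fr.sec i) := by
    intro s
    have h1 : smulSec Fr.cut s = ∑ i, smulSec (Fr.coef i s) (Fr.sec i) := by
      ext y
      rw [Frame.sec_sum_apply]
      exact (Fr.sum_sec y (s y)).symm
    have h2 := hsmul Fr.cut s
    rw [hx.cut_eq, one_smul, h1, hsum] at h2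
    rw [← h2]
    simp only [hsmul, Frame.coef_apply]
  have hlin : ∀ u : E x, ∑ i, Fr.cov i x u • δ (Fr.sec i) = 0 := by
    intro u
    have hu : u ∈ ⨆ m, G.piece x m := by
      rw [(G.isInternal x).submodule_iSup_eq_top]
      trivial
    induction hu using Submodule.iSup_induction' with
    | mem m u hu =>
      obtain ⟨s, rfl, hs⟩ := Grading.exists_section hx hu
      rw [← hval, hhom m s hs]
    | zero => simp
    | add u v _ _ h1 h2 =>
      simp only [map_add, add_smul, Finset.sum_add_distrib, h1, h2, add_zero]
  rw [hval, hlin]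

/-- `∇` preserves the grading. -/
theorem nabla_prSection (hx : Fr.Good x) (n : ℤ) (s : Sec V F E) (X : TangentSpace 𝓘(ℝ, V) x) :
    R.nabla (G.prSection n s) x X = G.pr x n (R.nabla s x X) := by
  -- The Leibniz terms cancel in the commutator of `∇` with the projection, so it is linear over
  -- functions. On homogeneous sections it vanishes by the degree axiom.
  refine sub_eq_zero.1 (eq_zero_of_tensorial (G := G) hx
    (fun s => R.nabla (G.prSection n s) x X - G.pr x n (R.nabla s x X)) ?_ ?_ ?_ s)
  · intro s t
    have h1 : G.prSection n (s + t) = G.prSection n s + G.prSection n t := by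
      ext y
      exact map_add (G.pr y n) (s y) (t y)
    simp only [h1, nabla_add, map_add]
    abel
  · intro f s
    have h1 : G.prSection n (smulSec f s) = smulSec f (G.prSection n s) := by
      ext y
      exact map_smul (G.pr y n) (f y) (s y)
    simp only [h1, nabla_smulSec, map_add, map_smul, smul_sub, Grading.prSection_apply]
    abel
  · intro m s hs
    by_cases hm : m = n
    · subst hm
      have h1 : G.prSection m s = s := by
        ext y
        exact Grading.pr_eq_self (hs y)
      simp only [h1, Grading.pr_eq_self (nabla_mem hs x X), sub_self]
    · have h1 : G.prSection n s = smulSec 0 s := by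
        ext y
        exact (Grading.pr_eq_zero (hs y) hm).trans (zero_smul ℝ (s y)).symm
      have h2 : mvfderiv 𝓘(ℝ, V) (0 : C^∞⟮𝓘(ℝ, V), M; ℝ⟯) x = 0 := mvfderiv_const 0
      rw [h1, nabla_smulSec, Grading.pr_eq_zero (nabla_mem hs x X) hm, h2]
      simp

namespace HasPropagator

variable {c : ℝ → M} {C : Finset ℝ} {K : ℝ} {W Z : ℝ → (Fr.ι → ℝ) →L[ℝ] (Fr.ι → ℝ)}
  (h : HasPropagator R Fr c C K W Z) (hFr : ∀ x : M, ∃ Fr : Frame V F E, Fr.Good x)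
  {s t : ℝ} (hs : s ∈ Icc (0 : ℝ) 1) (ht : t ∈ Icc (0 : ℝ) 1) {p q : M} (hp : c s = p)
  (hq : c t = q)
include h hFr hs ht hp hq

theorem del_transport (u : E p) :
    R.del q (R.transport c s t p q u) = R.transport c s t p q (R.del p u) := by
  refine h.transport_comm hs ht (fun x => R.del x) R.delSection (fun s x => ?_)
    (fun s x X => nabla_delSection hFr s X) hp hq u
  obtain ⟨Fr', hx⟩ := hFr x
  rw [del_apply_sec hx, delSection_apply]

theorem transport_mem {u : E p} (hu : u ∈ G.piece p n) :
    R.transport c s t p q u ∈ G.piece q n := by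
  have h1 := h.transport_comm hs ht (fun x => G.pr x n) (G.prSection n) (fun s x => rfl)
    (fun s x X => by
      obtain ⟨Fr', hx⟩ := hFr x
      exact nabla_prSection hx n s X) hp hq u
  rw [Grading.pr_eq_self hu] at h1
  rw [← h1]
  exact Grading.pr_mem _

end HasPropagator

end RepUpToHomotopy

end Degrees

end RepHomotopy

end

open Bundle Set MeasureTheory Filter
open scoped Manifold ContDiff DirectSum Topology

noncomputable section

namespace RepHomotopy

variable {V : Type*} [NormedAddCommGroup V] [NormedSpace ℝ V]
  {M : Type*} [TopologicalSpace M] [ChartedSpace V M] [IsManifold 𝓘(ℝ, V) ∞ M]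
  {F : Type*} [NormedAddCommGroup F] [NormedSpace ℝ F]
  {E : M → Type*} [TopologicalSpace (TotalSpace F E)]
  [∀ x, AddCommGroup (E x)] [∀ x, Module ℝ (E x)] [∀ x, TopologicalSpace (E x)]
  [FiberBundle F E] [VectorBundle ℝ F E]


/-! ### Iterated integrals over the square -/

section DoubleIntegrals

variable {Y : Type*} [NormedAddCommGroup Y] [NormedSpace ℝ Y] {B C : Finset ℝ} {f g : ℝ × ℝ → Y}

/-- The iterated integral over the unit square. -/
def squareIntegral (f : ℝ × ℝ → Y) : Y := ∫ e in (0 : ℝ)..1, ∫ t in (0 : ℝ)..1, f (e, t)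

theorem squareIntegral_congr
    (h : ∀ e ∈ Ioo (0 : ℝ) 1, e ∉ B → ∀ t ∈ Ioo (0 : ℝ) 1, t ∉ C → f (e, t) = g (e, t)) :
    squareIntegral f = squareIntegral g := by
  refine intervalIntegral.integral_congr_ae ?_
  filter_upwards [IsHomotopyCoefficient.ae_uIoc_mem B] with e he he'
  refine intervalIntegral.integral_congr_ae ?_
  filter_upwards [IsHomotopyCoefficient.ae_uIoc_mem C] with t ht ht'
  exact h e (he he').1 (he he').2 t (ht ht').1 (ht ht').2

theorem IsCellwise.squareIntegral_add (hf : IsCellwise B C f) (hg : IsCellwise B C g) :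
    squareIntegral (fun z => f z + g z) = squareIntegral f + squareIntegral g := by
  rw [squareIntegral, squareIntegral, squareIntegral, ← intervalIntegral.integral_add
    (intervalIntegrable_integral_of_integrableOn hf.integrableOn)
    (intervalIntegrable_integral_of_integrableOn hg.integrableOn)]
  refine intervalIntegral.integral_congr_ae ?_
  filter_upwards [IsHomotopyCoefficient.ae_uIoc_mem B] with e he he'
  exact intervalIntegral.integral_add (hf.intervalIntegrable_slice (he he').1 (he he').2)
    (hg.intervalIntegrable_slice (he he').1 (he he').2)

omit [NormedSpace ℝ Y] in
theorem IsCellwise.map (hf : IsCellwise B C f) {Y' : Type*} [TopologicalSpace Y'] {L : Y → Y'}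
    (hL : Continuous L) : IsCellwise B C fun z => L (f z) := by
  intro a b a' b' hab hab'
  obtain ⟨k, hk, hfk⟩ := hf a b a' b' hab hab'
  exact ⟨fun z => L (k z), hL.comp_continuousOn hk, fun z hz => congrArg L (hfk hz)⟩

theorem IsCellwise.squareIntegral_map [CompleteSpace Y] (hf : IsCellwise B C f) (L : Y →L[ℝ] ℝ) :
    squareIntegral (fun z => L (f z)) = L (squareIntegral f) := by
  rw [squareIntegral, squareIntegral, ← L.intervalIntegral_comp_comm
    (intervalIntegrable_integral_of_integrableOn hf.integrableOn)]
  refine intervalIntegral.integral_congr_ae ?_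
  filter_upwards [IsHomotopyCoefficient.ae_uIoc_mem B] with e he he'
  exact L.intervalIntegral_comp_comm (hf.intervalIntegrable_slice (he he').1 (he he').2)

end DoubleIntegrals

/-! ### The homotopy operator -/

section Homotopies

variable {G : Grading V F E} {R : RepUpToHomotopy G} {Fr : Frame V F E}

namespace RepUpToHomotopy

variable {x : M}

theorem omega2Sec_sum_sum {ι κ : Type*} (S : Finset ι) (S' : Finset κ) (s : Sec V F E)
    (a : ι → ℝ) (b : κ → ℝ) (X : ι → TangentSpace 𝓘(ℝ, V) x) (Y : κ → TangentSpace 𝓘(ℝ, V) x) :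
    R.omega2Sec s x (∑ m ∈ S, a m • X m) (∑ n ∈ S', b n • Y n) =
      ∑ m ∈ S, ∑ n ∈ S', (a m * b n) • R.omega2Sec s x (X m) (Y n) := by
  have h0 : ∀ X Y, R.omega2Sec s x X Y =
      ((R.D s.toTotal 2).1 x).toMultilinearMap.toLinearMap ![0, Y] 0 X := fun X Y =>
    congrArg ((R.D s.toTotal 2).1 x) (by ext i; fin_cases i <;> rfl)
  have h1 : ∀ X Y, R.omega2Sec s x X Y =
      ((R.D s.toTotal 2).1 x).toMultilinearMap.toLinearMap ![X, 0] 1 Y := fun X Y =>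
    congrArg ((R.D s.toTotal 2).1 x) (by ext i; fin_cases i <;> rfl)
  have h2 : ∀ Z, R.omega2Sec s x (∑ m ∈ S, a m • X m) Z =
      ∑ m ∈ S, a m • R.omega2Sec s x (X m) Z := by
    intro Z
    simp only [h0, map_sum, map_smul]
  have h3 : ∀ Z, R.omega2Sec s x Z (∑ n ∈ S', b n • Y n) =
      ∑ n ∈ S', b n • R.omega2Sec s x Z (Y n) := by
    intro Z
    simp only [h1, map_sum, map_smul]
  simp only [h2, h3, Finset.smul_sum, smul_smul]

variable (R Fr) in
/-- The form `ω₂` along a family of curves, in coordinates. -/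
def omegaCoef (H : ℝ → ℝ → M) (e t : ℝ) : (Fr.ι → ℝ) →L[ℝ] (Fr.ι → ℝ) :=
  ∑ m, ∑ n, (deriv (fun τ => Fr.fn m (H e τ)) t * deriv (fun r => Fr.fn n (H r t)) e) •
    Fr.matrix (fun k => R.omega2Section (Fr.vf m) (Fr.vf n) (Fr.sec k)) (H e t)

variable (R) in
/-- The vector `T_{H_e}^{t,1} ω₂(∂H/∂t, ∂H/∂e) T_{H_e}^{0,t} u`. -/
def familyIntegrand (H : ℝ → ℝ → M) (x y : M) (u : E x) (e t : ℝ) : E y :=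
  R.transport (H e) t 1 (H e t) y (R.omega2 (H e t)
    ![velocity (H e) t, velocity (fun r => H r t) e] (R.transport (H e) 0 t x (H e t) u))

end RepUpToHomotopy

namespace IsSmoothFamily

variable {B C : Finset ℝ} {H : ℝ → ℝ → M} {x y : M} (h : IsSmoothFamily V B C H x y)
  (hgood : ∀ e t, Fr.Good (H e t))
include h hgood

/-- Expanding both velocities in the frame fields writes `ω₂` through smooth sections over `M` and
partial derivatives of functions, from which cellwise continuity can be read off. -/
theorem omegaCoef_apply {e t : ℝ} (he : e ∈ Ioo (0 : ℝ) 1) (heB : e ∉ B)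
    (ht : t ∈ Ioo (0 : ℝ) 1) (htC : t ∉ C) (w : Fr.ι → ℝ) :
    R.omegaCoef Fr H e t w = Fr.coords (H e t) (R.omega2 (H e t)
      ![RepUpToHomotopy.velocity (H e) t, RepUpToHomotopy.velocity (fun r => H r t) e]
        (Fr.comb (H e t) w)) := by
  have hmt := h.mdifferentiableAt_snd (Ioo_subset_Icc_self he) ht htC
  have hme := h.mdifferentiableAt_fst he heB (Ioo_subset_Icc_self ht)
  have hft := fun m => RepUpToHomotopy.curveCoef_eq (Fr := Fr) hmt m
  have hfe := fun m => RepUpToHomotopy.curveCoef_eq (Fr := Fr) hme m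
  have hX := (hgood e t).sum_vf (RepUpToHomotopy.velocity (H e) t)
  have hY := (hgood e t).sum_vf (RepUpToHomotopy.velocity (fun r => H r t) e)
  simp only [← hft] at hX
  simp only [← hfe] at hY
  have hω : ∀ s : Sec V F E, R.omega2 (H e t)
      ![RepUpToHomotopy.velocity (H e) t, RepUpToHomotopy.velocity (fun r => H r t) e]
        (s (H e t)) = ∑ m, ∑ n, (deriv (fun τ => Fr.fn m (H e τ)) t *
          deriv (fun r => Fr.fn n (H r t)) e) • R.omega2Section (Fr.vf m) (Fr.vf n) s (H e t) := by
    intro s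
    rw [RepUpToHomotopy.omega2_apply_sec (hgood e t)]
    exact (congrArg₂ (R.omega2Sec s (H e t)) hX.symm hY.symm).trans
      (RepUpToHomotopy.omega2Sec_sum_sum _ _ _ _ _ _ _)
  rw [RepUpToHomotopy.omegaCoef, Frame.comb_apply]
  simp only [map_sum, map_smul, hω, sum_apply, smul_apply, Frame.matrix_apply, Finset.smul_sum]
  conv_rhs => rw [Finset.sum_comm]
  refine Finset.sum_congr rfl fun m _ => ?_
  conv_rhs => rw [Finset.sum_comm]
  exact Finset.sum_congr rfl fun n _ => Finset.sum_congr rfl fun k _ => smul_comm _ _ _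

omit hgood in
theorem isCellwise_omegaCoef : IsCellwise B C fun z => R.omegaCoef Fr H z.1 z.2 := by
  have hle : (1 : WithTop ℕ∞) ≤ ∞ := by norm_cast
  intro a b a' b' hab hab'
  have hf := fun m => (h.contDiffOn_comp (Fr.fn m).contMDiff hab hab').of_le hle
  refine ⟨fun z => ∑ m, ∑ n, (fderivWithin ℝ (fun z : ℝ × ℝ => Fr.fn m (H z.1 z.2))
    (Icc a b ×ˢ Icc a' b') z (0, 1) * fderivWithin ℝ (fun z : ℝ × ℝ => Fr.fn n (H z.1 z.2))
      (Icc a b ×ˢ Icc a' b') z (1, 0)) •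
    Fr.matrix (fun k => R.omega2Section (Fr.vf m) (Fr.vf n) (Fr.sec k)) (H z.1 z.2), ?_, ?_⟩
  · refine continuousOn_finsetSum _ fun m _ => continuousOn_finsetSum _ fun n _ => ?_
    exact ((continuousOn_fderivWithin_apply (hf m) hab.lt hab'.lt _).mul
      (continuousOn_fderivWithin_apply (hf n) hab.lt hab'.lt _)).smul
        (h.contDiffOn_comp (Fr.contMDiff_matrix _) hab hab').continuousOn
  · intro z hz
    have h1 : ∀ m, deriv (fun τ => Fr.fn m (H z.1 τ)) z.2 = _ := fun m =>
      (hasDerivAt_snd_of_contDiffOn (hf m) (Ioo_subset_Icc_self hz.1) hz.2).deriv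
    have h2 : ∀ m, deriv (fun r => Fr.fn m (H r z.2)) z.1 = _ := fun m =>
      (hasDerivAt_fst_of_contDiffOn (hf m) hz.1 (Ioo_subset_Icc_self hz.2)).deriv
    simp only [RepUpToHomotopy.omegaCoef, h1, h2]

variable {K : ℝ} {W Z : ℝ → ℝ → (Fr.ι → ℝ) →L[ℝ] (Fr.ι → ℝ)}
  (hK : ∀ e ∈ Icc (0 : ℝ) 1, IsCoefficient (R.curveCoef Fr (H e)) C K)
  (hW : ∀ e ∈ Icc (0 : ℝ) 1, R.HasPropagator Fr (H e) C K (W e) (Z e))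
include hK hW

omit hgood in
theorem isCellwise_propagator {A : ℝ → ℝ → (Fr.ι → ℝ) →L[ℝ] (Fr.ι → ℝ)}
    (hA : IsCellwise B C fun z => A z.1 z.2) :
    IsCellwise B C fun z => W z.1 1 * (Z z.1 z.2 * A z.1 z.2 * W z.1 z.2) := by
  have hG := h.isHomotopyCoefficient (R := R) (Fr := Fr)
  have hP := fun e he => (hW e he).propagator
  have hW1 : ContinuousOn (fun z : ℝ × ℝ => W z.1 1) (Icc 0 1 ×ˢ Icc 0 1) :=
    (hG.continuousOn_W hK hP).comp (f := fun z : ℝ × ℝ => (z.1, (1 : ℝ))) (by fun_prop)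
      fun z hz => mk_mem_prod hz.1 (right_mem_Icc.2 zero_le_one)
  exact (isCellwise_of_continuousOn hW1).mul
    (((isCellwise_of_continuousOn (hG.continuousOn_Z hK hP)).mul hA).mul
      (isCellwise_of_continuousOn (hG.continuousOn_W hK hP)))

-- The transports are `comb ∘ W(1) Z(t) ∘ coords` and `comb ∘ W(t) ∘ coords`. The inner `coords` and
-- `comb` combine with `ω₂` to give `omegaCoef`.
omit hK in
theorem familyIntegrand_eq {e t : ℝ} (he : e ∈ Ioo (0 : ℝ) 1) (heB : e ∉ B)
    (ht : t ∈ Ioo (0 : ℝ) 1) (htC : t ∉ C) (u : E x) :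
    R.familyIntegrand H x y u e t = Fr.comb y ((W e 1 * (Z e t * R.omegaCoef Fr H e t * W e t))
      (Fr.coords x u)) := by
  have hp := hW e (Ioo_subset_Icc_self he)
  have h0 : (0 : ℝ) ∈ Icc (0 : ℝ) 1 := left_mem_Icc.2 zero_le_one
  have h1 : (1 : ℝ) ∈ Icc (0 : ℝ) 1 := right_mem_Icc.2 zero_le_one
  have ht' := Ioo_subset_Icc_self ht
  rw [RepUpToHomotopy.familyIntegrand, hp.transport_apply ht' h1 rfl (h.right e),
    hp.transport_apply h0 ht' (h.left e) rfl, hp.propagator.Z_zero]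
  simp only [mul_apply_eq_comp, h.omegaCoef_apply hgood he heB ht htC]
  rfl

/-- The homotopy operator of a smooth family of curves. -/
theorem exists_homotopyOperator (hFr : ∀ x : M, ∃ Fr : Frame V F E, Fr.Good x) :
    ∃ T : E x →ₗ[ℝ] E y,
      (∀ (u : E x) (φ : E y →ₗ[ℝ] ℝ),
        IntegrableOn (fun z : ℝ × ℝ => φ (R.familyIntegrand H x y u z.1 z.2))
          (Icc 0 1 ×ˢ Icc 0 1) ∧
        φ (T u) = -∫ e in (0 : ℝ)..1, ∫ t in (0 : ℝ)..1, φ (R.familyIntegrand H x y u e t)) ∧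
      (∀ (n : ℤ), ∀ v ∈ G.piece x n, T v ∈ G.piece y (n - 1)) ∧
      R.transport (H 1) 0 1 x y - R.transport (H 0) 0 1 x y = R.del y ∘ₗ T + T ∘ₗ R.del x := by
  have h0 : (0 : ℝ) ∈ Icc (0 : ℝ) 1 := left_mem_Icc.2 zero_le_one
  have h1 : (1 : ℝ) ∈ Icc (0 : ℝ) 1 := right_mem_Icc.2 zero_le_one
  have hG := h.isHomotopyCoefficient (R := R) (Fr := Fr)
  have hP := fun e he => (hW e he).propagator
  let L : E x → (E y →ₗ[ℝ] ℝ) → ((Fr.ι → ℝ) →L[ℝ] (Fr.ι → ℝ)) →L[ℝ] ℝ := fun u φ =>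
    LinearMap.toContinuousLinearMap (φ ∘ₗ Fr.comb y) ∘L
      ContinuousLinearMap.apply ℝ (Fr.ι → ℝ) (Fr.coords x u)
  have hL : ∀ u φ A, L u φ A = φ (Fr.comb y (A (Fr.coords x u))) := fun _ _ _ => rfl
  have cΩ := h.isCellwise_propagator hK hW (h.isCellwise_omegaCoef (R := R) (Fr := Fr))
  have cF := h.isCellwise_propagator hK hW hG.isCellwise_curvature
  have cI : ∀ (u : E x) (φ : E y →ₗ[ℝ] ℝ),
      IsCellwise B C fun z : ℝ × ℝ => φ (R.familyIntegrand H x y u z.1 z.2) :=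
    fun u φ => (cΩ.map (L u φ).continuous).congr fun e he heB t ht htC => by
      rw [hL, ← h.familyIntegrand_eq hgood hW he heB ht htC]
  -- The integral is taken in the normed space of operators on coordinates; the functionals `L u φ`
  -- then pass through it.
  let T : E x →ₗ[ℝ] E y := Fr.comb y ∘ₗ ContinuousLinearMap.toLinearMap
    (-squareIntegral fun z : ℝ × ℝ =>
      W z.1 1 * (Z z.1 z.2 * R.omegaCoef Fr H z.1 z.2 * W z.1 z.2)) ∘ₗ Fr.coords x
  have hT : ∀ (u : E x) (φ : E y →ₗ[ℝ] ℝ), φ (T u) =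
      -squareIntegral fun z : ℝ × ℝ => φ (R.familyIntegrand H x y u z.1 z.2) := by
    intro u φ
    have h2 : φ (T u) = L u φ (-squareIntegral fun z : ℝ × ℝ =>
      W z.1 1 * (Z z.1 z.2 * R.omegaCoef Fr H z.1 z.2 * W z.1 z.2)) := rfl
    rw [h2, map_neg, ← cΩ.squareIntegral_map]
    congr 1
    refine squareIntegral_congr (B := B) (C := C) fun e he heB t ht htC => ?_
    rw [hL, ← h.familyIntegrand_eq hgood hW he heB ht htC]
  refine ⟨T, fun u φ => ⟨(cI u φ).integrableOn, hT u φ⟩, fun n v hv => ?_, ?_⟩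
  -- A functional that kills the piece of degree `n - 1` but not `T v` would annihilate the
  -- integrand, which lies in that piece off the break lines, and hence `T v` itself.
  · by_contra hcon
    obtain ⟨φ, hφ, hφ'⟩ := (G.piece y (n - 1)).exists_dual_map_eq_bot_of_notMem hcon inferInstance
    refine hφ ?_
    rw [hT, squareIntegral_congr (B := B) (C := C) (g := fun _ => 0)]
    · simp [squareIntegral]
    · intro e he heB t ht htC
      have hp := hW e (Ioo_subset_Icc_self he)
      have ht' := Ioo_subset_Icc_self ht
      have h3 := hp.transport_mem hFr ht' h1 rfl (h.right e)
        (RepUpToHomotopy.omega2_mem (R := R) (hgood e t) (RepUpToHomotopy.velocity (H e) t)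
          (RepUpToHomotopy.velocity (fun r => H r t) e)
          (hp.transport_mem hFr h0 ht' (h.left e) rfl hv))
      have h4 : φ (R.familyIntegrand H x y v e t) ∈ (G.piece y (n - 1)).map φ :=
        Submodule.mem_map_of_mem h3
      rw [hφ'] at h4
      exact h4
  · ext u
    refine sub_eq_zero.1 ((Module.forall_dual_apply_eq_zero_iff ℝ _).1 fun φ => ?_)
    rw [map_sub, sub_eq_zero]
    have h2 : φ ((R.del y ∘ₗ T + T ∘ₗ R.del x) u) =
        (φ ∘ₗ R.del y) (T u) + φ (T (R.del x u)) := by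
      simp
    have h3 : φ ((R.transport (H 1) 0 1 x y - R.transport (H 0) 0 1 x y) u) =
        L u φ (W 1 1 - W 0 1) := by
      rw [hL, LinearMap.sub_apply, (hW 1 h1).transport_apply h0 h1 (h.left 1) (h.right 1),
        (hW 0 h0).transport_apply h0 h1 (h.left 0) (h.right 0), (hP 1 h1).Z_zero, (hP 0 h0).Z_zero,
        sub_apply]
      simp
    rw [h2, hT, hT, ← neg_add, ← (cI u _).squareIntegral_add (cI _ φ), h3,
      hG.W_one_sub_eq_integral hK hP]
    refine (map_neg (L u φ) _).trans (congrArg Neg.neg ((cF.squareIntegral_map (L u φ)).symm.trans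
      (squareIntegral_congr (B := B) (C := C) fun e he heB t ht htC => ?_)))
    have hp := hW e (Ioo_subset_Icc_self he)
    have ht' := Ioo_subset_Icc_self ht
    have h5 : W e t (Fr.coords x u) =
        Fr.coords (H e t) (R.transport (H e) 0 t x (H e t) u) := by
      rw [hp.transport_apply h0 ht' (h.left e) rfl]
      have h6 := hp.coords_comb h0 ht'
      rw [h.left e] at h6
      rw [h6, hp.propagator.Z_zero]
      rfl
    -- The curvature formula is available on values of sections, so the transported vector is
    -- extended to one.
    obtain ⟨s, hs⟩ : ∃ s : Sec V F E, s (H e t) = R.transport (H e) 0 t x (H e t) u :=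
      ⟨_, (hgood e t).through_apply _⟩
    have h6 := h.curvature_apply (R := R) hFr hgood he heB ht htC s
    rw [hL]
    simp only [mul_apply_eq_comp, h5, ← hs]
    rw [Frame.coordsSec] at h6
    -- In `∂ ω₂` the outer transport lets `∂` move to the end point `y`; in `ω₂ ∂` the inner one
    -- lets it move to `x`.
    rw [h6, ← hp.transport_apply ht' h1 rfl (h.right e), LinearMap.comp_apply, ← map_add, map_add,
      add_comm, RepUpToHomotopy.familyIntegrand, RepUpToHomotopy.familyIntegrand,
      hp.del_transport hFr ht' h1 rfl (h.right e), ← hp.del_transport hFr h0 ht' (h.left e) rfl, hs]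

end IsSmoothFamily

end Homotopies

end RepHomotopy

end

open Bundle Set MeasureTheory Filter
open scoped Manifold ContDiff DirectSum Topology

noncomputable section

namespace RepHomotopy

variable {V : Type*} [NormedAddCommGroup V] [NormedSpace ℝ V]
  {M : Type*} [TopologicalSpace M] [ChartedSpace V M] [IsManifold 𝓘(ℝ, V) ∞ M]
  {F : Type*} [NormedAddCommGroup F] [NormedSpace ℝ F]
  {E : M → Type*} [TopologicalSpace (TotalSpace F E)]
  [∀ x, AddCommGroup (E x)] [∀ x, Module ℝ (E x)] [∀ x, TopologicalSpace (E x)]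
  [FiberBundle F E] [VectorBundle ℝ F E]


/-! ### Reparametrization, concatenation and the passage from paths to families -/

section Curves

variable {G : Grading V F E} {R : RepUpToHomotopy G} {Fr : Frame V F E}

namespace RepUpToHomotopy

theorem coefAt_smul (x : M) (df : Fr.κ → ℝ) (dP : (Fr.ι → ℝ) →L[ℝ] (Fr.ι → ℝ)) (r : ℝ) :
    R.coefAt Fr x (fun m => r • df m) (r • dP) = r • R.coefAt Fr x df dP := by
  simp only [coefAt, smul_add, smul_neg, Finset.smul_sum, smul_assoc, mul_smul_comm]

/-- The coefficient is linear in the derivatives along the curve, which the chain rule multiplies by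
`a`. -/
theorem curveCoef_comp_affine {c c' : ℝ → M} {a b t : ℝ}
    (hc : ∀ᶠ τ in 𝓝 t, c' τ = c (a * τ + b)) :
    R.curveCoef Fr c' t = a • R.curveCoef Fr c (a * t + b) := by
  have hd : ∀ {Y : Type _} [NormedAddCommGroup Y] [NormedSpace ℝ Y] (f : M → Y),
      deriv (fun τ => f (c' τ)) t = a • deriv (fun τ => f (c τ)) (a * t + b) := by
    intro Y _ _ f
    rw [Filter.EventuallyEq.deriv_eq (hc.mono fun τ hτ => congrArg f hτ),
      deriv_comp_mul_left a (fun z => f (c (z + b))) t,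
      deriv_comp_add_const (f := fun z => f (c z))]
  rw [curveCoef, curveCoef, ← coefAt_smul, hc.self_of_nhds]
  congr 1
  · exact funext fun m => hd (Fr.fn m)
  · exact hd Fr.proj

/-- The propagator of an affine reparametrization of a piece of a curve. -/
theorem HasPropagator.apply_comp_affine {c c' : ℝ → M} {C C' : Finset ℝ} {K K' : ℝ}
    {W Z W' Z' : ℝ → (Fr.ι → ℝ) →L[ℝ] (Fr.ι → ℝ)} (h : R.HasPropagator Fr c C K W Z)
    (h' : R.HasPropagator Fr c' C' K' W' Z') {a b : ℝ} (ha : 0 < a) (hb : 0 ≤ b) (hab : a + b ≤ 1)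
    (hc : ∀ t ∈ Icc (0 : ℝ) 1, c' t = c (a * t + b)) (w : Fr.ι → ℝ) :
    W' 1 (Z' 0 (W b w)) = W (a + b) w := by
  have key := h'.propagator.apply_eq (w := fun t => W (a * t + b) w)
    -- The break times of `c`, pulled back under `t ↦ a t + b`.
    (B₁ := C.image fun r => (r - b) / a)
    (h.propagator.contW.comp (by fun_prop : Continuous fun t : ℝ => a * t + b)
      |>.clm_apply continuous_const).continuousOn ?_
    (left_mem_Icc.2 zero_le_one) (right_mem_Icc.2 zero_le_one)
  · simp only [mul_one, mul_zero, zero_add] at key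
    exact key.symm
  · intro t ht htC
    have ht1 : a * t + b ∈ Ioo (0 : ℝ) 1 :=
      ⟨by have := mul_pos ha ht.1; linarith, by have := mul_lt_mul_of_pos_left ht.2 ha; linarith⟩
    have ht2 : a * t + b ∉ C := fun h2 => htC (Finset.mem_image.2 ⟨_, h2, by field_simp; ring⟩)
    rw [curveCoef_comp_affine (c := c) (a := a) (b := b)
      ((Icc_mem_nhds ht.1 ht.2 : Icc (0 : ℝ) 1 ∈ 𝓝 t) |> fun h3 => eventually_of_mem h3 hc)]
    have h4 : HasDerivAt (fun t : ℝ => a * t + b) a t := by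
      simpa using ((hasDerivAt_id t).const_mul a).add_const b
    exact HasDerivAt.scomp t (h.hasDerivAt ht1 ht2 w) h4

end RepUpToHomotopy

section Paths

variable {x y z : M}

omit [IsManifold 𝓘(ℝ, V) ∞ M] in
-- A single path is a family that does not depend on the parameter, so the results on families also
-- produce its propagator.
theorem IsPiecewiseSmooth.exists_isSmoothFamily {γ : Path x y} (hγ : IsPiecewiseSmooth V γ) :
    ∃ B : Finset ℝ, IsSmoothFamily V ∅ B (fun _ t => γ.extend t) x y := by
  obtain ⟨B, hB⟩ := hγ
  refine ⟨B, γ.continuous_extend.comp continuous_snd, fun a b a' b' _ h => ?_,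
    fun _ => γ.extend_zero, fun _ => γ.extend_one⟩
  exact (hB a' b' h.nonneg h.lt h.le_one h.free).comp
    (contDiff_snd.contMDiff.contMDiffOn (s := Icc a b ×ˢ Icc a' b')) fun z hz => hz.2

omit [IsManifold 𝓘(ℝ, V) ∞ M] in
theorem contMDiffOn_comp_affine {f g : ℝ → M} {a b p q : ℝ} (hp : 0 < p)
    (hf : ContMDiffOn 𝓘(ℝ, ℝ) 𝓘(ℝ, V) ∞ f (Icc (p * a + q) (p * b + q)))
    (hg : ∀ t ∈ Icc a b, g t = f (p * t + q)) :
    ContMDiffOn 𝓘(ℝ, ℝ) 𝓘(ℝ, V) ∞ g (Icc a b) :=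
  (hf.comp (((contDiff_const.mul contDiff_id).add contDiff_const).contMDiff.contMDiffOn
    (f := fun t : ℝ => p * t + q)) fun t ht =>
      ⟨by have := mul_le_mul_of_nonneg_left ht.1 hp.le; linarith,
        by have := mul_le_mul_of_nonneg_left ht.2 hp.le; linarith⟩).congr hg

omit [IsManifold 𝓘(ℝ, V) ∞ M] in
theorem IsPiecewiseSmooth.trans {γ : Path x y} {δ : Path y z} (hγ : IsPiecewiseSmooth V γ)
    (hδ : IsPiecewiseSmooth V δ) : IsPiecewiseSmooth V (γ.trans δ) := by
  obtain ⟨B, hB⟩ := hγ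
  obtain ⟨C, hC⟩ := hδ
  refine ⟨insert (1 / 2) (B.image (fun r => r / 2) ∪ C.image fun r => (r + 1) / 2),
    fun a b ha hab hb hr => ?_⟩
  rcases le_or_gt b (1 / 2) with h1 | h1
  · refine contMDiffOn_comp_affine (p := 2) (q := 0) two_pos
      (hB _ _ (by linarith) (by linarith) (by linarith) fun r hrB hr' => ?_) fun t ht => ?_
    · exact hr (r / 2) (by simp only [Finset.mem_insert, Finset.mem_union, Finset.mem_image]
                           exact Or.inr (Or.inl ⟨r, hrB, rfl⟩))
        ⟨by linarith [hr'.1], by linarith [hr'.2]⟩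
    · rw [add_zero]
      exact Path.extend_trans_of_le_half γ δ (ht.2.trans h1)
  · have h2 : 1 / 2 ≤ a := by
      by_contra! h2
      exact hr (1 / 2) (Finset.mem_insert_self _ _) ⟨h2, h1⟩
    refine contMDiffOn_comp_affine (p := 2) (q := -1) two_pos
      (hC _ _ (by linarith) (by linarith) (by linarith) fun r hrB hr' => ?_) fun t ht => ?_
    · exact hr ((r + 1) / 2) (by simp only [Finset.mem_insert, Finset.mem_union, Finset.mem_image]
                                 exact Or.inr (Or.inr ⟨r, hrB, rfl⟩))
        ⟨by linarith [hr'.1], by linarith [hr'.2]⟩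
    · rw [← sub_eq_add_neg]
      exact Path.extend_trans_of_half_le γ δ (h2.trans ht.1)

theorem IsPiecewiseSmooth.exists_hasPropagator {γ : Path x y} (hγ : IsPiecewiseSmooth V γ)
    (R : RepUpToHomotopy G) (hgood : ∀ t, Fr.Good (γ.extend t)) :
    ∃ (C : Finset ℝ) (K : ℝ) (W Z : ℝ → (Fr.ι → ℝ) →L[ℝ] (Fr.ι → ℝ)),
      R.HasPropagator Fr γ.extend C K W Z := by
  obtain ⟨C, hC⟩ := hγ.exists_isSmoothFamily
  obtain ⟨K, W, Z, h⟩ := hC.exists_hasPropagator (R := R) (Fr := Fr) fun _ t => hgood t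
  exact ⟨C, K, W 0, Z 0, (h 0 (left_mem_Icc.2 zero_le_one)).2⟩

/-- One frame along the concatenation serves both halves, whose propagators are those of the whole
curve on `[0, 1/2]` and `[1/2, 1]`. At `y`, passing to `E y` and back loses nothing because the
solution stays in the image of `coords`. -/
theorem pathTransport_trans {γ : Path x y} {δ : Path y z} (hγ : IsPiecewiseSmooth V γ)
    (hδ : IsPiecewiseSmooth V δ) (R : RepUpToHomotopy G)
    (hgood : ∀ t, Fr.Good ((γ.trans δ).extend t)) :
    R.pathTransport (γ.trans δ) = R.pathTransport δ ∘ₗ R.pathTransport γ := by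
  have h0 : (0 : ℝ) ∈ Icc (0 : ℝ) 1 := left_mem_Icc.2 zero_le_one
  have h1 : (1 : ℝ) ∈ Icc (0 : ℝ) 1 := right_mem_Icc.2 zero_le_one
  have hmem : ∀ {p}, p ∈ range γ ∪ range δ → Fr.Good p := by
    rw [← Path.trans_range, ← Path.extend_range]
    rintro p ⟨t, rfl⟩
    exact hgood t
  obtain ⟨C, K, W, Z, h⟩ := (hγ.trans hδ).exists_hasPropagator R hgood
  obtain ⟨C₁, K₁, W₁, Z₁, hp₁⟩ := hγ.exists_hasPropagator (Fr := Fr) R fun t =>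
    hmem (Or.inl (by rw [← Path.extend_range]; exact mem_range_self t))
  obtain ⟨C₂, K₂, W₂, Z₂, hp₂⟩ := hδ.exists_hasPropagator (Fr := Fr) R fun t =>
    hmem (Or.inr (by rw [← Path.extend_range]; exact mem_range_self t))
  ext u
  have hW0 : W 0 (Fr.coords x u) = Fr.coords x u := by
    have h2 := h.W_Z_apply h0 (Fr.coords x u)
    rwa [h.propagator.Z_zero] at h2
  have key₁ := h.apply_comp_affine hp₁ (a := 1 / 2) (b := 0) (by norm_num) le_rfl (by norm_num)
    (fun t ht => by
      rw [Path.extend_trans_of_le_half γ δ (by linarith [ht.2])]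
      congr 1; ring) (Fr.coords x u)
  have key₂ := h.apply_comp_affine hp₂ (a := 1 / 2) (b := 1 / 2) (by norm_num) (by norm_num)
    (by norm_num) (fun t ht => by
      rw [Path.extend_trans_of_half_le γ δ (by linarith [ht.1])]
      congr 1; ring) (Fr.coords x u)
  rw [hW0, add_zero] at key₁
  rw [add_halves] at key₂
  have h3 : Fr.coords y (Fr.comb y (W₁ 1 (Z₁ 0 (Fr.coords x u)))) =
      W₁ 1 (Z₁ 0 (Fr.coords x u)) := by
    have h4 := hp₁.coords_comb h0 h1
    rw [γ.extend_zero, γ.extend_one] at h4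
    exact h4 u
  rw [LinearMap.comp_apply, RepUpToHomotopy.pathTransport, RepUpToHomotopy.pathTransport,
    RepUpToHomotopy.pathTransport, hp₂.transport_apply h0 h1 δ.extend_zero δ.extend_one,
    hp₁.transport_apply h0 h1 γ.extend_zero γ.extend_one, h3, key₁, key₂,
    h.transport_apply h0 h1 (Path.extend_zero _) (Path.extend_one _), h.propagator.Z_zero]
  rfl

omit [IsManifold 𝓘(ℝ, V) ∞ M] in
theorem IsPiecewiseSmoothHomotopy.exists_isSmoothFamily {γ₀ γ₁ : Path x y} {h : γ₀.Homotopy γ₁}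
    (hh : IsPiecewiseSmoothHomotopy V h) :
    ∃ B C : Finset ℝ, IsSmoothFamily V B C (homotopyMap h) x y := by
  obtain ⟨B, C, hBC⟩ := hh
  refine ⟨B, C, ?_, fun a b a' b' hb hb' => hBC a b a' b' hb.nonneg hb.lt hb.le_one hb'.nonneg
    hb'.lt hb'.le_one hb.free hb'.free, fun e => ?_, fun e => ?_⟩
  · exact h.continuous.comp ((continuous_projIcc.comp continuous_fst).prodMk
      (continuous_projIcc.comp continuous_snd))
  · rw [homotopyMap, projIcc_left]
    exact Path.Homotopy.source h _
  · rw [homotopyMap, projIcc_right]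
    exact Path.Homotopy.target h _

omit [IsManifold 𝓘(ℝ, V) ∞ M] in
theorem homotopyMap_zero {γ₀ γ₁ : Path x y} (h : γ₀.Homotopy γ₁) :
    homotopyMap h 0 = γ₀.extend := by
  funext t
  rw [homotopyMap, projIcc_left]
  exact h.apply_zero _

omit [IsManifold 𝓘(ℝ, V) ∞ M] in
theorem homotopyMap_one {γ₀ γ₁ : Path x y} (h : γ₀.Homotopy γ₁) :
    homotopyMap h 1 = γ₁.extend := by
  funext t
  rw [homotopyMap, projIcc_right]
  exact h.apply_one _

end Paths

end Curves

end RepHomotopy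

end

theorem mainTheorem12
    {V : Type*} [NormedAddCommGroup V] [NormedSpace ℝ V] [FiniteDimensional ℝ V]
    {M : Type*} [TopologicalSpace M] [T2Space M] [ChartedSpace V M] [IsManifold 𝓘(ℝ, V) ∞ M]
    {F : Type*} [NormedAddCommGroup F] [NormedSpace ℝ F] [FiniteDimensional ℝ F]
    {E : M → Type*} [TopologicalSpace (Bundle.TotalSpace F E)]
    [∀ x, AddCommGroup (E x)] [∀ x, Module ℝ (E x)] [∀ x, TopologicalSpace (E x)]
    [FiberBundle F E] [VectorBundle ℝ F E] [ContMDiffVectorBundle ∞ F E 𝓘(ℝ, V)]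
    (G : RepHomotopy.Grading V F E) (R : RepHomotopy.RepUpToHomotopy G) :
    -- the differential and the 2-form underlying `D` are well defined, and the fibers are complexes
    (∀ (s : RepHomotopy.Sec V F E) (x : M), R.del x (s x) = R.delSec s x) ∧
    (∀ (s : RepHomotopy.Sec V F E) (x : M) (X Y : TangentSpace 𝓘(ℝ, V) x),
      R.omega2 x ![X, Y] (s x) = R.omega2Sec s x X Y) ∧
    (∀ x : M, R.del x ∘ₗ R.del x = 0 ∧
      ∀ (n : ℤ), ∀ v ∈ G.piece x n, R.del x v ∈ G.piece x (n + 1)) ∧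
    -- parallel transport along piecewise smooth paths exists, is unique, and is a chain map
    (∀ (x y : M) (γ : Path x y), RepHomotopy.IsPiecewiseSmooth V γ →
      (∀ s ∈ Set.Icc (0 : ℝ) 1, ∀ t ∈ Set.Icc (0 : ℝ) 1, ∀ p q : M,
        γ.extend s = p → γ.extend t = q →
          R.IsParallelTransport γ.extend s t (R.transport γ.extend s t p q)) ∧
      (∀ (n : ℤ), ∀ v ∈ G.piece x n, R.pathTransport γ v ∈ G.piece y n) ∧
      R.del y ∘ₗ R.pathTransport γ = R.pathTransport γ ∘ₗ R.del x) ∧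
    -- compatibility with concatenation
    (∀ (x y z : M) (γ : Path x y) (δ : Path y z),
      RepHomotopy.IsPiecewiseSmooth V γ → RepHomotopy.IsPiecewiseSmooth V δ →
      RepHomotopy.IsPiecewiseSmooth V (γ.trans δ) ∧
      R.pathTransport (γ.trans δ) = R.pathTransport δ ∘ₗ R.pathTransport γ) ∧
    -- homotopic paths
    (∀ (x y : M) (γ₀ γ₁ : Path x y) (h : γ₀.Homotopy γ₁),
      RepHomotopy.IsPiecewiseSmoothHomotopy V h →
      ∃ T : E x →ₗ[ℝ] E y, R.IsHomotopyOperator h T ∧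
        (∀ (n : ℤ), ∀ v ∈ G.piece x n, T v ∈ G.piece y (n - 1)) ∧
        R.pathTransport γ₁ - R.pathTransport γ₀ = R.del y ∘ₗ T + T ∘ₗ R.del x) := by
  have h0 : (0 : ℝ) ∈ Set.Icc (0 : ℝ) 1 := Set.left_mem_Icc.2 zero_le_one
  have h1 : (1 : ℝ) ∈ Set.Icc (0 : ℝ) 1 := Set.right_mem_Icc.2 zero_le_one
  have hFr : ∀ x : M, ∃ Fr : RepHomotopy.Frame V F E, Fr.Good x :=
    RepHomotopy.Frame.exists_good_point
  have hpath : ∀ {x y : M} (γ : Path x y), ∃ Fr : RepHomotopy.Frame V F E,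
      ∀ t, Fr.Good (γ.extend t) := by
    intro x y γ
    obtain ⟨Fr, h⟩ := RepHomotopy.Frame.exists_good (V := V) (F := F) (E := E)
      (isCompact_range γ.continuous)
    exact ⟨Fr, fun t => h _ (γ.extend_range ▸ Set.mem_range_self t)⟩
  refine ⟨fun s x => ?_, fun s x X Y => ?_, fun x => ⟨R.del_comp_del hFr x, fun n v hv => ?_⟩,
    fun x y γ hγ => ?_, fun x y z γ δ hγ hδ => ⟨hγ.trans hδ, ?_⟩, fun x y γ₀ γ₁ h hh => ?_⟩
  · obtain ⟨Fr, hx⟩ := hFr x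
    exact RepHomotopy.RepUpToHomotopy.del_apply_sec hx s
  · obtain ⟨Fr, hx⟩ := hFr x
    exact RepHomotopy.RepUpToHomotopy.omega2_apply_sec hx s X Y
  · obtain ⟨Fr, hx⟩ := hFr x
    exact RepHomotopy.RepUpToHomotopy.del_mem hx hv
  · obtain ⟨Fr, hgood⟩ := hpath γ
    obtain ⟨C, K, W, Z, hp⟩ := hγ.exists_hasPropagator R hgood
    refine ⟨fun s hs t ht p q hpq hq => ?_, fun n v hv => ?_, ?_⟩
    · rw [hp.transport_eq hs ht hpq hq]
      exact hp.isParallelTransport hs ht hpq hq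
    · exact hp.transport_mem hFr h0 h1 γ.extend_zero γ.extend_one hv
    · ext u
      exact hp.del_transport hFr h0 h1 γ.extend_zero γ.extend_one u
  · obtain ⟨Fr, hgood⟩ := hpath (γ.trans δ)
    exact RepHomotopy.pathTransport_trans hγ hδ R hgood
  · obtain ⟨B, C, hH⟩ := hh.exists_isSmoothFamily
    -- The image of the square is compact. `homotopyMap` clamps its arguments to the square, so this
    -- frame is good at all real parameters.
    obtain ⟨Fr, hgood⟩ := RepHomotopy.Frame.exists_good (V := V) (F := F) (E := E)
      (isCompact_range h.continuous)
    have hgood' : ∀ e t, Fr.Good (RepHomotopy.homotopyMap h e t) := fun e t =>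
      hgood _ (Set.mem_range_self _)
    obtain ⟨K, W, Z, hW⟩ := hH.exists_hasPropagator (R := R) hgood'
    obtain ⟨T, hT, hT', hT''⟩ := hH.exists_homotopyOperator hgood' (fun e he => (hW e he).1)
      (fun e he => (hW e he).2) hFr
    rw [RepHomotopy.homotopyMap_zero, RepHomotopy.homotopyMap_one] at hT''
    exact ⟨T, hT, hT', hT''⟩
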